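/- **Conventions.** Minkowski space has signature $(+,-,-,-)$, and $(xy)$ is the Minkowski product, extended bilinearly to $\mathbb C^4$. $H_m=\{p\in\mathbb R^4: p^2=m^2,\ p^0>0\}$ carries the measure $d\mu_m(p)=(2\pi)^{-3}\,d^4p\,\delta(p^2-m^2)\theta(p^0)$. A free field with intertwiner $u$ is $$X(e,x)=\int d\mu_m(p)\int d\tau(\alpha)\,\big[u(e,p)(\alpha)\,a^*(p,\alpha)\,e^{ipx}+\overline{u(e,p)(\alpha)}\,a(p,\alpha)\,e^{-ipx}\big]$$ on the bosonic Fock space over $L^2(H_m,d\mu_m)\otimes L^2(d\tau)$. Its two-point kernel is $\int d\tau(\alpha)\,\overline{u(e_1,p)(\alpha)}\,u(e_2,p)(\alpha)$. String directions $e$ are real with $e^2<0$, or complex in the tube $\mathcal T_+=\{e\in\mathbb C^4: e^2=-1,\ \mathrm{Im}\,e\in V_+\}$. On $e^{ipx}$ the string integration $(I_eX)(x)=\int_0^\infty dt\,X(x+te)$ is multiplication by $i/(ep)_+$, the boundary value from $\mathcal T_+$. **Massive fields.** Let $B_p$ be a measurable family of proper orthochronous Lorentz transformations with $B_p(m,0,0,0)^t=p$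 for $p\in H_m$. Let $E_3:\mathbb R^3\to\mathbb R^4$ be the spatial embedding, and let $T_n$, $n=1,\dots,2s+1$, be an orthonormal basis of the symmetric traceless tensors in $(\mathbb R^3)^{\otimes s}$. The spin-$s$ Proca field $A^{{\rm P}(s)}$ has the intertwiner $(B_pE_3)^{\otimes s}T_n$. Let $F^{{\rm P}(s)}_{[\mu_1\nu_1]\dots[\mu_s\nu_s]}$ be its curl $\partial_\mu A_\nu-\partial_\nu A_\mu$ in every index. Put $a^{(s,s)}_{\mu_1\dots\mu_s}=(I_e)^sF^{{\rm P}(s)}_{[\mu_1\nu_1]\dots[\mu_s\nu_s]}e^{\nu_1}\cdots e^{\nu_s}$ and $-m\,a^{(s,r)}_{\mu_1\dots\mu_r}=\partial^\mu a^{(s,r+1)}_{\mu\mu_1\dots\mu_r}$. Let $$N_0^{(s,0)}=\Big[\frac{\Gamma(\frac12+s)}{\Gamma(\frac12+\frac s2)\,\Gamma(1+\frac s2)}\Big]^{1/2},\qquad X_s(e,x)=N_0^{(s,0)}\,(1-m\sqrt{-e^2}\,I_e)^s\,a^{(s,0)}(e,x).$$ **Standard infinite-spin field.** Let $\kappa>0$,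 and let $B_p$ be a measurable family of proper orthochronous Lorentz transformations with $B_p(1,0,0,1)^t=p$ for $p\in H_0$. Then $\phi^{\kappa(0)}(e,x)$ is the free field on $H_0$ with $\tau=\frac{d\varphi}{2\pi}$ on the circle $\kappa S^1\ni\vec k$ and with the intertwiner $$u^{\kappa(0)}(e,p)(\vec k)=e^{-i\kappa\frac{\sqrt{-e^2}}{(ep)_+}}\;e^{-i\frac{(e\,B_p(0,k^1,k^2,0)^t)}{(ep)_+}} .$$ **Test functions.** Fix a locally finite Borel measure $\nu$ on $\mathbb R^4$ for the smearing in $e$ (for example the invariant measure on $e^2=-1$, or a point mass). A test function $F(e,p)$, the Fourier transform in $x$ of the smearing function, is continuous, compactly supported in $e$ within $\{e^2<0\}$, rapidly decreasing in $p$, and has $1/(ep)$ bounded on its support. The field $X(F)$ creates from the vacuum $\Omega$ the one-particle vector $\psi_F(p,\alpha)=\int d\nu(e)\,F(e,p)\,u(e,p)(\alpha)$. **Corollary.** Up to unitary equivalence, $\phi^{\kappa(0)}$ is the Pauli–Lubanski limit of $X_s$, i.e. the limit $s\to\infty$ with $m=m_s$ given by $m_s^2\,s(s+1)=\kappa^2$.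 Precisely, parametrizing each mass shell by the spatial momentum, for all choices of the families $B_p$ and of the bases $T_n$: 1. (Köhler factor.) The symbol $\big(1-im_s\frac{\sqrt{-e^2}}{(ep)}\big)^s$, $p\in H_{m_s}$, of the operator factor converges to $e^{-i\kappa\sqrt{-e^2}/(ep)}$, $p\in H_0$, locally uniformly in $(e,\vec p)$ with $(ep)\neq0$. 2. The two-point kernels of $X_s$ converge to that of $\phi^{\kappa(0)}$, locally uniformly in $(e_1,e_2,\vec p)$ with $(e_1p)\ne0\ne(e_2p)$ on $H_0$. 3. For every test function $F$, the one-particle vectors of $X_s(F)$ ($s\ge1$) and of $\phi^{\kappa(0)}(F)$ are square integrable. For all test functions, all vacuum expectation values $(\Omega,X_s(F_1)\cdots X_s(F_n)\Omega)$ converge to $(\Omega,\phi^{\kappa(0)}(F_1)\cdots\phi^{\kappa(0)}(F_n)\Omega)$. 4. There are unitary operators $V_s$ from the one-particle space of $X_s$ onto that of $\phi^{\kappa(0)}$ such that, for every test function $F$, $V_s$ maps the one-particle vectors created by $X_s(F)$ to vectors converging in norm to the one created by $\phi^{\kappa(0)}(F)$. -/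

import Mathlib

open MeasureTheory Filter Topology Complex
open scoped ComplexConjugate

noncomputable section

namespace PauliLubanski

/-! ### Minkowski space, mass shells, Lorentz transformations -/

/-- The Minkowski product with signature `(+,-,-,-)`, bilinear over `R`. -/
def mink {R : Type*} [CommRing R] (x y : Fin 4 → R) : R :=
  x 0 * y 0 - x 1 * y 1 - x 2 * y 2 - x 3 * y 3

/-- The metric tensor `η = diag(1,-1,-1,-1)`. -/
def eta : Matrix (Fin 4) (Fin 4) ℝ := Matrix.diagonal ![1, -1, -1, -1]

/-- A real four-vector regarded as a complex one. -/
def toC (v : Fin 4 → ℝ) : Fin 4 → ℂ := fun i => (v i : ℂ)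

/-- Lowering the index of a real four-vector. -/
def lower (v : Fin 4 → ℝ) : Fin 4 → ℝ := fun i => eta i i * v i

/-- The positive-energy mass shell `H_m`. -/
def massShell (m : ℝ) : Set (Fin 4 → ℝ) := {p | mink p p = m ^ 2 ∧ 0 < p 0}

/-- The four-momentum of mass `m` and spatial momentum `k`. -/
def onShell (m : ℝ) (k : Fin 3 → ℝ) : Fin 4 → ℝ :=
  ![Real.sqrt (m ^ 2 + ∑ i, k i ^ 2), k 0, k 1, k 2]

/-- The Lorentz invariant measure `(2π)⁻³ d⁴p δ(p² - m²) θ(p⁰)` on the mass shell, in the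
coordinates given by the spatial momentum: `(2π)⁻³ d³k / (2 p⁰)`. -/
def shellMeasure (m : ℝ) : Measure (Fin 3 → ℝ) :=
  (volume : Measure (Fin 3 → ℝ)).withDensity
    fun k => ENNReal.ofReal (1 / ((2 * Real.pi) ^ 3 * (2 * onShell m k 0)))

/-- The proper orthochronous Lorentz group. -/
def IsProperOrthochronous (L : Matrix (Fin 4) (Fin 4) ℝ) : Prop :=
  L.transpose * eta * L = eta ∧ L.det = 1 ∧ 0 < L 0 0

/-- A (measurable) family of standard boosts: proper orthochronous Lorentz transformations `B p`
that take the reference momentum `pref` to `p`, for every `p` on the mass shell `H_m`. -/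
structure IsBoostFamily (m : ℝ) (pref : Fin 4 → ℝ)
    (B : (Fin 4 → ℝ) → Matrix (Fin 4) (Fin 4) ℝ) : Prop where
  measurable : ∀ i j, Measurable fun p => B p i j
  lorentz : ∀ p ∈ massShell m, IsProperOrthochronous (B p)
  map_ref : ∀ p ∈ massShell m, (B p).mulVec pref = p

/-! ### String directions and string integration -/

/-- The admissible string directions: real spacelike vectors, and the complex vectors of the
forward tube `{e ∈ ℂ⁴ | e² = -1, Im e ∈ V₊}`, from which the real directions are reached as
boundary values. -/
def stringDirections : Set (Fin 4 → ℂ) :=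
  {e | (∃ v : Fin 4 → ℝ, e = toC v ∧ mink v v < 0) ∨
    (mink e e = -1 ∧ 0 < (e 0).im ∧
      0 < mink (fun i => (e i).im) (fun i => (e i).im))}

/-- `√(-e²)`. It is the positive root for real spacelike `e`, and `1` when `e² = -1`. -/
def rootNegSq (e : Fin 4 → ℂ) : ℂ := (-(mink e e)) ^ (1 / 2 : ℂ)

/-- The string integration `(I_e X)(x) = ∫₀^∞ dt X(x + t e)` on the plane wave `exp(i p x)` is the
multiplication by `i / (e p)₊`. For `e` in the forward tube, and for real `e` with `(e p) ≠ 0`, the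
value of this distribution is `i / (e p)`. -/
def stringInt (e : Fin 4 → ℂ) (p : Fin 4 → ℝ) : ℂ := I / mink e (toC p)

/-- The operator `(1 - m √(-e²) I_e)^s` on plane waves `exp(i p x)`. -/
def operatorFactor (m : ℝ) (s : ℕ) (e : Fin 4 → ℂ) (p : Fin 4 → ℝ) : ℂ :=
  (1 - m * rootNegSq e * stringInt e p) ^ s

/-- The Köhler factor `exp(-i κ √(-e²) / (e p)₊)`. -/
def koehlerFactor (κ : ℝ) (e : Fin 4 → ℂ) (p : Fin 4 → ℝ) : ℂ :=
  Complex.exp (-(I * κ * rootNegSq e / mink e (toC p)))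

/-! ### The massive fields of spin `s`

A hermitean free field is `∫ dμ(p) ∑_α [u_α(p) a_α^*(p) exp(ipx) + h.c.]`; it is given by its
intertwiner `u`. Derivatives `∂_μ` and string integrations act on `u` as multiplications by
`i p_μ` and `i / (e p)₊`. -/

/-- The symmetric traceless real tensors of rank `s` over `ℝ³`, a subspace of the Euclidean space
`(ℝ³)^{⊗s}` of all tensors. -/
def stf (s : ℕ) : Submodule ℝ (EuclideanSpace ℝ (Fin s → Fin 3)) where
  carrier := {t | (∀ (σ : Equiv.Perm (Fin s)) (i : Fin s → Fin 3), t (i ∘ σ) = t i) ∧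
    ∀ j l : Fin s, j ≠ l → ∀ i : Fin s → Fin 3,
      ∑ a, t (Function.update (Function.update i j a) l a) = 0}
  add_mem' := by
    rintro x y ⟨hx, hx'⟩ ⟨hy, hy'⟩
    refine ⟨fun σ i => ?_, fun j l h i => ?_⟩
    · simp [hx σ i, hy σ i]
    · simp [Finset.sum_add_distrib, hx' j l h i, hy' j l h i]
  zero_mem' := by simp
  smul_mem' := by
    rintro c x ⟨hx, hx'⟩
    refine ⟨fun σ i => ?_, fun j l h i => ?_⟩
    · simp [hx σ i]
    · simp [← Finset.mul_sum, hx' j l h i]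

/-- The intertwiner `(B_p E₃)^{⊗s} T_n` of the spin `s` Proca field, with covariant (lower)
indices. -/
def procaIntertwiner (s : ℕ) (B : (Fin 4 → ℝ) → Matrix (Fin 4) (Fin 4) ℝ)
    (T : OrthonormalBasis (Fin (2 * s + 1)) ℝ (stf s)) (p : Fin 4 → ℝ) (n : Fin (2 * s + 1))
    (μ : Fin s → Fin 4) : ℂ :=
  ((∏ j, eta (μ j) (μ j)) *
    ∑ i : Fin s → Fin 3, (∏ j, B p (μ j) (i j).succ) *
      (T n : EuclideanSpace ℝ (Fin s → Fin 3)) i : ℝ)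

/-- The total field strength `F_{[μ₁ν₁]…[μₛνₛ]}` of a rank `s` potential `A`, obtained by
the curl `∂_μ A_ν - ∂_ν A_μ` in every index, in momentum space. -/
def fieldStrength (s : ℕ) (p : Fin 4 → ℝ) (A : (Fin s → Fin 4) → ℂ) (μ ν : Fin s → Fin 4) : ℂ :=
  ∑ ρ : Fin s → Fin 4,
    (∏ j, ((if ν j = ρ j then I * (lower p (μ j) : ℂ) else 0) -
      (if μ j = ρ j then I * (lower p (ν j) : ℂ) else 0))) * A ρ

/-- The string-localized potential
`a^{(s,s)}_{μ₁…μₛ} = (I_e)^s F_{[μ₁ν₁]…[μₛνₛ]} e^{ν₁} … e^{νₛ}` in momentum space. -/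
def stringPotential (s : ℕ) (e : Fin 4 → ℂ) (p : Fin 4 → ℝ) (A : (Fin s → Fin 4) → ℂ)
    (μ : Fin s → Fin 4) : ℂ :=
  stringInt e p ^ s * ∑ ν : Fin s → Fin 4, fieldStrength s p A μ ν * ∏ j, e (ν j)

/-- Descent from a rank `r` field `a^{(s,r)}` to the scalar `a^{(s,0)}` by the recursion
`-m a^{(s,r)}_{μ₁…μ_r} = ∂^μ a^{(s,r+1)}_{μ μ₁…μ_r}`, in momentum space. -/
def descend (m : ℝ) (p : Fin 4 → ℝ) : (r : ℕ) → ((Fin r → Fin 4) → ℂ) → ℂ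
  | 0, a => a Fin.elim0
  | r + 1, a => descend m p r fun μ =>
      -(m : ℂ)⁻¹ * ∑ l : Fin 4, I * (p l : ℂ) * a (Fin.cons l μ)

/-- The intertwiner of the scalar escort field `a^{(s,0)}(e,x)`. -/
def escortIntertwiner (m : ℝ) (s : ℕ) (B : (Fin 4 → ℝ) → Matrix (Fin 4) (Fin 4) ℝ)
    (T : OrthonormalBasis (Fin (2 * s + 1)) ℝ (stf s)) (e : Fin 4 → ℂ) (p : Fin 4 → ℝ)
    (n : Fin (2 * s + 1)) : ℂ :=
  descend m p s (stringPotential s e p (procaIntertwiner s B T p n))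

/-- The normalization constant `N₀^{(s,0)}`. -/
def normConst (s : ℕ) : ℝ :=
  Real.sqrt (Real.Gamma (1 / 2 + s) / (Real.Gamma (1 / 2 + s / 2) * Real.Gamma (1 + s / 2)))

/-- The intertwiner of the field `N₀^{(s,0)} (1 - m √(-e²) I_e)^s a^{(s,0)}(e,x)`. -/
def rescaledIntertwiner (m : ℝ) (s : ℕ) (B : (Fin 4 → ℝ) → Matrix (Fin 4) (Fin 4) ℝ)
    (T : OrthonormalBasis (Fin (2 * s + 1)) ℝ (stf s)) (e : Fin 4 → ℂ) (p : Fin 4 → ℝ)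
    (n : Fin (2 * s + 1)) : ℂ :=
  (normConst s : ℂ) * operatorFactor m s e p * escortIntertwiner m s B T e p n

/-- The mass with `κ² = m² s (s + 1)`. -/
def plMass (κ : ℝ) (s : ℕ) : ℝ := κ / Real.sqrt (s * (s + 1))

/-! ### The standard infinite-spin field -/

/-- The standard intertwiner
`u^{κ(0)}(e,p)(k) = exp(-i κ √(-e²) / (e p)₊) exp(-i (e E_p(k)) / (e p)₊)`, where
`E_p(k) = B_p (0, k¹, k², 0)` and `k = κ (cos θ, sin θ)` is given by its angle `θ`. -/
def standardIntertwiner (κ : ℝ) (B : (Fin 4 → ℝ) → Matrix (Fin 4) (Fin 4) ℝ)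
    (e : Fin 4 → ℂ) (p : Fin 4 → ℝ) (θ : ℝ) : ℂ :=
  koehlerFactor κ e p *
    Complex.exp (-(I * mink e (toC ((B p).mulVec ![0, κ * Real.cos θ, κ * Real.sin θ, 0])) /
      mink e (toC p)))

/-- The normalized invariant measure `dθ / 2π` on the circle `κ S¹`, in the angle coordinate. -/
def circleMeasure : Measure ℝ :=
  (ENNReal.ofReal (2 * Real.pi))⁻¹ • (volume : Measure ℝ).restrict (Set.Ioc 0 (2 * Real.pi))

/-! ### Two-point kernels, one-particle vectors -/

/-- The two-point kernel `∫ dτ(α) conj(u(e₁,p)(α)) u(e₂,p)(α)` of `(Ω, φ(e₁,x) φ(e₂,y) Ω)`, where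
`α` is the inner (spin) variable and `τ` the measure on it. -/
def twoPointKernel {α : Type*} [MeasurableSpace α] (τ : Measure α)
    (u : (Fin 4 → ℂ) → (Fin 4 → ℝ) → α → ℂ) (e₁ e₂ : Fin 4 → ℂ) (p : Fin 4 → ℝ) : ℂ :=
  ∫ a, conj (u e₁ p a) * u e₂ p a ∂τ

/-- Test functions in the string direction `e` and the momentum `p` (the Fourier transform of a
test function of `e` and `x`): continuous, of compact support in the spacelike directions `e`,
rapidly decreasing in `p`, and with `1 / (e p)` bounded on the support. -/
structure IsTestFunction (F : (Fin 4 → ℝ) → (Fin 4 → ℝ) → ℂ) : Prop where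
  continuous : Continuous fun x : (Fin 4 → ℝ) × (Fin 4 → ℝ) => F x.1 x.2
  support_dir : ∃ K : Set (Fin 4 → ℝ), IsCompact K ∧ (∀ e ∈ K, mink e e < 0) ∧
    ∀ e, e ∉ K → ∀ p, F e p = 0
  support_away : ∃ δ : ℝ, 0 < δ ∧ ∀ e p, |mink e p| < δ → F e p = 0
  decay : ∀ N : ℕ, ∃ C : ℝ, ∀ e p, ‖p‖ ^ N * ‖F e p‖ ≤ C

/-- The momentum-space form of the complex conjugation of test functions `f(e,x)`. -/
def conjTest (F : (Fin 4 → ℝ) → (Fin 4 → ℝ) → ℂ) : (Fin 4 → ℝ) → (Fin 4 → ℝ) → ℂ :=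
  fun e p => conj (F e (-p))

/-- The one-particle wave function created from the vacuum by the field with intertwiner `u` on the
mass shell `H_m`, smeared with `F`; `ν` is the measure used for the smearing in `e`. -/
def oneParticle {α : Type*} (m : ℝ) (ν : Measure (Fin 4 → ℝ))
    (u : (Fin 4 → ℂ) → (Fin 4 → ℝ) → α → ℂ) (F : (Fin 4 → ℝ) → (Fin 4 → ℝ) → ℂ) :
    (Fin 3 → ℝ) × α → ℂ :=
  fun x => ∫ e, F e (onShell m x.1) * u (toC e) (onShell m x.1) x.2 ∂ν

open Classical in
/-- The class of a square-integrable function in the Hilbert space `L²(μ)`. -/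
def toL2 {X : Type*} [MeasurableSpace X] (μ : Measure X) (f : X → ℂ) : Lp ℂ 2 μ :=
  if h : MemLp f 2 μ then h.toLp f else 0

/-! ### Fock space over `L²(X, μ)` -/

/-- A vector of the Fock space: a sequence of `n`-particle wave functions. -/
abbrev FockVector (X : Type*) := (n : ℕ) → (Fin n → X) → ℂ

/-- The Fock vacuum. -/
def vacuum (X : Type*) : FockVector X
  | 0 => fun _ => 1
  | _ + 1 => fun _ => 0

/-- The bosonic creation operator `a^*(ψ)`. -/
def create {X : Type*} (ψ : X → ℂ) (Φ : FockVector X) : FockVector X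
  | 0 => fun _ => 0
  | n + 1 => fun x =>
      ((Real.sqrt (n + 1))⁻¹ : ℂ) * ∑ i : Fin (n + 1), ψ (x i) * Φ n (i.removeNth x)

/-- The bosonic annihilation operator `a(ψ)`, antilinear in `ψ`. -/
def annihilate {X : Type*} [MeasurableSpace X] (μ : Measure X) (ψ : X → ℂ) (Φ : FockVector X) :
    FockVector X :=
  fun n x => (Real.sqrt (n + 1) : ℂ) * ∫ y, conj (ψ y) * Φ (n + 1) (Fin.cons y x) ∂μ

/-- The inner product of the Fock space. -/
def fockInner {X : Type*} [MeasurableSpace X] (μ : Measure X) (Φ Ψ : FockVector X) : ℂ :=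
  ∑' n, ∫ x, conj (Φ n x) * Ψ n x ∂(Measure.pi fun _ : Fin n => μ)

/-- The smeared free field `φ(F) = a^*(ψ_F) + a(ψ_{F^*})` on the Fock space, where `ψ_F` is the
one-particle vector of the test function `F`. -/
def fieldOp {α : Type*} [MeasurableSpace α] (m : ℝ) (τ : Measure α) (ν : Measure (Fin 4 → ℝ))
    (u : (Fin 4 → ℂ) → (Fin 4 → ℝ) → α → ℂ) (F : (Fin 4 → ℝ) → (Fin 4 → ℝ) → ℂ)
    (Φ : FockVector ((Fin 3 → ℝ) × α)) : FockVector ((Fin 3 → ℝ) × α) :=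
  create (oneParticle m ν u F) Φ +
    annihilate ((shellMeasure m).prod τ) (oneParticle m ν u (conjTest F)) Φ

/-- The vacuum expectation value `(Ω, φ(F₁) ⋯ φ(F_n) Ω)`. -/
def wightman {α : Type*} [MeasurableSpace α] (m : ℝ) (τ : Measure α) (ν : Measure (Fin 4 → ℝ))
    (u : (Fin 4 → ℂ) → (Fin 4 → ℝ) → α → ℂ)
    (Fs : List ((Fin 4 → ℝ) → (Fin 4 → ℝ) → ℂ)) : ℂ :=
  fockInner ((shellMeasure m).prod τ) (vacuum _)
    (Fs.foldr (fun F Φ => fieldOp m τ ν u F Φ) (vacuum _))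

end PauliLubanski

end

open MeasureTheory Filter Topology Complex
open scoped ComplexConjugate

noncomputable section

namespace PauliLubanski

/-! ### Averages over the circle -/

/-! Let w(e) have the components i m (e B_a)/(ep), where B_a are the three spatial columns of the
boost. Curl, string integration and descent act on each tensor index separately, and together they
contract it with w(e). The escort intertwiner is therefore T_n evaluated on s copies of w(e), a
harmonic polynomial of degree s (`escortIntertwiner_eq`). Summation over n gives the reproducing
kernel of harmonic polynomials. Including the square of the normalization constant, the addition
theorem `sum_harmonic_mul_harmonic` turns it into Laplace's integral for a homogenized Legendre
polynomial: the average over θ of (A + i(a cos θ + b sin θ))^s, which depends only on A and D = a² +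
b². By completeness of the boost columns, A = G₁₂ and D = G₁₁G₂₂ - G₁₂² with G(e,f) = 1 -
m²(ef)/((ep)(fp)), where the first direction enters conjugated. All dependence on the boosts and on
the bases T_n has disappeared (`twoPointKernel_rescaledIntertwiner`).

In the Pauli–Lubanski limit s m tends to κ, so s(A - 1) tends to 0 while s²D has a finite limit D₀.
The s-th power becomes an exponential, and Laplace's integral tends to J₀(√D₀)
(`tendsto_laplaceSum`). The operator factors tend to the Köhler factors for the same reason
(`tendsto_operatorFactor`). On the infinite-spin side the average of an exponential linear in k over
the circle is exactly a Bessel function J₀ of the same argument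
(`twoPointKernel_standardIntertwiner`).

For the smeared fields, domination comes from the diagonal of the kernel. For real string directions
it equals (1 + m²(-e²)/(ep)²)^(2s), which is bounded uniformly in s as long as |(ep)| stays away
from 0 (`sum_norm_rescaledIntertwiner_sq_le`). Hence all inner products of one-particle vectors
converge (`tendsto_integral_conj_oneParticle_mul`). The other two limits are formal consequences.
The commutation relations express vacuum expectation values through these inner products
(`tendsto_wightman`). Convergent Gram matrices in separable infinite-dimensional Hilbert spaces can
be realized by unitaries making the vectors themselves converge
(`exists_linearIsometryEquiv_tendsto`). -/

instance isProbabilityMeasure_circleMeasure : IsProbabilityMeasure circleMeasure := by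
  constructor
  simp only [circleMeasure, Measure.smul_apply, Measure.restrict_apply MeasurableSet.univ,
    Set.univ_inter, Real.volume_Ioc, sub_zero, smul_eq_mul]
  exact ENNReal.inv_mul_cancel (by simpa using Real.pi_pos) ENNReal.ofReal_ne_top

theorem integrable_circleMeasure {E : Type*} [NormedAddCommGroup E] {f : ℝ → E}
    (hf : Continuous f) : Integrable f circleMeasure := by
  unfold circleMeasure
  refine Integrable.smul_measure ?_ (by simpa using Real.pi_pos)
  exact (hf.integrableOn_Icc).mono_set Set.Ioc_subset_Icc_self

theorem integral_circleMeasure (f : ℝ → ℂ) :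
    ∫ θ, f θ ∂circleMeasure = (2 * Real.pi : ℂ)⁻¹ * ∫ θ in (0 : ℝ)..(2 * Real.pi), f θ := by
  rw [circleMeasure, integral_smul_measure, intervalIntegral.integral_of_le Real.two_pi_pos.le,
    ENNReal.toReal_inv, ENNReal.toReal_ofReal Real.two_pi_pos.le, Complex.real_smul]
  push_cast
  rfl

theorem integral_exp_int_circleMeasure (n : ℤ) :
    ∫ θ : ℝ, exp (n * (θ * I)) ∂circleMeasure = if n = 0 then 1 else 0 := by
  split_ifs with h
  · simp [h]
  · have hn : (n : ℂ) * I ≠ 0 := by simp [h]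
    have : ∀ θ : ℝ, exp (n * (θ * I)) = exp (n * I * θ) := fun θ => by ring_nf
    simp_rw [integral_circleMeasure, this, integral_exp_mul_complex hn]
    have : exp (n * I * (2 * Real.pi : ℝ)) = 1 := by
      rw [← exp_int_mul_two_pi_mul_I n]
      push_cast
      ring_nf
    rw [this]
    simp

/-- The average of `(i (a cos θ + b sin θ))^j`, as a function of `D = a² + b²`. -/
def circleMoment (D : ℂ) (j : ℕ) : ℂ :=
  if Even j then (j.choose (j / 2)) * (-D / 4) ^ (j / 2) else 0

/-- Only the middle binomial term, with equally many factors of both exponentials, has frequency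
zero and survives the average. -/
theorem integral_exp_add_pow (p q : ℂ) (n : ℕ) :
    ∫ θ : ℝ, (p * exp (θ * I) + q * exp (-(θ * I))) ^ n ∂circleMeasure =
      if Even n then (n.choose (n / 2)) * (p * q) ^ (n / 2) else 0 := by
  have key : ∀ θ : ℝ, (p * exp (θ * I) + q * exp (-(θ * I))) ^ n =
      ∑ m ∈ Finset.range (n + 1),
        (p ^ m * q ^ (n - m) * n.choose m) * exp (((2 * m - n : ℤ) : ℂ) * (θ * I)) := by
    intro θ
    rw [add_pow]
    refine Finset.sum_congr rfl fun m hm => ?_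
    have hm' : m ≤ n := by simpa [Nat.lt_succ_iff] using hm
    have : exp (((2 * m - n : ℤ) : ℂ) * (θ * I)) =
        exp (θ * I) ^ m * exp (-(θ * I)) ^ (n - m) := by
      rw [← exp_nat_mul, ← exp_nat_mul, ← exp_add]
      congr 1
      push_cast [Nat.cast_sub hm']
      ring
    rw [this]
    ring
  simp_rw [key]
  rw [integral_finsetSum _ fun m _ => integrable_circleMeasure (by fun_prop)]
  simp_rw [integral_const_mul, integral_exp_int_circleMeasure]
  split_ifs with h
  · obtain ⟨k, rfl⟩ := h
    have hk : (k + k) / 2 = k := by omega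
    rw [hk, Finset.sum_eq_single k]
    · simp only [Nat.add_sub_cancel]
      rw [if_pos (by push_cast; ring)]
      ring
    · intro m _ hm
      rw [if_neg (by omega), mul_zero]
    · intro hk
      simp at hk
  · refine Finset.sum_eq_zero fun m _ => ?_
    rw [if_neg, mul_zero]
    intro hm
    exact h ⟨m, by omega⟩

theorem I_mul_cos_add_sin (a b : ℂ) (θ : ℝ) :
    I * (a * Real.cos θ + b * Real.sin θ) =
      (I * (a - I * b) / 2) * exp (θ * I) + (I * (a + I * b) / 2) * exp (-(θ * I)) := by
  have h1 : exp (-(θ * I)) = Complex.cos θ - Complex.sin θ * I := by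
    rw [← neg_mul, exp_mul_I, Complex.cos_neg, Complex.sin_neg]
    ring
  rw [exp_mul_I, h1]
  push_cast
  linear_combination (I * b * Complex.sin θ) * I_sq

theorem integral_cos_add_sin_pow (a b : ℂ) (n : ℕ) :
    ∫ θ : ℝ, (I * (a * Real.cos θ + b * Real.sin θ)) ^ n ∂circleMeasure =
      circleMoment (a ^ 2 + b ^ 2) n := by
  simp_rw [I_mul_cos_add_sin, integral_exp_add_pow, circleMoment]
  have : I * (a - I * b) / 2 * (I * (a + I * b) / 2) = -(a ^ 2 + b ^ 2) / 4 := by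
    ring_nf
    have h4 : I ^ 4 = 1 := I_pow_four
    rw [h4, I_sq]
    ring
  rw [this]

/-- The average of `(A + i (a cos θ + b sin θ))^s` as a function of `A` and `D = a² + b²`; for
`A² + D = 1` this is Laplace's integral for the Legendre polynomial `P_s(A)`. -/
def laplaceSum (s : ℕ) (A D : ℂ) : ℂ :=
  ∑ j ∈ Finset.range (s + 1), (s.choose j) * A ^ (s - j) * circleMoment D j

theorem integral_add_cos_add_sin_pow (A a b : ℂ) (s : ℕ) :
    ∫ θ : ℝ, (A + I * (a * Real.cos θ + b * Real.sin θ)) ^ s ∂circleMeasure =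
      laplaceSum s A (a ^ 2 + b ^ 2) := by
  have key : ∀ θ : ℝ, (A + I * (a * Real.cos θ + b * Real.sin θ)) ^ s =
      ∑ j ∈ Finset.range (s + 1), ((s.choose j) * A ^ (s - j)) *
        (I * (a * Real.cos θ + b * Real.sin θ)) ^ j := by
    intro θ
    rw [add_comm, add_pow]
    exact Finset.sum_congr rfl fun j _ => by ring
  simp_rw [key]
  rw [integral_finsetSum _ fun m _ => integrable_circleMeasure (by fun_prop)]
  simp_rw [integral_const_mul, integral_cos_add_sin_pow]
  rfl

/-- With z = exp(iθ) one has 1 + cos θ = (1 + z)²/(2z), so the average picks out the middle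
coefficient of (1 + z)^(2s). This evaluates the constant in the mean value property. -/
theorem integral_one_add_cos_pow (s : ℕ) :
    ∫ θ : ℝ, (1 + (exp (θ * I) + exp (-(θ * I))) / 2) ^ s ∂circleMeasure =
      (Nat.centralBinom s : ℂ) / 2 ^ s := by
  have key : ∀ θ : ℝ, (1 + (exp (θ * I) + exp (-(θ * I))) / 2) ^ s =
      ∑ m ∈ Finset.range (2 * s + 1), (((2 * s).choose m : ℂ) / 2 ^ s) *
        exp (((m - s : ℤ) : ℂ) * (θ * I)) := by
    intro θ
    have h1 : exp (θ * I) * exp (-(θ * I)) = 1 := by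
      rw [← exp_add]
      simp
    have h2 : (1 + (exp (θ * I) + exp (-(θ * I))) / 2) =
        (exp (θ * I) + 1) ^ 2 * exp (-(θ * I)) / 2 := by
      linear_combination (-(1 / 2) * exp (θ * I) - 1) * h1
    rw [h2, div_pow, mul_pow, ← pow_mul, add_pow, Finset.sum_mul, Finset.sum_div]
    refine Finset.sum_congr rfl fun m hm => ?_
    have : exp (((m - s : ℤ) : ℂ) * (θ * I)) = exp (θ * I) ^ m * exp (-(θ * I)) ^ s := by
      rw [← exp_nat_mul, ← exp_nat_mul, ← exp_add]
      congr 1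
      push_cast
      ring
    rw [this]
    ring
  simp_rw [key]
  rw [integral_finsetSum _ fun m _ => integrable_circleMeasure (by fun_prop)]
  simp_rw [integral_const_mul, integral_exp_int_circleMeasure]
  rw [Finset.sum_eq_single s]
  · simp [Nat.centralBinom]
  · intro m _ hm
    rw [if_neg (by omega), mul_zero]
  · intro hk
    simp at hk
    omega

/-- Legendre's duplication formula, applied once at 1/2 + s and once at 1/2 + s/2, turns all the
Gamma values into factorials. -/
theorem normConst_sq (s : ℕ) : (normConst s) ^ 2 = Nat.centralBinom s / 2 ^ s := by
  have hpi : (0 : ℝ) < Real.sqrt Real.pi := Real.sqrt_pos.2 Real.pi_pos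
  have g1 : Real.Gamma (1 / 2 + s) * s.factorial =
      (2 * s).factorial * ((2 : ℝ) ^ (2 * s))⁻¹ * Real.sqrt Real.pi := by
    have h := Real.Gamma_mul_Gamma_add_half (1 / 2 + s)
    have e1 : (1 / 2 + s + 1 / 2 : ℝ) = s + 1 := by ring
    have e2 : (2 * (1 / 2 + s) : ℝ) = ((2 * s : ℕ) : ℝ) + 1 := by push_cast; ring
    have e3 : (1 - 2 * (1 / 2 + s) : ℝ) = -((2 * s : ℕ) : ℝ) := by push_cast; ring
    rwa [e3, e1, e2, Real.Gamma_nat_eq_factorial, Real.Gamma_nat_eq_factorial,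
      Real.rpow_neg (by norm_num), Real.rpow_natCast] at h
  have g2 : Real.Gamma (1 / 2 + s / 2) * Real.Gamma (1 + s / 2) =
      s.factorial * ((2 : ℝ) ^ s)⁻¹ * Real.sqrt Real.pi := by
    have h := Real.Gamma_mul_Gamma_add_half (1 / 2 + s / 2)
    have e1 : (1 / 2 + s / 2 + 1 / 2 : ℝ) = 1 + s / 2 := by ring
    have e2 : (2 * (1 / 2 + s / 2) : ℝ) = s + 1 := by ring
    have e3 : (1 - 2 * (1 / 2 + s / 2) : ℝ) = -(s : ℝ) := by ring
    rwa [e3, e1, e2, Real.Gamma_nat_eq_factorial, Real.rpow_neg (by norm_num),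
      Real.rpow_natCast] at h
  have hf : (0 : ℝ) < s.factorial := by positivity
  have hc : (Nat.centralBinom s : ℝ) * s.factorial * s.factorial = (2 * s).factorial := by
    have := Nat.choose_mul_factorial_mul_factorial (show s ≤ 2 * s by omega)
    rw [show 2 * s - s = s by omega] at this
    rw [Nat.centralBinom]
    exact_mod_cast this
  have g1' : Real.Gamma (1 / 2 + s) =
      Nat.centralBinom s * s.factorial * ((2 : ℝ) ^ (2 * s))⁻¹ * Real.sqrt Real.pi := by
    rw [← hc] at g1
    apply mul_right_cancel₀ hf.ne'
    rw [g1]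
    ring
  rw [normConst, Real.sq_sqrt, g2, g1']
  · rw [two_mul, pow_add]
    field_simp
  · rw [g2, g1']
    positivity

/-- `∑_j circleMoment D j / j! = J₀(√D)`. -/
def besselSum (D : ℂ) : ℂ := ∑' j : ℕ, (j.factorial : ℂ)⁻¹ * circleMoment D j

/-- Termwise integration of the exponential series; it is the infinite-spin counterpart of
`integral_add_cos_add_sin_pow`. -/
theorem integral_exp_cos_add_sin (a b : ℂ) :
    ∫ θ : ℝ, exp (I * (a * Real.cos θ + b * Real.sin θ)) ∂circleMeasure =
      besselSum (a ^ 2 + b ^ 2) := by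
  have hb : ∀ θ : ℝ, ‖I * (a * Real.cos θ + b * Real.sin θ)‖ ≤ ‖a‖ + ‖b‖ := by
    intro θ
    rw [norm_mul, norm_I, one_mul]
    refine (norm_add_le _ _).trans (add_le_add ?_ ?_)
    · rw [norm_mul, Complex.norm_real]
      exact mul_le_of_le_one_right (norm_nonneg _) (Real.abs_cos_le_one θ)
    · rw [norm_mul, Complex.norm_real]
      exact mul_le_of_le_one_right (norm_nonneg _) (Real.abs_sin_le_one θ)
  have hs := hasSum_integral_of_dominated_convergence (μ := circleMeasure)
    (F := fun (j : ℕ) (θ : ℝ) =>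
      (j.factorial : ℂ)⁻¹ * (I * (a * Real.cos θ + b * Real.sin θ)) ^ j)
    (f := fun θ : ℝ => exp (I * (a * Real.cos θ + b * Real.sin θ)))
    (fun j _ => (j.factorial : ℝ)⁻¹ * (‖a‖ + ‖b‖) ^ j)
    (fun j => (integrable_circleMeasure (by fun_prop)).aestronglyMeasurable)
    (fun j => Eventually.of_forall fun θ => by
      rw [norm_mul, norm_inv, norm_pow]
      simp only [Complex.norm_natCast]
      gcongr
      exact hb θ)
    (Eventually.of_forall fun θ => by
      simpa [div_eq_inv_mul] using Real.summable_pow_div_factorial (‖a‖ + ‖b‖))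
    (integrable_const _)
    (Eventually.of_forall fun θ => by
      have := NormedSpace.expSeries_div_hasSum_exp (I * (a * Real.cos θ + b * Real.sin θ))
      rw [← Complex.exp_eq_exp_ℂ] at this
      simpa [div_eq_inv_mul] using this)
  rw [besselSum, ← hs.tsum_eq]
  simp_rw [integral_const_mul, integral_cos_add_sin_pow]

/-- The central binomial coefficient is at most 4^k, which absorbs the denominator. -/
theorem norm_circleMoment_le {D : ℂ} {R : ℝ} (hR : 0 ≤ R) (hD : ‖D‖ ≤ R ^ 2) (j : ℕ) :
    ‖circleMoment D j‖ ≤ R ^ j := by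
  unfold circleMoment
  split_ifs with h
  · obtain ⟨k, rfl⟩ := h
    have hk : (k + k) / 2 = k := by omega
    rw [hk, norm_mul, norm_pow, norm_div, norm_neg]
    have h1 : ((k + k).choose k : ℝ) ≤ 4 ^ k := by
      have := Nat.centralBinom_le_four_pow k
      rw [Nat.centralBinom, two_mul] at this
      exact_mod_cast this
    simp only [Complex.norm_natCast, Complex.norm_ofNat]
    calc ((k + k).choose k : ℝ) * (‖D‖ / 4) ^ k ≤ 4 ^ k * (R ^ 2 / 4) ^ k := by gcongr
      _ = R ^ (k + k) := by rw [← mul_pow, ← two_mul, pow_mul]; congr 1; ring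
  · simp only [norm_zero]
    positivity

theorem circleMoment_mul (t D : ℂ) (j : ℕ) :
    circleMoment (t ^ 2 * D) j = t ^ j * circleMoment D j := by
  unfold circleMoment
  split_ifs with h
  · obtain ⟨k, rfl⟩ := h
    have hk : (k + k) / 2 = k := by omega
    rw [hk, show -(t ^ 2 * D) / 4 = t ^ 2 * (-D / 4) by ring, mul_pow]
    ring
  · simp

theorem continuous_circleMoment (j : ℕ) : Continuous fun D => circleMoment D j := by
  unfold circleMoment
  split_ifs <;> fun_prop

/-- Tannery's theorem, with the exponential series at a fixed radius as the dominating series. -/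
theorem tendsto_tsum_mul_circleMoment {ι : Type*} {l : Filter ι} {c : ι → ℕ → ℂ} {D : ι → ℂ}
    {D₀ : ℂ} (hc : ∀ j, Tendsto (fun i => c i j) l (𝓝 (j.factorial : ℂ)⁻¹))
    (hb : ∀ᶠ i in l, ∀ j, ‖c i j‖ ≤ (j.factorial : ℝ)⁻¹) (hD : Tendsto D l (𝓝 D₀)) :
    Tendsto (fun i => ∑' j, c i j * circleMoment (D i) j) l (𝓝 (besselSum D₀)) := by
  have hR : ∀ᶠ i in l, ‖D i‖ ≤ (‖D₀‖ + 1) ^ 2 := by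
    filter_upwards [hD.norm.eventually_le_const (show ‖D₀‖ < ‖D₀‖ + 1 by linarith)] with i hi
    nlinarith [norm_nonneg D₀]
  refine tendsto_tsum_of_dominated_convergence
    (bound := fun j => (j.factorial : ℝ)⁻¹ * (‖D₀‖ + 1) ^ j) ?_ ?_ ?_
  · simpa [div_eq_inv_mul] using Real.summable_pow_div_factorial (‖D₀‖ + 1)
  · intro j
    exact (hc j).mul (((continuous_circleMoment j).tendsto D₀).comp hD)
  · filter_upwards [hb, hR] with i hi hRi j
    rw [norm_mul]
    gcongr
    · exact hi j
    · exact norm_circleMoment_le (by positivity) hRi j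

theorem continuous_besselSum : Continuous besselSum := by
  refine continuous_iff_continuousAt.2 fun D => ?_
  refine tendsto_tsum_mul_circleMoment (c := fun _ j => (j.factorial : ℂ)⁻¹)
    (fun j => tendsto_const_nhds) (Eventually.of_forall fun D j => ?_) tendsto_id
  rw [norm_inv, Complex.norm_natCast]

/-! ### Symmetric traceless tensors and their reproducing kernel -/

/-- The contraction of a tensor over `ℂ³` with the vectors `v₁, …, vₛ`. -/
def tensorEval {s : ℕ} (t : (Fin s → Fin 3) → ℂ) (v : Fin s → Fin 3 → ℂ) : ℂ :=
  ∑ i, t i * ∏ j, v j (i j)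

/-- Symmetric traceless tensors over `ℂ³`. -/
structure IsSymTraceless {s : ℕ} (t : (Fin s → Fin 3) → ℂ) : Prop where
  symm : ∀ (σ : Equiv.Perm (Fin s)) (i : Fin s → Fin 3), t (i ∘ σ) = t i
  trace : ∀ j l : Fin s, j ≠ l → ∀ i : Fin s → Fin 3,
    ∑ a, t (Function.update (Function.update i j a) l a) = 0

/-- Exchanging the summation variable a with the j-th entry of i is an involution on pairs. It
removes the update and leaves a free sum over three values. -/
theorem sum_sum_update {s : ℕ} (j : Fin s) (f : (Fin s → Fin 3) → ℂ) :
    ∑ i, ∑ a, f (Function.update i j a) = 3 * ∑ i, f i := by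
  have hinv : Function.Involutive
      (fun x : (Fin s → Fin 3) × Fin 3 => (Function.update x.1 j x.2, x.1 j)) := by
    rintro ⟨i, a⟩
    simp
  have h := Equiv.sum_comp hinv.toPerm (fun x => f x.1)
  rw [Fintype.sum_prod_type, Fintype.sum_prod_type] at h
  simpa [Finset.mul_sum] using h

theorem prod_eq_mul_mul_prod_erase {s : ℕ} {j l : Fin s} (hjl : j ≠ l) (f : Fin s → ℂ) :
    ∏ m, f m = f j * f l * ∏ m ∈ (Finset.univ.erase j).erase l, f m := by
  rw [mul_assoc, Finset.mul_prod_erase _ _ (by simpa using hjl.symm),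
    Finset.mul_prod_erase _ _ (Finset.mem_univ j)]

/-- Summing redundantly over the l-th and then the j-th entry costs a factor 9 and makes the
diagonal of the two entries a genuine trace. -/
theorem IsSymTraceless.sum_trace_eq_zero {s : ℕ} {t : (Fin s → Fin 3) → ℂ}
    (ht : IsSymTraceless t) {j l : Fin s} (hjl : j ≠ l) (w : Fin s → Fin 3 → ℂ) :
    ∑ i, t i * ((if i j = i l then 1 else 0) *
      ∏ m ∈ (Finset.univ.erase j).erase l, w m (i m)) = 0 := by
  set P : (Fin s → Fin 3) → ℂ := fun i => ∏ m ∈ (Finset.univ.erase j).erase l, w m (i m)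
    with hP
  have hPj : ∀ i a, P (Function.update i j a) = P i := by
    intro i a
    refine Finset.prod_congr rfl fun m hm => ?_
    have : m ≠ j := by
      rintro rfl
      simp at hm
    rw [Function.update_of_ne this]
  have hPl : ∀ i a, P (Function.update i l a) = P i := by
    intro i a
    refine Finset.prod_congr rfl fun m hm => ?_
    have : m ≠ l := by
      rintro rfl
      simp at hm
    rw [Function.update_of_ne this]
  set S := ∑ i, t i * ((if i j = i l then 1 else 0) * P i) with hS
  have h1 : 3 * S = ∑ i, t (Function.update i l (i j)) * P i := by
    rw [hS, ← sum_sum_update l]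
    refine Finset.sum_congr rfl fun i _ => ?_
    rw [Finset.sum_eq_single (i j)]
    · simp [hPl, Function.update_of_ne hjl]
    · intro b _ hb
      simp [Function.update_of_ne hjl, hb.symm]
    · simp
  have h2 : 3 * (3 * S) = 0 := by
    rw [h1, ← sum_sum_update j]
    refine Finset.sum_eq_zero fun i _ => ?_
    simp only [hPj, Function.update_self]
    rw [← Finset.sum_mul, ht.trace j l hjl, zero_mul]
  simpa using h2

theorem IsSymTraceless.tensorEval_comp {s : ℕ} {t : (Fin s → Fin 3) → ℂ}
    (ht : IsSymTraceless t) (v : Fin s → Fin 3 → ℂ) (σ : Equiv.Perm (Fin s)) :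
    tensorEval t (v ∘ σ) = tensorEval t v := by
  unfold tensorEval
  rw [← Equiv.sum_comp (Equiv.arrowCongr σ.symm (Equiv.refl (Fin 3)))]
  refine Finset.sum_congr rfl fun i _ => ?_
  have h1 : (Equiv.arrowCongr σ.symm (Equiv.refl (Fin 3))) i = i ∘ σ := by
    ext
    simp [Equiv.arrowCongr]
  rw [h1, ht.symm, ← Equiv.prod_comp σ fun j => v j (i j)]
  rfl

/-- Replacing a conjugate pair of null vectors by the axis changes the sign. -/
theorem IsSymTraceless.tensorEval_update_update {s : ℕ} {t : (Fin s → Fin 3) → ℂ}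
    (ht : IsSymTraceless t) {v : Fin 3 → Fin 3 → ℂ}
    (hv : ∀ a b, v 1 a * v 2 b + v 2 a * v 1 b = 2 * ((if a = b then 1 else 0) - v 0 a * v 0 b))
    {g : Fin s → Fin 3} {j l : Fin s} (hj : g j = 1) (hl : g l = 2) :
    tensorEval t (v ∘ g) =
      -tensorEval t (v ∘ Function.update (Function.update g j 0) l 0) := by
  have hjl : j ≠ l := by
    rintro rfl
    simp [hj] at hl
  have h1 : tensorEval t (v ∘ (g ∘ Equiv.swap j l)) = tensorEval t (v ∘ g) :=
    ht.tensorEval_comp (v ∘ g) _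
  -- By `hv` the symmetrized product of the null pair plus twice the square of the axis is twice the
  -- identity, which a traceless tensor annihilates.
  have h2 : tensorEval t (v ∘ g) + tensorEval t (v ∘ (g ∘ Equiv.swap j l)) +
      2 * tensorEval t (v ∘ Function.update (Function.update g j 0) l 0) = 0 := by
    refine Eq.trans ?_ ((congrArg (2 * ·) (ht.sum_trace_eq_zero hjl (v ∘ g))).trans (mul_zero 2))
    unfold tensorEval
    rw [Finset.mul_sum, Finset.mul_sum, ← Finset.sum_add_distrib, ← Finset.sum_add_distrib]
    refine Finset.sum_congr rfl fun i _ => ?_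
    rw [prod_eq_mul_mul_prod_erase hjl, prod_eq_mul_mul_prod_erase hjl,
      prod_eq_mul_mul_prod_erase hjl]
    have e1 : ∏ m ∈ (Finset.univ.erase j).erase l, (v ∘ (g ∘ Equiv.swap j l)) m (i m) =
        ∏ m ∈ (Finset.univ.erase j).erase l, (v ∘ g) m (i m) := by
      refine Finset.prod_congr rfl fun m hm => ?_
      simp only [Finset.mem_erase, Finset.mem_univ, and_true] at hm
      simp [Equiv.swap_apply_of_ne_of_ne hm.2 hm.1]
    have e2 : ∏ m ∈ (Finset.univ.erase j).erase l,
          (v ∘ Function.update (Function.update g j 0) l 0) m (i m) =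
        ∏ m ∈ (Finset.univ.erase j).erase l, (v ∘ g) m (i m) := by
      refine Finset.prod_congr rfl fun m hm => ?_
      simp only [Finset.mem_erase, Finset.mem_univ, and_true] at hm
      simp [Function.update_of_ne hm.2, Function.update_of_ne hm.1]
    rw [e1, e2]
    simp only [Function.comp_apply, hj, hl, Equiv.swap_apply_left, Equiv.swap_apply_right,
      Function.update_self, Function.update_of_ne hjl]
    linear_combination (t i * ∏ m ∈ (Finset.univ.erase j).erase l, v (g m) (i m)) *
      hv (i j) (i l)
  rw [h1] at h2
  linear_combination (1 / 2) * h2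

/-- The weight of a frame vector under rotations about the axis. -/
def frameWeight : Fin 3 → ℤ := ![0, 1, -1]

/-- The degree of a frame vector in the plane orthogonal to the axis. -/
def frameDegree : Fin 3 → ℕ := ![0, 1, 1]

theorem sum_eq_add_add_sum_erase {M : Type*} [AddCommMonoid M] {s : ℕ} {j l : Fin s}
    (hjl : j ≠ l) (f : Fin s → M) :
    ∑ m, f m = f j + f l + ∑ m ∈ (Finset.univ.erase j).erase l, f m := by
  rw [add_assoc, Finset.add_sum_erase _ _ (by simpa using hjl.symm),
    Finset.add_sum_erase _ _ (Finset.mem_univ j)]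

/-- Weight zero with some nonzero degree forces both signs of the weight to occur; otherwise the
total weight would have a strict sign. -/
theorem exists_eq_one_and_eq_two {s : ℕ} {g : Fin s → Fin 3}
    (hg : ∑ j, frameWeight (g j) = 0) (hd : ∑ j, frameDegree (g j) ≠ 0) :
    ∃ j l, g j = 1 ∧ g l = 2 := by
  obtain ⟨j, -, hj⟩ := Finset.exists_ne_zero_of_sum_ne_zero hd
  have h1 : ∀ a : Fin 3, a = 0 ∨ a = 1 ∨ a = 2 := by decide
  have h2 : ∃ j, g j = 1 := by
    by_contra! hno
    have : ∑ j, frameWeight (g j) < 0 := by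
      refine Finset.sum_neg' (fun i _ => ?_) ⟨j, Finset.mem_univ j, ?_⟩
      · rcases h1 (g i) with h | h | h
        · simp [h, frameWeight]
        · exact (hno i h).elim
        · simp [h, frameWeight]
      · rcases h1 (g j) with h | h | h
        · simp [h, frameDegree] at hj
        · exact (hno j h).elim
        · simp [h, frameWeight]
    omega
  have h3 : ∃ j, g j = 2 := by
    by_contra! hno
    have : 0 < ∑ j, frameWeight (g j) := by
      refine Finset.sum_pos' (fun i _ => ?_) ⟨j, Finset.mem_univ j, ?_⟩
      · rcases h1 (g i) with h | h | h
        · simp [h, frameWeight]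
        · simp [h, frameWeight]
        · exact (hno i h).elim
      · rcases h1 (g j) with h | h | h
        · simp [h, frameDegree] at hj
        · simp [h, frameWeight]
        · exact (hno j h).elim
    omega
  obtain ⟨a, ha⟩ := h2
  obtain ⟨b, hb⟩ := h3
  exact ⟨a, b, ha, hb⟩

/-- Induction on the degree: a null pair is traded for two axis vectors at the cost of a sign, and
this sign cancels against (i/2)² = -(1/2)². -/
theorem IsSymTraceless.tensorEval_balanced {s : ℕ} {t : (Fin s → Fin 3) → ℂ}
    (ht : IsSymTraceless t) {v : Fin 3 → Fin 3 → ℂ}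
    (hv : ∀ a b, v 1 a * v 2 b + v 2 a * v 1 b = 2 * ((if a = b then 1 else 0) - v 0 a * v 0 b))
    (g : Fin s → Fin 3) (hg : ∑ j, frameWeight (g j) = 0) :
    (I / 2) ^ (∑ j, frameDegree (g j)) * tensorEval t (v ∘ g) =
      (1 / 2) ^ (∑ j, frameDegree (g j)) * tensorEval t (fun _ => v 0) := by
  induction hD : ∑ j, frameDegree (g j) using Nat.strong_induction_on generalizing g with
  | _ D ih =>
    rcases Nat.eq_zero_or_pos D with rfl | hpos
    · have : g = fun _ => 0 := by
        funext j
        have h1 := (Finset.sum_eq_zero_iff.1 hD) j (Finset.mem_univ j)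
        have h2 : ∀ a : Fin 3, frameDegree a = 0 → a = 0 := by decide
        exact h2 _ h1
      simp [this, Function.comp_def]
    · obtain ⟨j, l, hj, hl⟩ := exists_eq_one_and_eq_two hg (by omega)
      have hjl : j ≠ l := by
        rintro rfl
        simp [hj] at hl
      set g' := Function.update (Function.update g j 0) l 0 with hg'
      have hsame : ∀ m ∈ (Finset.univ.erase j).erase l, g' m = g m := by
        intro m hm
        simp only [Finset.mem_erase, Finset.mem_univ, and_true] at hm
        simp [g', Function.update_of_ne hm.2, Function.update_of_ne hm.1]
      have hj' : g' j = 0 := by simp [g', Function.update_of_ne hjl]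
      have hl' : g' l = 0 := by simp [g']
      have hd' : ∑ j, frameDegree (g j) = 2 + ∑ j, frameDegree (g' j) := by
        rw [sum_eq_add_add_sum_erase hjl, sum_eq_add_add_sum_erase hjl, hj, hl, hj', hl',
          Finset.sum_congr rfl fun m hm => congrArg frameDegree (hsame m hm)]
        simp [frameDegree]
      have hw' : ∑ j, frameWeight (g' j) = 0 := by
        rw [← hg, sum_eq_add_add_sum_erase hjl, sum_eq_add_add_sum_erase hjl (fun j =>
          frameWeight (g j)), hj, hl, hj', hl',
          Finset.sum_congr rfl fun m hm => congrArg frameWeight (hsame m hm)]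
        simp [frameWeight]
      have := ih (∑ j, frameDegree (g' j)) (by omega) g' hw' rfl
      rw [ht.tensorEval_update_update hv hj hl, ← hD, hd', pow_add, pow_add, mul_assoc, mul_assoc,
        ← this, div_pow, I_sq]
      ring

/-- The coefficients of the frame vectors in a null vector rotated by the angle `θ`. -/
def frameCoeff (r : ℂ) (θ : ℝ) : Fin 3 → ℂ := ![1, r * exp (θ * I), r * exp (-(θ * I))]

theorem frameCoeff_eq (r : ℂ) (θ : ℝ) (c : Fin 3) :
    frameCoeff r θ c = r ^ frameDegree c * exp (frameWeight c * (θ * I)) := by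
  fin_cases c <;> simp [frameCoeff, frameDegree, frameWeight]

theorem continuous_frameCoeff (r : ℂ) (c : Fin 3) : Continuous fun θ => frameCoeff r θ c := by
  simp_rw [frameCoeff_eq]
  fun_prop

/-- The average projects onto words that are invariant under rotations about the axis. -/
theorem integral_prod_frameCoeff {s : ℕ} (r : ℂ) (g : Fin s → Fin 3) :
    ∫ θ, ∏ j, frameCoeff r θ (g j) ∂circleMeasure =
      if ∑ j, frameWeight (g j) = 0 then r ^ (∑ j, frameDegree (g j)) else 0 := by
  have : ∀ θ : ℝ, ∏ j, frameCoeff r θ (g j) = r ^ (∑ j, frameDegree (g j)) *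
      exp (((∑ j, frameWeight (g j) : ℤ) : ℂ) * (θ * I)) := by
    intro θ
    simp_rw [frameCoeff_eq]
    rw [Finset.prod_mul_distrib, Finset.prod_pow_eq_pow_sum, ← exp_sum, ← Finset.sum_mul]
    push_cast
    rfl
  simp_rw [this, integral_const_mul, integral_exp_int_circleMeasure]
  simp

theorem tensorEval_sum {s : ℕ} (t : (Fin s → Fin 3) → ℂ) (v : Fin 3 → Fin 3 → ℂ)
    (c : Fin 3 → ℂ) :
    tensorEval t (fun _ a => ∑ b, c b * v b a) =
      ∑ g : Fin s → Fin 3, (∏ j, c (g j)) * tensorEval t (v ∘ g) := by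
  unfold tensorEval
  simp_rw [Fintype.prod_sum, Finset.mul_sum]
  rw [Finset.sum_comm]
  refine Finset.sum_congr rfl fun g _ => Finset.sum_congr rfl fun i _ => ?_
  rw [Finset.prod_mul_distrib]
  simp only [Function.comp_apply]
  ring

/-- The mean value property of harmonic polynomials over a circle of null vectors. -/
theorem IsSymTraceless.integral_tensorEval {s : ℕ} {t : (Fin s → Fin 3) → ℂ}
    (ht : IsSymTraceless t) {v : Fin 3 → Fin 3 → ℂ}
    (hv : ∀ a b, v 1 a * v 2 b + v 2 a * v 1 b =
      2 * ((if a = b then 1 else 0) - v 0 a * v 0 b)) :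
    ∫ θ, tensorEval t (fun _ a => ∑ b, frameCoeff (I / 2) θ b * v b a) ∂circleMeasure =
      (normConst s : ℂ) ^ 2 * tensorEval t (fun _ => v 0) := by
  have hint : ∀ (r : ℂ) (g : Fin s → Fin 3),
      Integrable (fun θ => ∏ j, frameCoeff r θ (g j)) circleMeasure := fun r g =>
    integrable_circleMeasure (continuous_finsetProd _ fun j _ => continuous_frameCoeff r (g j))
  -- With r = 1/2 the three frame coefficients add up to 1 + cos θ. The squared normalization
  -- constant is thus the sum over balanced words that `tensorEval_balanced` produces below.
  have hN : (normConst s : ℂ) ^ 2 = ∑ g : Fin s → Fin 3,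
      if ∑ j, frameWeight (g j) = 0 then (1 / 2 : ℂ) ^ (∑ j, frameDegree (g j)) else 0 := by
    rw [← ofReal_pow, normConst_sq]
    push_cast
    rw [← integral_one_add_cos_pow]
    have : ∀ θ : ℝ, (1 + (exp (θ * I) + exp (-(θ * I))) / 2) ^ s =
        ∑ g : Fin s → Fin 3, ∏ j, frameCoeff (1 / 2) θ (g j) := by
      intro θ
      have h := Fintype.prod_sum (fun (_ : Fin s) (b : Fin 3) => frameCoeff (1 / 2) θ b)
      rw [← h, Finset.prod_const, Finset.card_univ, Fintype.card_fin]
      congr 1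
      simp [Fin.sum_univ_three, frameCoeff]
      ring
    simp_rw [this]
    rw [integral_finsetSum _ fun g _ => hint _ g]
    exact Finset.sum_congr rfl fun g _ => integral_prod_frameCoeff _ _
  simp_rw [tensorEval_sum]
  rw [integral_finsetSum _ fun g _ => (hint _ g).mul_const _, hN, Finset.sum_mul]
  refine Finset.sum_congr rfl fun g _ => ?_
  rw [integral_mul_const, integral_prod_frameCoeff]
  split_ifs with h
  · exact ht.tensorEval_balanced hv g h
  · simp

/-- Each trace of the tensor power contributes the factor w·w = 0. -/
theorem isSymTraceless_null_pow {s : ℕ} {w : Fin 3 → ℂ} (hw : ∑ a, w a * w a = 0) :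
    IsSymTraceless fun i : Fin s → Fin 3 => ∏ j, w (i j) := by
  constructor
  · intro σ i
    exact Equiv.prod_comp σ fun j => w (i j)
  · intro j l hjl i
    have : ∀ a, ∏ m, w (Function.update (Function.update i j a) l a m) =
        (w a * w a) * ∏ m ∈ (Finset.univ.erase j).erase l, w (i m) := by
      intro a
      rw [prod_eq_mul_mul_prod_erase hjl]
      congr 1
      · simp [Function.update_of_ne hjl]
      · refine Finset.prod_congr rfl fun m hm => ?_
        simp only [Finset.mem_erase, Finset.mem_univ, and_true] at hm
        simp [Function.update_of_ne hm.2, Function.update_of_ne hm.1]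
    simp_rw [this, ← Finset.sum_mul, hw, zero_mul]

/-- The harmonic polynomial of a real symmetric traceless tensor. -/
def harmonic {s : ℕ} (t : stf s) (w : Fin 3 → ℂ) : ℂ :=
  tensorEval (fun i => (((t : EuclideanSpace ℝ (Fin s → Fin 3)) i : ℝ) : ℂ)) fun _ => w

theorem isSymTraceless_coe {s : ℕ} (t : stf s) :
    IsSymTraceless fun i => (((t : EuclideanSpace ℝ (Fin s → Fin 3)) i : ℝ) : ℂ) := by
  obtain ⟨t, h1, h2⟩ := t
  constructor
  · intro σ i
    simp [h1 σ i]
  · intro j l hjl i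
    have := h2 j l hjl i
    exact_mod_cast this

/-- The basis expansion of a vector, applied to real and imaginary parts separately, because the
tensor space is real. -/
theorem sum_basis_mul_sum {s : ℕ} {ι : Type*} [Fintype ι] (T : OrthonormalBasis ι ℝ (stf s))
    {t : (Fin s → Fin 3) → ℂ} (ht : IsSymTraceless t) (i : Fin s → Fin 3) :
    ∑ n, (((T n : EuclideanSpace ℝ (Fin s → Fin 3)) i : ℝ) : ℂ) *
      ∑ i', (((T n : EuclideanSpace ℝ (Fin s → Fin 3)) i' : ℝ) : ℂ) * t i' = t i := by
  have hreal : ∀ x : stf s, ∑ n, ((T n : EuclideanSpace ℝ (Fin s → Fin 3)) i) *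
      ∑ i', ((T n : EuclideanSpace ℝ (Fin s → Fin 3)) i') *
        (x : EuclideanSpace ℝ (Fin s → Fin 3)) i' = (x : EuclideanSpace ℝ (Fin s → Fin 3)) i := by
    intro x
    have h := congrArg (fun y : stf s => (y : EuclideanSpace ℝ (Fin s → Fin 3)) i)
      (T.sum_repr' x)
    simp only at h
    rw [← h]
    simp only [AddSubmonoidClass.coe_finsetSum, SetLike.val_smul, WithLp.ofLp_sum,
      Finset.sum_apply, smul_eq_mul, Submodule.coe_inner, PiLp.inner_apply,
      RCLike.inner_apply, conj_trivial, WithLp.ofLp_smul, Pi.smul_apply]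
    refine Finset.sum_congr rfl fun n _ => ?_
    rw [mul_comm]
    congr 1
    exact Finset.sum_congr rfl fun _ _ => mul_comm _ _
  let xr : stf s := ⟨WithLp.toLp 2 fun i => (t i).re, by
    refine ⟨fun σ i => ?_, fun j l h i => ?_⟩
    · simp [ht.symm σ i]
    · simpa using congrArg Complex.re (ht.trace j l h i)⟩
  let xi : stf s := ⟨WithLp.toLp 2 fun i => (t i).im, by
    refine ⟨fun σ i => ?_, fun j l h i => ?_⟩
    · simp [ht.symm σ i]
    · simpa using congrArg Complex.im (ht.trace j l h i)⟩
  have hr := hreal xr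
  have hi := hreal xi
  apply Complex.ext
  · simpa [xr] using hr
  · simpa [xi] using hi

/-- The power of a null vector is already symmetric and traceless. The projection defined by the
basis fixes it, and the sum is a plain contraction of tensor powers. -/
theorem sum_harmonic_mul_harmonic_null {s : ℕ} {ι : Type*} [Fintype ι]
    (T : OrthonormalBasis ι ℝ (stf s)) (w : Fin 3 → ℂ) {w' : Fin 3 → ℂ}
    (hw' : ∑ a, w' a * w' a = 0) :
    ∑ n, harmonic (T n) w * harmonic (T n) w' = (∑ a, w a * w' a) ^ s := by
  have h1 : (∑ a, w a * w' a) ^ s = ∑ i : Fin s → Fin 3, (∏ j, w' (i j)) * ∏ j, w (i j) := by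
    have h := Fintype.prod_sum (fun (_ : Fin s) (a : Fin 3) => w a * w' a)
    rw [Finset.prod_const, Finset.card_univ, Fintype.card_fin] at h
    rw [h]
    exact Finset.sum_congr rfl fun i _ => by rw [Finset.prod_mul_distrib, mul_comm]
  rw [h1]
  simp only [harmonic]
  simp_rw [tensorEval, Finset.sum_mul]
  rw [Finset.sum_comm]
  refine Finset.sum_congr rfl fun i _ => ?_
  rw [← sum_basis_mul_sum T (isSymTraceless_null_pow hw') i, Finset.sum_mul]
  exact Finset.sum_congr rfl fun n _ => by ring

theorem laplaceSum_mul (s : ℕ) (c A D : ℂ) :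
    laplaceSum s (c * A) (c ^ 2 * D) = c ^ s * laplaceSum s A D := by
  unfold laplaceSum
  rw [Finset.mul_sum]
  refine Finset.sum_congr rfl fun j hj => ?_
  have hj' : j ≤ s := by simpa [Nat.lt_succ_iff] using hj
  rw [circleMoment_mul, mul_pow]
  have : c ^ s = c ^ (s - j) * c ^ j := by rw [← pow_add, Nat.sub_add_cancel hj']
  rw [this]
  ring

/-- A complex unit vector can be completed to an orthonormal frame. -/
theorem exists_orthonormal_frame {z : Fin 3 → ℂ} (hz : ∑ a, z a * z a = 1) :
    ∃ x y : Fin 3 → ℂ, ∀ a b, x a * x b + y a * y b + z a * z b = if a = b then 1 else 0 := by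
  obtain ⟨y, hy1, hy2⟩ : ∃ y : Fin 3 → ℂ, ∑ a, y a * y a = 1 ∧ ∑ a, y a * z a = 0 := by
    -- If every square were 1, they would add up to 3. For such an i, the component of the i-th unit
    -- vector orthogonal to z has square 1 - z_i² ≠ 0 and can be normalized over ℂ.
    have : ∃ i, z i * z i ≠ 1 := by
      by_contra! h
      simp [h] at hz
    obtain ⟨i, hi⟩ := this
    obtain ⟨c, hc⟩ := IsAlgClosed.exists_eq_mul_self (1 - z i * z i)
    have hc0 : c ≠ 0 := by
      rintro rfl
      apply hi
      linear_combination -hc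
    refine ⟨fun a => ((if a = i then 1 else 0) - z i * z a) / c, ?_, ?_⟩
    · have : ∀ a, ((if a = i then 1 else 0) - z i * z a) / c *
          (((if a = i then 1 else 0) - z i * z a) / c) =
          ((if a = i then 1 - 2 * z i * z a else 0) + z i * z i * (z a * z a)) / (c * c) := by
        intro a
        split_ifs <;> field_simp <;> ring
      simp_rw [this]
      rw [← Finset.sum_div, Finset.sum_add_distrib, ← Finset.mul_sum, hz]
      simp only [Finset.sum_ite_eq', Finset.mem_univ, if_true]
      rw [← hc]
      rw [div_eq_one_iff_eq (by rw [hc]; simpa using hc0)]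
      ring
    · have : ∀ a, ((if a = i then 1 else 0) - z i * z a) / c * z a =
          ((if a = i then z a else 0) - z i * (z a * z a)) / c := by
        intro a
        split_ifs <;> field_simp
        ring
      simp_rw [this]
      rw [← Finset.sum_div, Finset.sum_sub_distrib, ← Finset.mul_sum, hz]
      simp
  -- The cross product of y and z completes the frame. Orthonormality of the rows then gives that of
  -- the columns, which is the claimed completeness.
  let x : Fin 3 → ℂ := ![y 1 * z 2 - y 2 * z 1, y 2 * z 0 - y 0 * z 2, y 0 * z 1 - y 1 * z 0]
  let M : Matrix (Fin 3) (Fin 3) ℂ := Matrix.of ![x, y, z]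
  simp only [Fin.sum_univ_three] at hz hy1 hy2
  have hM : M * M.transpose = 1 := by
    ext a b
    fin_cases a <;> fin_cases b <;>
      simp [M, x, Matrix.mul_apply, Fin.sum_univ_three]
    · linear_combination (z 0 * z 0 + z 1 * z 1 + z 2 * z 2) * hy1 + hz -
        (y 0 * z 0 + y 1 * z 1 + y 2 * z 2) * hy2
    · ring
    · ring
    · ring
    · exact hy1
    · exact hy2
    · ring
    · linear_combination hy2
    · exact hz
  have hM' := mul_eq_one_comm.1 hM
  refine ⟨x, y, fun a b => ?_⟩
  have := congrFun (congrFun hM' a) b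
  simp only [Matrix.mul_apply, Fin.sum_univ_three, Matrix.transpose_apply, Matrix.one_apply] at this
  exact this

theorem harmonic_smul {s : ℕ} (t : stf s) (c : ℂ) (w : Fin 3 → ℂ) :
    harmonic t (fun a => c * w a) = c ^ s * harmonic t w := by
  simp only [harmonic, tensorEval, Finset.prod_mul_distrib, Finset.prod_const, Finset.card_univ,
    Fintype.card_fin, Finset.mul_sum]
  exact Finset.sum_congr rfl fun i _ => by ring

/-- The mean value property replaces z by the null vectors z + i(x cos θ + y sin θ), where the
kernel is a pure power; averaging that power is Laplace's integral. -/
theorem sum_harmonic_mul_harmonic_unit {s : ℕ} {ι : Type*} [Fintype ι]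
    (T : OrthonormalBasis ι ℝ (stf s)) (w : Fin 3 → ℂ) {z : Fin 3 → ℂ}
    (hz : ∑ a, z a * z a = 1) :
    (normConst s : ℂ) ^ 2 * ∑ n, harmonic (T n) w * harmonic (T n) z =
      laplaceSum s (∑ a, w a * z a) ((∑ a, w a * w a) - (∑ a, w a * z a) ^ 2) := by
  obtain ⟨x, y, hxy⟩ := exists_orthonormal_frame hz
  let v : Fin 3 → Fin 3 → ℂ := ![z, fun a => x a - I * y a, fun a => x a + I * y a]
  have hv : ∀ a b, v 1 a * v 2 b + v 2 a * v 1 b =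
      2 * ((if a = b then 1 else 0) - v 0 a * v 0 b) := by
    intro a b
    simp only [v, Matrix.cons_val_zero, Matrix.cons_val_one, Matrix.cons_val]
    rw [← hxy a b]
    linear_combination (-2 * y a * y b) * I_sq
  have hvec : ∀ θ : ℝ, (fun a => ∑ b, frameCoeff (I / 2) θ b * v b a) =
      fun a => z a + I * (x a * Real.cos θ + y a * Real.sin θ) := by
    intro θ
    funext a
    rw [I_mul_cos_add_sin]
    simp [Fin.sum_univ_three, frameCoeff, v]
    ring
  have hxx : ∀ a b, ∑ c, (![x, y, z] c a) * (![x, y, z] c b) = if a = b then 1 else 0 := by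
    intro a b
    rw [← hxy a b]
    simp [Fin.sum_univ_three]
  have hM : (Matrix.of ![x, y, z]).transpose * (Matrix.of ![x, y, z]) = 1 := by
    ext a b
    rw [Matrix.mul_apply, Matrix.one_apply, ← hxx a b]
    rfl
  have hM' := mul_eq_one_comm.1 hM
  have horth : ∀ c d : Fin 3, ∑ a, ![x, y, z] c a * ![x, y, z] d a = if c = d then 1 else 0 := by
    intro c d
    have := congrFun (congrFun hM' c) d
    rwa [Matrix.mul_apply, Matrix.one_apply] at this
  have hnull : ∀ θ : ℝ, ∑ a, (∑ b, frameCoeff (I / 2) θ b * v b a) *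
      (∑ b, frameCoeff (I / 2) θ b * v b a) = 0 := by
    intro θ
    have h00 := horth 0 0
    have h01 := horth 0 1
    have h02 := horth 0 2
    have h11 := horth 1 1
    have h12 := horth 1 2
    have hcs : (Real.cos θ : ℂ) ^ 2 + (Real.sin θ : ℂ) ^ 2 = 1 := by
      rw [← ofReal_pow, ← ofReal_pow, ← ofReal_add, Real.cos_sq_add_sin_sq, ofReal_one]
    simp only [fun a => congrFun (hvec θ) a]
    simp [Fin.sum_univ_three] at h00 h01 h02 h11 h12 hz ⊢
    simp only [ofReal_cos, ofReal_sin] at hcs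
    linear_combination hz + (I ^ 2 * Complex.cos θ ^ 2) * h00 +
      (I ^ 2 * Complex.sin θ ^ 2) * h11 + (2 * I ^ 2 * Complex.cos θ * Complex.sin θ) * h01 +
      (2 * I * Complex.cos θ) * h02 + (2 * I * Complex.sin θ) * h12 + I_sq + I ^ 2 * hcs
  have hmean : ∀ n, (normConst s : ℂ) ^ 2 * harmonic (T n) z =
      ∫ θ, harmonic (T n) (fun a => ∑ b, frameCoeff (I / 2) θ b * v b a) ∂circleMeasure :=
    fun n => ((isSymTraceless_coe (T n)).integral_tensorEval hv).symm
  have hcont : ∀ n, Continuous fun θ =>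
      harmonic (T n) (fun a => ∑ b, frameCoeff (I / 2) θ b * v b a) := by
    intro n
    simp only [harmonic, tensorEval]
    refine continuous_finsetSum _ fun i _ => continuous_const.mul
      (continuous_finsetProd _ fun j _ => continuous_finsetSum _ fun b _ =>
        (continuous_frameCoeff _ b).mul continuous_const)
  calc (normConst s : ℂ) ^ 2 * ∑ n, harmonic (T n) w * harmonic (T n) z
      = ∑ n, harmonic (T n) w * ((normConst s : ℂ) ^ 2 * harmonic (T n) z) := by
        rw [Finset.mul_sum]
        exact Finset.sum_congr rfl fun n _ => by ring
    _ = ∫ θ, ∑ n, harmonic (T n) w *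
          harmonic (T n) (fun a => ∑ b, frameCoeff (I / 2) θ b * v b a) ∂circleMeasure := by
        rw [integral_finsetSum _ fun n _ => (integrable_circleMeasure (hcont n)).const_mul _]
        exact Finset.sum_congr rfl fun n _ => by rw [hmean, integral_const_mul]
    _ = ∫ θ : ℝ, ((∑ a, w a * z a) + I * ((∑ a, w a * x a) * Real.cos θ +
          (∑ a, w a * y a) * Real.sin θ)) ^ s ∂circleMeasure := by
        refine integral_congr_ae (Eventually.of_forall fun θ => ?_)
        simp only
        rw [sum_harmonic_mul_harmonic_null T w (hnull θ)]
        simp only [fun a => congrFun (hvec θ) a]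
        congr 1
        simp only [Fin.sum_univ_three]
        ring
    _ = _ := by
        rw [integral_add_cos_add_sin_pow]
        congr 1
        have : ∑ a, w a * w a = ∑ a, ∑ b, w a * w b * (if a = b then 1 else 0) := by
          simp
        rw [this]
        simp_rw [← hxy]
        simp only [Fin.sum_univ_three]
        ring

/-- The addition theorem: the reproducing kernel of the harmonic polynomials of degree `s`. -/
theorem sum_harmonic_mul_harmonic {s : ℕ} {ι : Type*} [Fintype ι]
    (T : OrthonormalBasis ι ℝ (stf s)) (w : Fin 3 → ℂ) {w' : Fin 3 → ℂ}
    (hw' : ∑ a, w' a * w' a ≠ 0) :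
    (normConst s : ℂ) ^ 2 * ∑ n, harmonic (T n) w * harmonic (T n) w' =
      laplaceSum s (∑ a, w a * w' a)
        ((∑ a, w a * w a) * (∑ a, w' a * w' a) - (∑ a, w a * w' a) ^ 2) := by
  -- Dividing by a complex root of w'·w' reduces to a unit vector; both sides are homogeneous of
  -- degree s.
  obtain ⟨c, hc⟩ := IsAlgClosed.exists_eq_mul_self (∑ a, w' a * w' a)
  have hc0 : c ≠ 0 := by
    rintro rfl
    exact hw' (by simpa using hc)
  set z : Fin 3 → ℂ := fun a => w' a / c with hzdef
  have hw'z : w' = fun a => c * z a := by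
    funext a
    simp [z, mul_div_cancel₀ _ hc0]
  have hz : ∑ a, z a * z a = 1 := by
    have : ∀ a, z a * z a = w' a * w' a / (c * c) := fun a => by
      simp only [z]
      field_simp
    simp_rw [this]
    rw [← Finset.sum_div, ← hc, div_self hw']
  have e1 : ∑ a, w a * w' a = c * ∑ a, w a * z a := by
    rw [hw'z, Finset.mul_sum]
    exact Finset.sum_congr rfl fun a _ => by ring
  rw [hc, e1, show (∑ a, w a * w a) * (c * c) - (c * ∑ a, w a * z a) ^ 2 =
    c ^ 2 * ((∑ a, w a * w a) - (∑ a, w a * z a) ^ 2) by ring, laplaceSum_mul,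
    ← sum_harmonic_mul_harmonic_unit T w hz]
  rw [hw'z]
  simp_rw [harmonic_smul]
  simp only [Finset.mul_sum]
  exact Finset.sum_congr rfl fun n _ => by ring

/-! ### Lorentz transformations -/

theorem mink_toC (x y : Fin 4 → ℝ) : mink (toC x) (toC y) = ((mink x y : ℝ) : ℂ) := by
  simp [mink, toC]

/-- The transpose of a Lorentz matrix is again Lorentz, because the left inverse read off from the
defining relation is also a right inverse. This is the resolution of the metric by the columns. -/
theorem IsProperOrthochronous.completeness {L : Matrix (Fin 4) (Fin 4) ℝ}
    (hL : IsProperOrthochronous L) (e f : Fin 4 → ℂ) :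
    mink e f = mink e (toC fun μ => L μ 0) * mink f (toC fun μ => L μ 0) -
      ∑ a : Fin 3, mink e (toC fun μ => L μ a.succ) * mink f (toC fun μ => L μ a.succ) := by
  have hη : eta * eta = 1 := by
    rw [eta, Matrix.diagonal_mul_diagonal, ← Matrix.diagonal_one]
    congr 1
    ext i
    fin_cases i <;> simp
  have h1 : (eta * L.transpose * eta) * L = 1 := by
    rw [Matrix.mul_assoc, Matrix.mul_assoc, ← Matrix.mul_assoc L.transpose, hL.1, hη]
  have h2 : L * eta * L.transpose = eta := by
    have h3 := mul_eq_one_comm.1 h1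
    calc L * eta * L.transpose = L * (eta * L.transpose * eta) * eta := by
          rw [← Matrix.mul_assoc, ← Matrix.mul_assoc, Matrix.mul_assoc _ eta eta, hη,
            Matrix.mul_one]
      _ = eta := by rw [h3, Matrix.one_mul]
  have h : ∀ μ ν, (L μ 0 : ℂ) * L ν 0 - L μ 1 * L ν 1 - L μ 2 * L ν 2 - L μ 3 * L ν 3 =
      (eta μ ν : ℂ) := by
    intro μ ν
    rw [← h2]
    simp [eta, Matrix.mul_apply, Fin.sum_univ_four, Matrix.diagonal_apply]
    ring
  have d0 : eta 0 0 = 1 := rfl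
  have d1 : eta 1 1 = -1 := rfl
  have d2 : eta 2 2 = -1 := rfl
  have d3 : eta 3 3 = -1 := rfl
  have o : ∀ μ ν, μ ≠ ν → eta μ ν = 0 := fun μ ν hμν => Matrix.diagonal_apply_ne _ hμν
  have h' := fun μ ν (hμν : μ ≠ ν) => (h μ ν).trans (by rw [o μ ν hμν, ofReal_zero])
  have h00 := h 0 0
  have h11 := h 1 1
  have h22 := h 2 2
  have h33 := h 3 3
  rw [d0] at h00
  rw [d1] at h11
  rw [d2] at h22
  rw [d3] at h33
  push_cast at h00 h11 h22 h33
  have h01 := h' 0 1 (by decide)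
  have h02 := h' 0 2 (by decide)
  have h03 := h' 0 3 (by decide)
  have h12 := h' 1 2 (by decide)
  have h13 := h' 1 3 (by decide)
  have h23 := h' 2 3 (by decide)
  simp only [mink, toC, Fin.sum_univ_three, Fin.succ_zero_eq_one, Fin.succ_one_eq_two,
    show (Fin.succ 2 : Fin 4) = 3 from rfl]
  linear_combination (-(e 0 * f 0)) * h00 - e 1 * f 1 * h11 - e 2 * f 2 * h22 - e 3 * f 3 * h33 +
    (e 0 * f 1 + e 1 * f 0) * h01 + (e 0 * f 2 + e 2 * f 0) * h02 +
    (e 0 * f 3 + e 3 * f 0) * h03 - (e 1 * f 2 + e 2 * f 1) * h12 -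
    (e 1 * f 3 + e 3 * f 1) * h13 - (e 2 * f 3 + e 3 * f 2) * h23

theorem IsProperOrthochronous.mink_col {L : Matrix (Fin 4) (Fin 4) ℝ}
    (hL : IsProperOrthochronous L) (a b : Fin 4) :
    mink (fun μ => L μ a) (fun μ => L μ b) = eta a b := by
  rw [← hL.1]
  simp [eta, mink, Matrix.mul_apply, Fin.sum_univ_four, Matrix.diagonal_apply]
  ring

theorem IsBoostFamily.col_zero {m : ℝ} {B : (Fin 4 → ℝ) → Matrix (Fin 4) (Fin 4) ℝ}
    (hB : IsBoostFamily m ![m, 0, 0, 0] B) {p : Fin 4 → ℝ} (hp : p ∈ massShell m) (μ : Fin 4) :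
    B p μ 0 * m = p μ := by
  have := congrFun (hB.map_ref p hp) μ
  simpa [Matrix.mulVec, dotProduct, Fin.sum_univ_four] using this

/-! ### The escort field -/

/-- The contraction of the string direction with the standard polarization vectors. -/
def polarization (m : ℝ) (B : (Fin 4 → ℝ) → Matrix (Fin 4) (Fin 4) ℝ) (e : Fin 4 → ℂ)
    (p : Fin 4 → ℝ) (a : Fin 3) : ℂ :=
  I * m / mink e (toC p) * mink e (toC fun μ => B p μ a.succ)

/-- Each step of the recursion contracts the first index only, so on a sum of products the descent
acts factor by factor. -/
theorem descend_sum_prod {ι : Type*} [Fintype ι] (m : ℝ) (p : Fin 4 → ℝ) (r : ℕ)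
    (M : Fin r → ι → Fin 4 → ℂ) (c : ι → ℂ) :
    descend m p r (fun μ => ∑ ρ, (∏ j, M j ρ (μ j)) * c ρ) =
      ∑ ρ, (∏ j, ∑ l, -(m : ℂ)⁻¹ * (I * (p l : ℂ)) * M j ρ l) * c ρ := by
  induction r generalizing c with
  | zero => simp [descend]
  | succ r ih =>
    rw [descend]
    have : (fun μ : Fin r → Fin 4 => -(m : ℂ)⁻¹ * ∑ l : Fin 4, I * (p l : ℂ) *
        ∑ ρ, (∏ j, M j ρ ((Fin.cons l μ : Fin (r + 1) → Fin 4) j)) * c ρ) =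
        fun μ => ∑ ρ, (∏ j, M (Fin.succ j) ρ (μ j)) *
          ((∑ l, -(m : ℂ)⁻¹ * (I * (p l : ℂ)) * M 0 ρ l) * c ρ) := by
      funext μ
      simp_rw [Fin.prod_univ_succ, Fin.cons_zero, Fin.cons_succ, Finset.mul_sum, Finset.sum_mul,
        Finset.mul_sum]
      rw [Finset.sum_comm]
      exact Finset.sum_congr rfl fun ρ _ => Finset.sum_congr rfl fun l _ => by ring
    rw [this, ih (fun j => M j.succ)]
    refine Finset.sum_congr rfl fun ρ _ => ?_
    rw [Fin.prod_univ_succ]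
    ring

/-- The matrix by which the curl and the string integration act on each index. -/
def stringMatrix (e : Fin 4 → ℂ) (p : Fin 4 → ℝ) (l ρ : Fin 4) : ℂ :=
  stringInt e p * ∑ ν, ((if ν = ρ then I * (lower p l : ℂ) else 0) -
    (if l = ρ then I * (lower p ν : ℂ) else 0)) * e ν

theorem stringPotential_eq (s : ℕ) (e : Fin 4 → ℂ) (p : Fin 4 → ℝ) (A : (Fin s → Fin 4) → ℂ)
    (μ : Fin s → Fin 4) :
    stringPotential s e p A μ = ∑ ρ, (∏ j, stringMatrix e p (μ j) (ρ j)) * A ρ := by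
  simp only [stringPotential, fieldStrength, stringMatrix, Finset.prod_mul_distrib,
    Finset.prod_const, Finset.card_univ, Fintype.card_fin]
  simp_rw [Fintype.prod_sum, Finset.prod_mul_distrib, Finset.sum_mul, Finset.mul_sum,
    Finset.sum_mul]
  rw [Finset.sum_comm]
  exact Finset.sum_congr rfl fun ρ _ => Finset.sum_congr rfl fun ν _ => by ring

/-- The two terms of the curl contribute p² = m² times e and (ep) times p. The second will drop out
against polarization vectors, which are orthogonal to p. -/
theorem sum_momentum_mul_stringMatrix {m : ℝ} (hm : m ≠ 0) {e : Fin 4 → ℂ} {p : Fin 4 → ℝ}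
    (hp : mink p p = m ^ 2) (hep : mink e (toC p) ≠ 0) (ρ : Fin 4) :
    ∑ l, -(m : ℂ)⁻¹ * (I * (p l : ℂ)) * stringMatrix e p l ρ =
      I / m * (m ^ 2 * e ρ / mink e (toC p) - p ρ) := by
  have hmC : (m : ℂ) ≠ 0 := by exact_mod_cast hm
  have hpC : (p 0 * p 0 - p 1 * p 1 - p 2 * p 2 - p 3 * p 3 : ℂ) = m ^ 2 := by
    have := congrArg (fun x : ℝ => (x : ℂ)) hp
    simpa [mink] using this
  have h0 : lower p 0 = p 0 := by simp [lower, eta]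
  have h1 : lower p 1 = -p 1 := by simp [lower, eta]
  have h2 : lower p 2 = -p 2 := by simp [lower, eta]
  have h3 : lower p 3 = -p 3 := by simp [lower, eta]
  have hS : ∀ l, stringMatrix e p l ρ = stringInt e p * (I * lower p l * e ρ -
      (if l = ρ then I * mink e (toC p) else 0)) := by
    intro l
    simp only [stringMatrix, sub_mul, Finset.sum_sub_distrib, ite_mul, zero_mul,
      Finset.sum_ite_eq', Finset.mem_univ, if_true]
    congr 2
    split_ifs
    · simp [Fin.sum_univ_four, h0, h1, h2, h3, mink, toC]
      ring
    · simp
  simp_rw [hS]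
  have hsplit : ∀ l, -(m : ℂ)⁻¹ * (I * (p l : ℂ)) * (stringInt e p * (I * lower p l * e ρ -
      (if l = ρ then I * mink e (toC p) else 0))) =
      -(m : ℂ)⁻¹ * stringInt e p * I * I * e ρ * (p l * lower p l) +
      (if l = ρ then (m : ℂ)⁻¹ * stringInt e p * I * I * mink e (toC p) * p l else 0) := by
    intro l
    split_ifs <;> ring
  simp_rw [hsplit]
  rw [Finset.sum_add_distrib, ← Finset.mul_sum]
  simp only [Finset.sum_ite_eq', Finset.mem_univ, if_true, Fin.sum_univ_four, h0, h1, h2, h3]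
  rw [show ((p 0 : ℂ) * (p 0 : ℝ) + p 1 * (-p 1 : ℝ) + p 2 * (-p 2 : ℝ) + p 3 * (-p 3 : ℝ)) =
    m ^ 2 by rw [← hpC]; push_cast; ring]
  rw [stringInt]
  have hI : I * I = -1 := I_mul_I
  field_simp
  linear_combination (-(m : ℂ) ^ 2 * e ρ + p ρ * mink e (toC p)) * I_sq

theorem descend_stringPotential (m : ℝ) (s : ℕ) (e : Fin 4 → ℂ) (p : Fin 4 → ℝ)
    (A : (Fin s → Fin 4) → ℂ) :
    descend m p s (stringPotential s e p A) = ∑ ρ : Fin s → Fin 4,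
      (∏ j, ∑ l, -(m : ℂ)⁻¹ * (I * (p l : ℂ)) * stringMatrix e p l (ρ j)) * A ρ := by
  rw [funext fun μ => stringPotential_eq s e p A μ]
  exact descend_sum_prod (ι := Fin s → Fin 4) m p s (fun j ρ l => stringMatrix e p l (ρ j)) A

theorem sum_stringMatrix_mul_boost {m : ℝ} (hm : m ≠ 0)
    {B : (Fin 4 → ℝ) → Matrix (Fin 4) (Fin 4) ℝ} (hB : IsBoostFamily m ![m, 0, 0, 0] B)
    (e : Fin 4 → ℂ) {p : Fin 4 → ℝ} (hp : p ∈ massShell m) (a : Fin 3) :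
    ∑ ρ, (∑ l, -(m : ℂ)⁻¹ * (I * (p l : ℂ)) * stringMatrix e p l ρ) *
      ((eta ρ ρ : ℂ) * (B p ρ a.succ : ℂ)) = polarization m B e p a := by
  -- Here division by zero makes both sides vanish, so the escort formula holds on the whole mass
  -- shell; measurability uses this later.
  by_cases hep : mink e (toC p) = 0
  · simp [polarization, hep, stringMatrix, stringInt]
  · have hmC : (m : ℂ) ≠ 0 := by exact_mod_cast hm
    have hcol : mink p (fun μ => B p μ a.succ) = 0 := by
      have h := (hB.lorentz p hp).mink_col 0 a.succ
      have h0 : eta 0 a.succ = 0 := Matrix.diagonal_apply_ne _ (Fin.succ_ne_zero a).symm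
      rw [h0] at h
      have hc := hB.col_zero hp
      simp only [mink] at h ⊢
      rw [← hc 0, ← hc 1, ← hc 2, ← hc 3]
      linear_combination m * h
    have hcolC := congrArg (fun x : ℝ => (x : ℂ)) hcol
    simp_rw [sum_momentum_mul_stringMatrix hm hp.1 hep]
    have e0 : eta 0 0 = 1 := rfl
    have e1 : eta 1 1 = -1 := rfl
    have e2 : eta 2 2 = -1 := rfl
    have e3 : eta 3 3 = -1 := rfl
    simp only [mink] at hcolC
    push_cast at hcolC
    rw [polarization]
    generalize mink e (toC p) = E at hep ⊢
    simp only [Fin.sum_univ_four, e0, e1, e2, e3, mink, toC]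
    push_cast
    field_simp
    linear_combination (-E) * hcolC

/-- The operations on different indices decouple, and `sum_stringMatrix_mul_boost` evaluates the
contraction at one index. -/
theorem escortIntertwiner_eq {m : ℝ} (hm : m ≠ 0) {s : ℕ}
    {B : (Fin 4 → ℝ) → Matrix (Fin 4) (Fin 4) ℝ} (hB : IsBoostFamily m ![m, 0, 0, 0] B)
    (T : OrthonormalBasis (Fin (2 * s + 1)) ℝ (stf s)) (e : Fin 4 → ℂ) {p : Fin 4 → ℝ}
    (hp : p ∈ massShell m) (n : Fin (2 * s + 1)) :
    escortIntertwiner m s B T e p n = harmonic (T n) (polarization m B e p) := by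
  rw [escortIntertwiner, descend_stringPotential, harmonic, tensorEval]
  simp_rw [← sum_stringMatrix_mul_boost hm hB e hp]
  -- The inner sum is made opaque so that distributing the product over the outer sum does not
  -- expand it.
  obtain ⟨d, hd⟩ : ∃ d : Fin 4 → ℂ, ∀ ρ,
    ∑ l, -(m : ℂ)⁻¹ * (I * (p l : ℂ)) * stringMatrix e p l ρ = d ρ := ⟨_, fun _ => rfl⟩
  simp_rw [hd]
  simp_rw [procaIntertwiner]
  push_cast
  simp_rw [Fintype.prod_sum, Finset.mul_sum]
  rw [Finset.sum_comm]
  refine Finset.sum_congr rfl fun i _ => Finset.sum_congr rfl fun ρ _ => ?_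
  simp only [Finset.prod_mul_distrib]
  ring

/-! ### The two-point kernel of the massive field -/

/-- The Gram function of the polarization vectors. -/
def polarizationGram (m : ℝ) (e f : Fin 4 → ℂ) (p : Fin 4 → ℝ) : ℂ :=
  1 - m ^ 2 * mink e f / (mink e (toC p) * mink f (toC p))

/-- Completeness, with the time column of the boost equal to p/m; the overall sign is the square of
the factor i. -/
theorem sum_polarization_mul {m : ℝ} (hm : m ≠ 0)
    {B : (Fin 4 → ℝ) → Matrix (Fin 4) (Fin 4) ℝ} (hB : IsBoostFamily m ![m, 0, 0, 0] B)
    {e f : Fin 4 → ℂ} {p : Fin 4 → ℝ} (hp : p ∈ massShell m) (he : mink e (toC p) ≠ 0)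
    (hf : mink f (toC p) ≠ 0) :
    ∑ a, polarization m B e p a * polarization m B f p a = -polarizationGram m e f p := by
  have hmC : (m : ℂ) ≠ 0 := by exact_mod_cast hm
  have h := (hB.lorentz p hp).completeness e f
  have hcol : ∀ g : Fin 4 → ℂ, mink g (toC fun μ => B p μ 0) * m = mink g (toC p) := by
    intro g
    have hc := hB.col_zero hp
    simp only [mink, toC]
    rw [← hc 0, ← hc 1, ← hc 2, ← hc 3]
    push_cast
    ring
  have hsum : ∑ a, polarization m B e p a * polarization m B f p a =
      (I * m / mink e (toC p)) * (I * m / mink f (toC p)) *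
      ∑ a : Fin 3, mink e (toC fun μ => B p μ a.succ) * mink f (toC fun μ => B p μ a.succ) := by
    rw [Finset.mul_sum]
    exact Finset.sum_congr rfl fun a _ => by simp only [polarization]; ring
  have hsum' : ∑ a : Fin 3, mink e (toC fun μ => B p μ a.succ) * mink f (toC fun μ => B p μ a.succ)
      = mink e (toC p) / m * (mink f (toC p) / m) - mink e f := by
    rw [← hcol e, ← hcol f, mul_div_cancel_right₀ _ hmC, mul_div_cancel_right₀ _ hmC]
    linear_combination h
  rw [hsum, hsum', polarizationGram]
  field_simp
  linear_combination (mink e (toC p) * mink f (toC p) - mink e f * m ^ 2) * I_sq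

theorem conj_mink_toC (e : Fin 4 → ℂ) (p : Fin 4 → ℝ) :
    conj (mink e (toC p)) = mink (fun i => conj (e i)) (toC p) := by
  simp [mink, toC]

theorem conj_polarization (m : ℝ) (B : (Fin 4 → ℝ) → Matrix (Fin 4) (Fin 4) ℝ) (e : Fin 4 → ℂ)
    (p : Fin 4 → ℝ) (a : Fin 3) :
    conj (polarization m B e p a) = -polarization m B (fun i => conj (e i)) p a := by
  simp only [polarization, map_mul, map_div₀, conj_I, conj_ofReal, conj_mink_toC]
  ring

theorem conj_harmonic {s : ℕ} (t : stf s) (w : Fin 3 → ℂ) :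
    conj (harmonic t w) = harmonic t fun a => conj (w a) := by
  simp [harmonic, tensorEval]

theorem twoPointKernel_count {n : ℕ} (u : (Fin 4 → ℂ) → (Fin 4 → ℝ) → Fin n → ℂ)
    (e₁ e₂ : Fin 4 → ℂ) (p : Fin 4 → ℝ) :
    twoPointKernel Measure.count u e₁ e₂ p = ∑ a, conj (u e₁ p a) * u e₂ p a := by
  rw [twoPointKernel, integral_count]

/-- The addition theorem at the conjugated first and the unconjugated second polarization vector;
`hG` says that the latter is not null. Conjugation flips the sign in `conj_polarization`, so the
mixed product is +G and the squares are -G. -/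
theorem twoPointKernel_rescaledIntertwiner {m : ℝ} (hm : m ≠ 0) {s : ℕ}
    {B : (Fin 4 → ℝ) → Matrix (Fin 4) (Fin 4) ℝ} (hB : IsBoostFamily m ![m, 0, 0, 0] B)
    (T : OrthonormalBasis (Fin (2 * s + 1)) ℝ (stf s)) {e₁ e₂ : Fin 4 → ℂ} {p : Fin 4 → ℝ}
    (hp : p ∈ massShell m) (h₁ : mink e₁ (toC p) ≠ 0) (h₂ : mink e₂ (toC p) ≠ 0)
    (hG : polarizationGram m e₂ e₂ p ≠ 0) :
    twoPointKernel Measure.count (rescaledIntertwiner m s B T) e₁ e₂ p =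
      conj (operatorFactor m s e₁ p) * operatorFactor m s e₂ p *
        laplaceSum s (polarizationGram m (fun i => conj (e₁ i)) e₂ p)
          (polarizationGram m (fun i => conj (e₁ i)) (fun i => conj (e₁ i)) p *
            polarizationGram m e₂ e₂ p -
            polarizationGram m (fun i => conj (e₁ i)) e₂ p ^ 2) := by
  have h₁' : mink (fun i => conj (e₁ i)) (toC p) ≠ 0 := by
    rw [← conj_mink_toC]
    simpa using h₁
  have hadd := sum_harmonic_mul_harmonic T (fun a => conj (polarization m B e₁ p a))
    (w' := polarization m B e₂ p) (by rw [sum_polarization_mul hm hB hp h₂ h₂]; simpa using hG)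
  have hs12 : ∑ a, conj (polarization m B e₁ p a) * polarization m B e₂ p a =
      polarizationGram m (fun i => conj (e₁ i)) e₂ p := by
    simp_rw [conj_polarization, neg_mul]
    rw [Finset.sum_neg_distrib, sum_polarization_mul hm hB hp h₁' h₂, neg_neg]
  have hs11 : ∑ a, conj (polarization m B e₁ p a) * conj (polarization m B e₁ p a) =
      -polarizationGram m (fun i => conj (e₁ i)) (fun i => conj (e₁ i)) p := by
    simp_rw [conj_polarization, neg_mul_neg]
    rw [sum_polarization_mul hm hB hp h₁' h₁']
  rw [hs12, hs11, sum_polarization_mul hm hB hp h₂ h₂, neg_mul_neg] at hadd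
  rw [← hadd, twoPointKernel_count, Finset.mul_sum, Finset.mul_sum]
  refine Finset.sum_congr rfl fun n _ => ?_
  simp only [rescaledIntertwiner, escortIntertwiner_eq hm hB T _ hp, map_mul, conj_ofReal,
    conj_harmonic]
  ring

theorem laplaceSum_zero_right (s : ℕ) (A : ℂ) : laplaceSum s A 0 = A ^ s := by
  rw [laplaceSum, Finset.sum_eq_single 0]
  · simp [circleMoment]
  · intro j _ hj
    unfold circleMoment
    split_ifs with h
    · obtain ⟨k, rfl⟩ := h
      have : (k + k) / 2 ≠ 0 := by omega
      simp [this]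
    · simp
  · simp

theorem rootNegSq_toC {v : Fin 4 → ℝ} (hv : mink v v ≤ 0) :
    rootNegSq (toC v) = ((Real.sqrt (-(mink v v)) : ℝ) : ℂ) := by
  rw [rootNegSq, mink_toC, ← ofReal_neg, Real.sqrt_eq_rpow, ofReal_cpow (by linarith)]
  norm_num

theorem polarizationGram_toC {m : ℝ} {v p : Fin 4 → ℝ} :
    polarizationGram m (toC v) (toC v) p =
      ((1 + m ^ 2 * (-(mink v v)) / mink v p ^ 2 : ℝ) : ℂ) := by
  rw [polarizationGram, mink_toC, mink_toC]
  push_cast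
  ring

theorem conj_mul_operatorFactor_toC {m : ℝ} {s : ℕ} {v p : Fin 4 → ℝ} (hv : mink v v ≤ 0) :
    conj (operatorFactor m s (toC v) p) * operatorFactor m s (toC v) p =
      ((1 + m ^ 2 * (-(mink v v)) / mink v p ^ 2 : ℝ) : ℂ) ^ s := by
  rw [operatorFactor, map_pow, ← mul_pow, rootNegSq_toC hv, stringInt, mink_toC]
  congr 1
  have h : ((Real.sqrt (-(mink v v)) : ℝ) : ℂ) ^ 2 = ((-(mink v v) : ℝ) : ℂ) := by
    rw [← ofReal_pow, Real.sq_sqrt (by linarith)]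
  simp only [map_sub, map_one, map_mul, map_div₀, conj_ofReal, conj_I]
  push_cast at h ⊢
  rw [← h]
  linear_combination (-(m : ℂ) ^ 2 * ((Real.sqrt (-(mink v v)) : ℝ) : ℂ) ^ 2 / ((mink v p : ℝ) : ℂ) ^ 2) * I_sq

/-- The norm of the intertwiner of the rescaled field for real string directions. -/
theorem sum_norm_rescaledIntertwiner_sq {m : ℝ} (hm : m ≠ 0) {s : ℕ}
    {B : (Fin 4 → ℝ) → Matrix (Fin 4) (Fin 4) ℝ} (hB : IsBoostFamily m ![m, 0, 0, 0] B)
    (T : OrthonormalBasis (Fin (2 * s + 1)) ℝ (stf s)) {v : Fin 4 → ℝ} {p : Fin 4 → ℝ}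
    (hp : p ∈ massShell m) (hv : mink v v < 0) (hvp : mink v p ≠ 0) :
    ∑ n, ‖rescaledIntertwiner m s B T (toC v) p n‖ ^ 2 =
      (1 + m ^ 2 * (-(mink v v)) / mink v p ^ 2) ^ (2 * s) := by
  have hpos : 0 < 1 + m ^ 2 * (-(mink v v)) / mink v p ^ 2 := by
    have : 0 ≤ m ^ 2 * (-(mink v v)) / mink v p ^ 2 := by
      have : 0 < -(mink v v) := by linarith
      positivity
    linarith
  have hvpC : mink (toC v) (toC p) ≠ 0 := by
    rw [mink_toC]
    exact_mod_cast hvp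
  have hG : polarizationGram m (toC v) (toC v) p ≠ 0 := by
    rw [polarizationGram_toC]
    exact_mod_cast hpos.ne'
  have h := twoPointKernel_rescaledIntertwiner hm hB T hp hvpC hvpC hG
  have hconj : (fun i => conj (toC v i)) = toC v := by
    funext i
    simp [toC]
  -- For equal real directions D = 0 and the Legendre factor is the s-th power of G. The two
  -- operator factors contribute the same power again, hence the exponent 2s.
  rw [hconj, ← sq, sub_self, laplaceSum_zero_right, conj_mul_operatorFactor_toC hv.le,
    polarizationGram_toC, twoPointKernel_count, ← pow_add, ← two_mul] at h
  have h' : ∀ n, conj (rescaledIntertwiner m s B T (toC v) p n) *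
      rescaledIntertwiner m s B T (toC v) p n =
      ((‖rescaledIntertwiner m s B T (toC v) p n‖ ^ 2 : ℝ) : ℂ) := fun n => by
    rw [conj_mul']
    push_cast
    rfl
  simp_rw [h'] at h
  exact_mod_cast h

/-! ### Limits -/

theorem tendsto_one_add_pow_exp {ι : Type*} {l : Filter ι} {s : ι → ℕ} {g : ι → ℂ} {t : ℂ}
    (hs : Tendsto s l atTop) (hg : Tendsto (fun i => s i * g i) l (𝓝 t)) :
    Tendsto (fun i => (1 + g i) ^ s i) l (𝓝 (exp t)) := by
  have hsC : Tendsto (fun i => ((s i : ℂ))⁻¹) l (𝓝 0) :=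
    (tendsto_inv_atTop_nhds_zero_nat (𝕜 := ℂ)).comp hs
  have hs0 : ∀ᶠ i in l, (s i : ℂ) ≠ 0 := by
    filter_upwards [hs.eventually_gt_atTop 0] with i hi
    exact_mod_cast hi.ne'
  have hg0 : Tendsto g l (𝓝 0) := by
    have := hsC.mul hg
    rw [zero_mul] at this
    refine this.congr' ?_
    filter_upwards [hs0] with i hi
    field_simp
  -- The quotient log(1 + z)/z, continuously extended by 1 at 0, gives s log(1 + g) = s g φ(g) and
  -- hence the limit t.
  set φ : ℂ → ℂ := dslope (fun z => Complex.log (1 + z)) 0 with hφ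
  have hd : HasDerivAt (fun z : ℂ => Complex.log (1 + z)) 1 0 := by
    have h := (hasDerivAt_id (0 : ℂ)).const_add 1
    have := h.clog (by simp)
    simpa using this
  have hφc : Tendsto φ (𝓝 0) (𝓝 1) := by
    have h := (continuousAt_dslope_same.2 hd.differentiableAt).tendsto
    rwa [dslope_same, hd.deriv] at h
  have hlog : Tendsto (fun i => s i * Complex.log (1 + g i)) l (𝓝 t) := by
    have h := hg.mul (hφc.comp hg0)
    rw [mul_one] at h
    refine h.congr fun i => ?_
    have := sub_smul_dslope (fun z => Complex.log (1 + z)) 0 (g i)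
    simp only [sub_zero, smul_eq_mul, add_zero, Complex.log_one] at this
    simp only [Function.comp_apply, φ]
    rw [mul_assoc, this]
  refine ((continuous_exp.tendsto t).comp hlog).congr' ?_
  have hne : ∀ᶠ i in l, 1 + g i ≠ 0 := by
    have : Tendsto (fun i => 1 + g i) l (𝓝 (1 + 0)) := hg0.const_add 1
    exact this.eventually_ne (by simp)
  filter_upwards [hne] with i hi
  simp only [Function.comp_apply]
  rw [exp_nat_mul, exp_log hi]

theorem tendsto_choose_div_pow {ι : Type*} {l : Filter ι} {s : ι → ℕ} (hs : Tendsto s l atTop)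
    (j : ℕ) : Tendsto (fun i => ((s i).choose j : ℂ) / (s i : ℂ) ^ j) l
      (𝓝 (j.factorial : ℂ)⁻¹) := by
  have h1 : Tendsto (fun n : ℕ => (n.choose j : ℝ) / (n : ℝ) ^ j) atTop
      (𝓝 (j.factorial : ℝ)⁻¹) := by
    have h := (isEquivalent_choose j)
    rw [Asymptotics.isEquivalent_iff_tendsto_one] at h
    · have h' := h.mul_const (j.factorial : ℝ)⁻¹
      rw [one_mul] at h'
      refine h'.congr' ?_
      filter_upwards [eventually_gt_atTop 0] with n hn
      simp only [Pi.div_apply]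
      field_simp
    · filter_upwards [eventually_gt_atTop 0] with n hn
      positivity
  have h2 := (continuous_ofReal.tendsto _).comp (h1.comp hs)
  refine (h2.congr fun i => ?_).trans (by simp)
  simp

/-- After extracting A^s, which tends to 1, the j-th coefficient is the binomial coefficient over
s^j, and the moment has argument s²D/A². The coefficients tend to 1/j! and are bounded by it, so
Tannery's theorem applies. -/
theorem tendsto_laplaceSum {ι : Type*} {l : Filter ι} {s : ι → ℕ} {A D : ι → ℂ} {D₀ : ℂ}
    (hs : Tendsto s l atTop) (hA : Tendsto (fun i => s i * (A i - 1)) l (𝓝 0))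
    (hD : Tendsto (fun i => (s i : ℂ) ^ 2 * D i) l (𝓝 D₀)) :
    Tendsto (fun i => laplaceSum (s i) (A i) (D i)) l (𝓝 (besselSum D₀)) := by
  have hs0 : ∀ᶠ i in l, (s i : ℂ) ≠ 0 := by
    filter_upwards [hs.eventually_gt_atTop 0] with i hi
    exact_mod_cast hi.ne'
  have hsC : Tendsto (fun i => ((s i : ℂ))⁻¹) l (𝓝 0) :=
    (tendsto_inv_atTop_nhds_zero_nat (𝕜 := ℂ)).comp hs
  have hA1 : Tendsto A l (𝓝 1) := by
    have := (hsC.mul hA).add_const 1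
    rw [zero_mul, zero_add] at this
    refine this.congr' ?_
    filter_upwards [hs0] with i hi
    field_simp
    ring
  have hpow : Tendsto (fun i => A i ^ s i) l (𝓝 1) := by
    have := tendsto_one_add_pow_exp hs hA
    rw [exp_zero] at this
    exact this.congr fun i => by simp
  have hD' : Tendsto (fun i => (s i : ℂ) ^ 2 * D i / A i ^ 2) l (𝓝 D₀) := by
    have := hD.div (hA1.pow 2) (by simp)
    rwa [one_pow, div_one] at this
  have hmain := hpow.mul (tendsto_tsum_mul_circleMoment (fun j => tendsto_choose_div_pow hs j)
    (by
      refine Eventually.of_forall fun i j => ?_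
      rw [norm_div, norm_pow, Complex.norm_natCast, Complex.norm_natCast]
      rcases Nat.eq_zero_or_pos (s i) with h | h
      · rcases Nat.eq_zero_or_pos j with rfl | hj
        · simp
        · simp [h, hj.ne']
      · rw [div_le_iff₀ (by positivity), ← div_eq_inv_mul]
        exact Nat.choose_le_pow_div j (s i)) hD')
  rw [one_mul] at hmain
  refine hmain.congr' ?_
  filter_upwards [hs0, hA1.eventually_ne one_ne_zero] with i hi hAi
  rw [tsum_eq_sum (s := Finset.range (s i + 1)), laplaceSum, Finset.mul_sum]
  · refine Finset.sum_congr rfl fun j hj => ?_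
    have hj' : j ≤ s i := by simpa [Nat.lt_succ_iff] using hj
    have : (s i : ℂ) ^ 2 * D i / A i ^ 2 = (s i / A i) ^ 2 * D i := by
      rw [div_pow]
      ring
    have hAs : A i ^ s i = A i ^ (s i - j) * A i ^ j := by
      rw [← pow_add, Nat.sub_add_cancel hj']
    rw [this, circleMoment_mul, hAs, div_pow]
    field_simp
  · intro j hj
    have hj' : s i < j := by simpa [Nat.lt_succ_iff] using hj
    simp [Nat.choose_eq_zero_of_lt hj']

theorem plMass_pos {κ : ℝ} (hκ : 0 < κ) {s : ℕ} (hs : 0 < s) : 0 < plMass κ s := by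
  unfold plMass
  positivity

theorem plMass_sq {κ : ℝ} (s : ℕ) : plMass κ s ^ 2 = κ ^ 2 / (s * (s + 1)) := by
  rw [plMass, div_pow, Real.sq_sqrt (by positivity)]

/-- For positive s the product is κ √(s/(s+1)). -/
theorem tendsto_mul_plMass {κ : ℝ} (hκ : 0 < κ) :
    Tendsto (fun s : ℕ => (s : ℝ) * plMass κ s) atTop (𝓝 κ) := by
  have h1 : Tendsto (fun s : ℕ => κ * Real.sqrt ((s : ℝ) / ((s : ℝ) + 1))) atTop
      (𝓝 (κ * Real.sqrt 1)) :=
    ((Real.continuous_sqrt.tendsto 1).comp (tendsto_natCast_div_add_atTop (1 : ℝ))).const_mul κ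
  rw [Real.sqrt_one, mul_one] at h1
  refine h1.congr' ?_
  filter_upwards [eventually_gt_atTop 0] with s hs
  have hs' : (0 : ℝ) < s := by exact_mod_cast hs
  have : 0 ≤ (s : ℝ) * plMass κ s := mul_nonneg hs'.le (plMass_pos hκ hs).le
  rw [← Real.sqrt_sq this, mul_pow, plMass_sq]
  rw [← Real.sqrt_sq hκ.le, ← Real.sqrt_mul (by positivity), Real.sqrt_sq hκ.le]
  congr 1
  field_simp

theorem tendsto_plMass {κ : ℝ} (hκ : 0 < κ) : Tendsto (plMass κ) atTop (𝓝 0) := by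
  have h := (tendsto_inv_atTop_nhds_zero_nat (𝕜 := ℝ)).mul (tendsto_mul_plMass hκ)
  rw [zero_mul] at h
  refine h.congr' ?_
  filter_upwards [eventually_gt_atTop 0] with s hs
  have hs' : (0 : ℝ) < s := by exact_mod_cast hs
  field_simp

theorem continuous_onShell : Continuous fun x : ℝ × (Fin 3 → ℝ) => onShell x.1 x.2 := by
  refine continuous_pi fun i => ?_
  fin_cases i <;> simp [onShell] <;> fun_prop

theorem continuous_mink_toC :
    Continuous fun x : (Fin 4 → ℂ) × (Fin 4 → ℝ) => mink x.1 (toC x.2) := by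
  unfold mink toC
  fun_prop

theorem continuous_mink : Continuous fun x : (Fin 4 → ℂ) × (Fin 4 → ℂ) => mink x.1 x.2 := by
  unfold mink
  fun_prop

theorem tendsto_onShell {ι : Type*} {l : Filter ι} {m : ι → ℝ} {k : ι → Fin 3 → ℝ} {m₀ : ℝ}
    {k₀ : Fin 3 → ℝ} (hm : Tendsto m l (𝓝 m₀)) (hk : Tendsto k l (𝓝 k₀)) :
    Tendsto (fun i => onShell (m i) (k i)) l (𝓝 (onShell m₀ k₀)) := by
  simpa only [Function.comp_def] using
    (continuous_onShell.tendsto (m₀, k₀)).comp (hm.prodMk_nhds hk)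

theorem tendsto_mink_toC {ι : Type*} {l : Filter ι} {e : ι → Fin 4 → ℂ} {p : ι → Fin 4 → ℝ}
    {e₀ : Fin 4 → ℂ} {p₀ : Fin 4 → ℝ} (he : Tendsto e l (𝓝 e₀)) (hp : Tendsto p l (𝓝 p₀)) :
    Tendsto (fun i => mink (e i) (toC (p i))) l (𝓝 (mink e₀ (toC p₀))) := by
  simpa only [Function.comp_def] using
    (continuous_mink_toC.tendsto (e₀, p₀)).comp (he.prodMk_nhds hp)

theorem tendsto_mink {ι : Type*} {l : Filter ι} {e f : ι → Fin 4 → ℂ} {e₀ f₀ : Fin 4 → ℂ}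
    (he : Tendsto e l (𝓝 e₀)) (hf : Tendsto f l (𝓝 f₀)) :
    Tendsto (fun i => mink (e i) (f i)) l (𝓝 (mink e₀ f₀)) := by
  simpa only [Function.comp_def] using
    (continuous_mink.tendsto (e₀, f₀)).comp (he.prodMk_nhds hf)

/-- On both kinds of directions -e² is a positive real number, away from the cut of the complex
power. -/
theorem continuousAt_rootNegSq {e : Fin 4 → ℂ} (he : e ∈ stringDirections) :
    ContinuousAt rootNegSq e := by
  have hsl : -(mink e e) ∈ slitPlane := by
    rcases he with ⟨v, rfl, hv⟩ | ⟨h, -⟩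
    · left
      rw [mink_toC, ← ofReal_neg, ofReal_re]
      linarith
    · rw [h]
      simp
  unfold rootNegSq
  refine ContinuousAt.cpow ?_ continuousAt_const hsl
  have : Continuous fun e : Fin 4 → ℂ => -(mink e e) := by
    unfold mink
    fun_prop
  exact this.continuousAt

theorem onShell_sq (m : ℝ) (k : Fin 3 → ℝ) : mink (onShell m k) (onShell m k) = m ^ 2 := by
  have h : 0 ≤ m ^ 2 + ∑ i, k i ^ 2 := by positivity
  have h' := Real.mul_self_sqrt h
  have e0 : onShell m k 0 = Real.sqrt (m ^ 2 + ∑ i, k i ^ 2) := rfl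
  have e1 : onShell m k 1 = k 0 := rfl
  have e2 : onShell m k 2 = k 1 := rfl
  have e3 : onShell m k 3 = k 2 := rfl
  rw [mink, e0, e1, e2, e3, h', Fin.sum_univ_three]
  ring

theorem onShell_mem_of_pos {m : ℝ} (hm : 0 < m) (k : Fin 3 → ℝ) : onShell m k ∈ massShell m := by
  refine ⟨onShell_sq m k, ?_⟩
  change 0 < Real.sqrt _
  positivity

theorem onShell_zero_zero : onShell 0 0 = 0 := by
  funext i
  fin_cases i <;> simp [onShell]

theorem onShell_mem_of_ne {k : Fin 3 → ℝ} (hk : k ≠ 0) : onShell 0 k ∈ massShell 0 := by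
  refine ⟨onShell_sq 0 k, ?_⟩
  change 0 < Real.sqrt _
  refine Real.sqrt_pos.2 ?_
  obtain ⟨i, hi⟩ : ∃ i, k i ≠ 0 := by
    by_contra! h
    exact hk (funext h)
  have : 0 < ∑ i, k i ^ 2 :=
    Finset.sum_pos' (fun i _ => sq_nonneg _) ⟨i, Finset.mem_univ i, by positivity⟩
  simpa using this

theorem ne_zero_of_mink_onShell_ne {e : Fin 4 → ℂ} {k : Fin 3 → ℝ}
    (h : mink e (toC (onShell 0 k)) ≠ 0) : k ≠ 0 := by
  rintro rfl
  apply h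
  simp [onShell_zero_zero, mink, toC]

/-! ### Joint limits in the spin, the string directions and the momentum -/

section Joint

variable {ι : Type*} {l : Filter ι} {s : ι → ℕ} {κ : ℝ} {k : ι → Fin 3 → ℝ} {k₀ : Fin 3 → ℝ}

theorem tendsto_onShell_plMass (hκ : 0 < κ) (hs : Tendsto s l atTop) (hk : Tendsto k l (𝓝 k₀)) :
    Tendsto (fun i => onShell (plMass κ (s i)) (k i)) l (𝓝 (onShell 0 k₀)) :=
  tendsto_onShell ((tendsto_plMass hκ).comp hs) hk

theorem tendsto_mink_onShell (hκ : 0 < κ) (hs : Tendsto s l atTop) (hk : Tendsto k l (𝓝 k₀))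
    {e : ι → Fin 4 → ℂ} {e₀ : Fin 4 → ℂ} (he : Tendsto e l (𝓝 e₀)) :
    Tendsto (fun i => mink (e i) (toC (onShell (plMass κ (s i)) (k i)))) l
      (𝓝 (mink e₀ (toC (onShell 0 k₀)))) :=
  tendsto_mink_toC he (tendsto_onShell_plMass hκ hs hk)

theorem tendsto_mul_plMass_complex (hκ : 0 < κ) (hs : Tendsto s l atTop) :
    Tendsto (fun i => (s i : ℂ) * plMass κ (s i)) l (𝓝 (κ : ℂ)) := by
  have := (continuous_ofReal.tendsto _).comp ((tendsto_mul_plMass hκ).comp hs)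
  exact this.congr fun i => by simp

theorem tendsto_plMass_complex (hκ : 0 < κ) (hs : Tendsto s l atTop) :
    Tendsto (fun i => (plMass κ (s i) : ℂ)) l (𝓝 0) := by
  have := (continuous_ofReal.tendsto _).comp ((tendsto_plMass hκ).comp hs)
  exact_mod_cast this

theorem tendsto_operatorFactor (hκ : 0 < κ) (hs : Tendsto s l atTop) (hk : Tendsto k l (𝓝 k₀))
    {e : ι → Fin 4 → ℂ} {e₀ : Fin 4 → ℂ} (he : Tendsto e l (𝓝 e₀)) (he₀ : e₀ ∈ stringDirections)
    (h0 : mink e₀ (toC (onShell 0 k₀)) ≠ 0) :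
    Tendsto (fun i => operatorFactor (plMass κ (s i)) (s i) (e i)
      (onShell (plMass κ (s i)) (k i))) l (𝓝 (koehlerFactor κ e₀ (onShell 0 k₀))) := by
  have hE := tendsto_mink_onShell hκ hs hk he
  have hr := (continuousAt_rootNegSq he₀).tendsto.comp he
  have h := (((tendsto_mul_plMass_complex hκ hs).mul hr).mul
    ((tendsto_const_nhds (x := I)).div hE h0)).neg
  have h2 := tendsto_one_add_pow_exp hs (g := fun i =>
    -((plMass κ (s i) : ℂ) * rootNegSq (e i) *
      stringInt (e i) (onShell (plMass κ (s i)) (k i)))) (h.congr fun i => by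
        simp only [Function.comp_apply, Pi.div_apply, stringInt]
        ring)
  have e1 : koehlerFactor κ e₀ (onShell 0 k₀) =
      exp (-(κ * rootNegSq e₀ * (I / mink e₀ (toC (onShell 0 k₀))))) := by
    rw [koehlerFactor]
    ring_nf
  rw [e1]
  refine h2.congr fun i => ?_
  rw [operatorFactor, sub_eq_add_neg]

/-- The common limit of the two-point kernels. -/
def limitKernel (κ : ℝ) (e₁ e₂ : Fin 4 → ℂ) (p : Fin 4 → ℝ) : ℂ :=
  conj (koehlerFactor κ e₁ p) * koehlerFactor κ e₂ p *
    besselSum (κ ^ 2 * (2 * (mink (fun i => conj (e₁ i)) e₂ /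
      (mink (fun i => conj (e₁ i)) (toC p) * mink e₂ (toC p))) -
      mink (fun i => conj (e₁ i)) (fun i => conj (e₁ i)) /
        (mink (fun i => conj (e₁ i)) (toC p) * mink (fun i => conj (e₁ i)) (toC p)) -
      mink e₂ e₂ / (mink e₂ (toC p) * mink e₂ (toC p))))

/-- This quotient is what multiplies m² in `polarizationGram`; the Gram function itself only tends
to 1, so its first-order term is tracked separately. -/
theorem tendsto_polarizationGram (hκ : 0 < κ) (hs : Tendsto s l atTop) (hk : Tendsto k l (𝓝 k₀))
    {e f : ι → Fin 4 → ℂ} {e₀ f₀ : Fin 4 → ℂ} (he : Tendsto e l (𝓝 e₀)) (hf : Tendsto f l (𝓝 f₀))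
    (he₀ : mink e₀ (toC (onShell 0 k₀)) ≠ 0) (hf₀ : mink f₀ (toC (onShell 0 k₀)) ≠ 0) :
    Tendsto (fun i => mink (e i) (f i) / (mink (e i) (toC (onShell (plMass κ (s i)) (k i))) *
      mink (f i) (toC (onShell (plMass κ (s i)) (k i))))) l
      (𝓝 (mink e₀ f₀ / (mink e₀ (toC (onShell 0 k₀)) * mink f₀ (toC (onShell 0 k₀))))) :=
  (tendsto_mink he hf).div
    ((tendsto_mink_onShell hκ hs hk he).mul (tendsto_mink_onShell hκ hs hk hf))
    (mul_ne_zero he₀ hf₀)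

theorem tendsto_twoPointKernel_rescaled (hκ : 0 < κ)
    {B : ℕ → (Fin 4 → ℝ) → Matrix (Fin 4) (Fin 4) ℝ}
    (hB : ∀ s, 0 < s → IsBoostFamily (plMass κ s) ![plMass κ s, 0, 0, 0] (B s))
    (T : (s : ℕ) → OrthonormalBasis (Fin (2 * s + 1)) ℝ (stf s))
    (hs : Tendsto s l atTop) (hk : Tendsto k l (𝓝 k₀))
    {e f : ι → Fin 4 → ℂ} {e₀ f₀ : Fin 4 → ℂ} (he : Tendsto e l (𝓝 e₀)) (hf : Tendsto f l (𝓝 f₀))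
    (heS : e₀ ∈ stringDirections) (hfS : f₀ ∈ stringDirections)
    (he₀ : mink e₀ (toC (onShell 0 k₀)) ≠ 0) (hf₀ : mink f₀ (toC (onShell 0 k₀)) ≠ 0) :
    Tendsto (fun i => twoPointKernel Measure.count
      (rescaledIntertwiner (plMass κ (s i)) (s i) (B (s i)) (T (s i))) (e i) (f i)
      (onShell (plMass κ (s i)) (k i))) l (𝓝 (limitKernel κ e₀ f₀ (onShell 0 k₀))) := by
  set e' : ι → Fin 4 → ℂ := fun i a => conj (e i a) with he'def
  set e₀' : Fin 4 → ℂ := fun a => conj (e₀ a) with he₀'def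
  have he' : Tendsto e' l (𝓝 e₀') := by
    have hc : Continuous fun (v : Fin 4 → ℂ) (a : Fin 4) => conj (v a) := by fun_prop
    exact (hc.tendsto e₀).comp he
  have he₀' : mink e₀' (toC (onShell 0 k₀)) ≠ 0 := by
    rw [he₀'def, ← conj_mink_toC]
    simpa using he₀
  have hc := tendsto_polarizationGram hκ hs hk he' hf he₀' hf₀
  have ha := tendsto_polarizationGram hκ hs hk he' he' he₀' he₀'
  have hb := tendsto_polarizationGram hκ hs hk hf hf hf₀ hf₀
  have hm := tendsto_plMass_complex hκ hs
  have hsm := tendsto_mul_plMass_complex hκ hs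
  have hop1 := tendsto_operatorFactor hκ hs hk he heS he₀
  have hop2 := tendsto_operatorFactor hκ hs hk hf hfS hf₀
  have hlap : Tendsto (fun i => laplaceSum (s i)
      (polarizationGram (plMass κ (s i)) (e' i) (f i) (onShell (plMass κ (s i)) (k i)))
      (polarizationGram (plMass κ (s i)) (e' i) (e' i) (onShell (plMass κ (s i)) (k i)) *
        polarizationGram (plMass κ (s i)) (f i) (f i) (onShell (plMass κ (s i)) (k i)) -
        polarizationGram (plMass κ (s i)) (e' i) (f i) (onShell (plMass κ (s i)) (k i)) ^ 2)) l
      (𝓝 (besselSum (κ ^ 2 * (2 * (mink e₀' f₀ /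
      (mink e₀' (toC (onShell 0 k₀)) * mink f₀ (toC (onShell 0 k₀)))) -
      mink e₀' e₀' / (mink e₀' (toC (onShell 0 k₀)) * mink e₀' (toC (onShell 0 k₀))) -
      mink f₀ f₀ / (mink f₀ (toC (onShell 0 k₀)) * mink f₀ (toC (onShell 0 k₀))))))) := by
    refine tendsto_laplaceSum hs ?_ ?_
    · have h := ((hsm.mul hm).mul hc).neg
      rw [mul_zero, zero_mul, neg_zero] at h
      refine h.congr fun i => ?_
      rw [polarizationGram]
      ring
    -- Writing G₁₁ = 1 - m²a, G₂₂ = 1 - m²b and G₁₂ = 1 - m²c, the determinant is m²(2c - a - b) +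
    -- m⁴(ab - c²). Multiplied by s², only the first term survives.
    · have h := ((hsm.pow 2).mul (((hc.const_mul 2).sub ha).sub hb)).add
        (((hsm.pow 2).mul (hm.pow 2)).mul ((ha.mul hb).sub (hc.pow 2)))
      rw [zero_pow two_ne_zero, mul_zero, zero_mul, add_zero] at h
      refine h.congr fun i => ?_
      simp only [polarizationGram]
      ring
  have hconj := (continuous_conj.tendsto _).comp hop1
  refine ((hconj.mul hop2).mul hlap).congr' ?_
  have hE := (tendsto_mink_onShell hκ hs hk he).eventually_ne he₀
  have hF := (tendsto_mink_onShell hκ hs hk hf).eventually_ne hf₀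
  have hG : Tendsto (fun i => polarizationGram (plMass κ (s i)) (f i) (f i)
      (onShell (plMass κ (s i)) (k i))) l (𝓝 1) := by
    have h := ((hm.pow 2).mul hb).const_sub 1
    rw [zero_pow two_ne_zero, zero_mul, sub_zero] at h
    refine h.congr fun i => ?_
    rw [polarizationGram]
    ring
  filter_upwards [hE, hF, hG.eventually_ne one_ne_zero, hs.eventually_gt_atTop 0] with i h1 h2 h3 h4
  have hm0 := plMass_pos hκ h4
  rw [twoPointKernel_rescaledIntertwiner hm0.ne' (hB _ h4) (T _) (onShell_mem_of_pos hm0 _) h1 h2 h3]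
  rfl

theorem tendsto_koehlerFactor {e : ι → Fin 4 → ℂ} {e₀ : Fin 4 → ℂ} (he : Tendsto e l (𝓝 e₀))
    (hk : Tendsto k l (𝓝 k₀)) (heS : e₀ ∈ stringDirections)
    (he₀ : mink e₀ (toC (onShell 0 k₀)) ≠ 0) :
    Tendsto (fun i => koehlerFactor κ (e i) (onShell 0 (k i))) l
      (𝓝 (koehlerFactor κ e₀ (onShell 0 k₀))) := by
  have hp : Tendsto (fun i => onShell 0 (k i)) l (𝓝 (onShell 0 k₀)) :=
    tendsto_onShell tendsto_const_nhds hk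
  have hE : Tendsto (fun i => mink (e i) (toC (onShell 0 (k i)))) l
      (𝓝 (mink e₀ (toC (onShell 0 k₀)))) :=
    tendsto_mink_toC he hp
  have hr := (continuousAt_rootNegSq heS).tendsto.comp he
  exact (continuous_exp.tendsto _).comp ((hr.const_mul (I * κ)).div hE he₀).neg

theorem tendsto_limitKernel {e f : ι → Fin 4 → ℂ} {e₀ f₀ : Fin 4 → ℂ} (he : Tendsto e l (𝓝 e₀))
    (hf : Tendsto f l (𝓝 f₀)) (hk : Tendsto k l (𝓝 k₀))
    (heS : e₀ ∈ stringDirections) (hfS : f₀ ∈ stringDirections)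
    (he₀ : mink e₀ (toC (onShell 0 k₀)) ≠ 0) (hf₀ : mink f₀ (toC (onShell 0 k₀)) ≠ 0) :
    Tendsto (fun i => limitKernel κ (e i) (f i) (onShell 0 (k i))) l
      (𝓝 (limitKernel κ e₀ f₀ (onShell 0 k₀))) := by
  have hp : Tendsto (fun i => onShell 0 (k i)) l (𝓝 (onShell 0 k₀)) :=
    tendsto_onShell tendsto_const_nhds hk
  have hE := tendsto_mink_toC he hp
  have hF := tendsto_mink_toC hf hp
  have hc : Continuous fun (v : Fin 4 → ℂ) (a : Fin 4) => conj (v a) := by fun_prop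
  have he' : Tendsto (fun i a => conj (e i a)) l (𝓝 fun a => conj (e₀ a)) :=
    (hc.tendsto e₀).comp he
  have hE' := tendsto_mink_toC he' hp
  have he₀' : mink (fun a => conj (e₀ a)) (toC (onShell 0 k₀)) ≠ 0 := by
    rw [← conj_mink_toC]
    simpa using he₀
  unfold limitKernel
  refine (((continuous_conj.tendsto _).comp (tendsto_koehlerFactor he hk heS he₀)).mul
    (tendsto_koehlerFactor hf hk hfS hf₀)).mul ((continuous_besselSum.tendsto _).comp ?_)
  refine Tendsto.const_mul _ ((Tendsto.sub (Tendsto.const_mul _ ?_) ?_).sub ?_)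
  · exact (tendsto_mink he' hf).div (hE'.mul hF) (mul_ne_zero he₀' hf₀)
  · exact (tendsto_mink he' he').div (hE'.mul hE') (mul_ne_zero he₀' he₀')
  · exact (tendsto_mink hf hf).div (hF.mul hF) (mul_ne_zero hf₀ hf₀)

end Joint

/-! ### The infinite-spin two-point kernel and locally uniform convergence -/

theorem mink_mulVec (L : Matrix (Fin 4) (Fin 4) ℝ) (e : Fin 4 → ℂ) (a b : ℝ) :
    mink e (toC (L.mulVec ![0, a, b, 0])) =
      a * mink e (toC fun μ => L μ 1) + b * mink e (toC fun μ => L μ 2) := by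
  simp [mink, toC, Matrix.mulVec, dotProduct, Fin.sum_univ_four]
  ring

/-- The product of the two phases is exp(i κ (v₁ cos θ + v₂ sin θ)), with v the difference of the
transverse parts of the directions divided by (ep). The circle average sees only v₁² + v₂².
Completeness and p = B₀ + B₃ express it by invariants, the B₀ components cancelling in the
difference. -/
theorem twoPointKernel_standardIntertwiner {κ : ℝ}
    {B : (Fin 4 → ℝ) → Matrix (Fin 4) (Fin 4) ℝ} (hB : IsBoostFamily 0 ![1, 0, 0, 1] B)
    {e₁ e₂ : Fin 4 → ℂ} {p : Fin 4 → ℝ} (hp : p ∈ massShell 0)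
    (h₁ : mink e₁ (toC p) ≠ 0) (h₂ : mink e₂ (toC p) ≠ 0) :
    twoPointKernel circleMeasure (standardIntertwiner κ B) e₁ e₂ p = limitKernel κ e₁ e₂ p := by
  set f : Fin 4 → ℂ := fun i => conj (e₁ i) with hf
  have h₁' : mink f (toC p) ≠ 0 := by
    rw [hf, ← conj_mink_toC]
    simpa using h₁
  have hcf : ∀ q : Fin 4 → ℝ, conj (mink e₁ (toC q)) = mink f (toC q) := conj_mink_toC e₁
  set c : Fin 4 → Fin 4 → ℂ := fun a => toC fun μ => B p μ a with hc
  have hpc : ∀ g : Fin 4 → ℂ, mink g (toC p) = mink g (c 0) + mink g (c 3) := by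
    intro g
    have h : ∀ μ, B p μ 0 + B p μ 3 = p μ := fun μ => by
      have := congrFun (hB.map_ref p hp) μ
      simpa [Matrix.mulVec, dotProduct, Fin.sum_univ_four] using this
    simp only [hc, mink, toC, ← h]
    push_cast
    ring
  set v : Fin 4 → ℂ := fun a => mink f (c a) / mink f (toC p) - mink e₂ (c a) / mink e₂ (toC p)
    with hv
  have hkey : ∀ θ : ℝ, conj (standardIntertwiner κ B e₁ p θ) * standardIntertwiner κ B e₂ p θ =
      conj (koehlerFactor κ e₁ p) * koehlerFactor κ e₂ p *
        exp (I * ((κ * v 1) * Real.cos θ + (κ * v 2) * Real.sin θ)) := by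
    intro θ
    rw [standardIntertwiner, standardIntertwiner, map_mul, ← exp_conj]
    rw [mul_mul_mul_comm, ← exp_add]
    congr 2
    simp only [map_neg, map_div₀, map_mul, conj_I, hcf]
    simp only [mink_mulVec, hv, hc]
    push_cast
    ring
  rw [twoPointKernel]
  simp_rw [hkey]
  rw [integral_const_mul, integral_exp_cos_add_sin, limitKernel]
  congr 2
  have hcomp := fun g g' => (hB.lorentz p hp).completeness g g'
  simp only [Fin.sum_univ_three, Fin.succ_zero_eq_one, Fin.succ_one_eq_two,
    show (Fin.succ 2 : Fin 4) = 3 from rfl] at hcomp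
  have hcomp' : ∀ g g' : Fin 4 → ℂ, mink g (c 1) * mink g' (c 1) + mink g (c 2) * mink g' (c 2) =
      mink g (c 0) * mink g' (c 0) - mink g (c 3) * mink g' (c 3) - mink g g' := fun g g' => by
    rw [hcomp g g']
    ring
  have hff := hcomp' f f
  have hfe := hcomp' f e₂
  have hee := hcomp' e₂ e₂
  have hpf := hpc f
  have hpe := hpc e₂
  have hf3 : mink f (c 3) = mink f (toC p) - mink f (c 0) := by rw [hpf]; ring
  have he3 : mink e₂ (c 3) = mink e₂ (toC p) - mink e₂ (c 0) := by rw [hpe]; ring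
  rw [hf3] at hff hfe
  rw [he3] at hfe hee
  simp only [hv]
  rw [← hf]
  generalize mink f (toC p) = E at *
  generalize mink e₂ (toC p) = F at *
  field_simp
  linear_combination (κ : ℂ) ^ 2 * (F ^ 2 * hff + E ^ 2 * hee - 2 * E * F * hfe)

theorem tendstoLocallyUniformlyOn_operatorFactor {κ : ℝ} (hκ : 0 < κ) :
    TendstoLocallyUniformlyOn
      (fun (s : ℕ) (x : (Fin 4 → ℂ) × (Fin 3 → ℝ)) =>
        operatorFactor (plMass κ s) s x.1 (onShell (plMass κ s) x.2))
      (fun x => koehlerFactor κ x.1 (onShell 0 x.2)) atTop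
      {x | x.1 ∈ stringDirections ∧ mink x.1 (toC (onShell 0 x.2)) ≠ 0} := by
  rw [tendstoLocallyUniformlyOn_iff_forall_tendsto]
  rintro ⟨e₀, k₀⟩ ⟨h1, h2⟩
  -- Locally uniform convergence amounts to convergence of the pair (limit, approximant) to the
  -- diagonal, jointly in s and the point; both entries tend to the value at the base point.
  refine Tendsto.mono_right ?_ (nhds_le_uniformity (koehlerFactor κ e₀ (onShell 0 k₀)))
  have hs : Tendsto (fun y : ℕ × ((Fin 4 → ℂ) × (Fin 3 → ℝ)) => y.1)
      (atTop ×ˢ 𝓝[{x | x.1 ∈ stringDirections ∧ mink x.1 (toC (onShell 0 x.2)) ≠ 0}] (e₀, k₀))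
      atTop := tendsto_fst
  have hx : Tendsto (fun y : ℕ × ((Fin 4 → ℂ) × (Fin 3 → ℝ)) => y.2)
      (atTop ×ˢ 𝓝[{x | x.1 ∈ stringDirections ∧ mink x.1 (toC (onShell 0 x.2)) ≠ 0}] (e₀, k₀))
      (𝓝 (e₀, k₀)) := tendsto_snd.mono_right nhdsWithin_le_nhds
  have he := (continuous_fst.tendsto _).comp hx
  have hk := (continuous_snd.tendsto _).comp hx
  exact (tendsto_koehlerFactor he hk h1 h2).prodMk_nhds (tendsto_operatorFactor hκ hs hk he h1 h2)

theorem tendstoLocallyUniformlyOn_twoPointKernel {κ : ℝ} (hκ : 0 < κ)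
    {B₀ : (Fin 4 → ℝ) → Matrix (Fin 4) (Fin 4) ℝ}
    (hB₀ : IsBoostFamily 0 ![1, 0, 0, 1] B₀)
    {B : ℕ → (Fin 4 → ℝ) → Matrix (Fin 4) (Fin 4) ℝ}
    (hB : ∀ s, 0 < s → IsBoostFamily (plMass κ s) ![plMass κ s, 0, 0, 0] (B s))
    (T : (s : ℕ) → OrthonormalBasis (Fin (2 * s + 1)) ℝ (stf s)) :
    TendstoLocallyUniformlyOn
      (fun (s : ℕ) (x : (Fin 4 → ℂ) × (Fin 4 → ℂ) × (Fin 3 → ℝ)) =>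
        twoPointKernel Measure.count (rescaledIntertwiner (plMass κ s) s (B s) (T s))
          x.1 x.2.1 (onShell (plMass κ s) x.2.2))
      (fun x => twoPointKernel circleMeasure (standardIntertwiner κ B₀)
          x.1 x.2.1 (onShell 0 x.2.2)) atTop
      {x | x.1 ∈ stringDirections ∧ x.2.1 ∈ stringDirections ∧
        mink x.1 (toC (onShell 0 x.2.2)) ≠ 0 ∧ mink x.2.1 (toC (onShell 0 x.2.2)) ≠ 0} := by
  set S : Set ((Fin 4 → ℂ) × (Fin 4 → ℂ) × (Fin 3 → ℝ)) :=
    {x | x.1 ∈ stringDirections ∧ x.2.1 ∈ stringDirections ∧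
        mink x.1 (toC (onShell 0 x.2.2)) ≠ 0 ∧ mink x.2.1 (toC (onShell 0 x.2.2)) ≠ 0} with hS
  have hlim : ∀ x ∈ S, limitKernel κ x.1 x.2.1 (onShell 0 x.2.2) =
      twoPointKernel circleMeasure (standardIntertwiner κ B₀) x.1 x.2.1 (onShell 0 x.2.2) := by
    rintro x ⟨-, -, h3, h4⟩
    rw [twoPointKernel_standardIntertwiner hB₀
      (onShell_mem_of_ne (ne_zero_of_mink_onShell_ne h3)) h3 h4]
  refine TendstoLocallyUniformlyOn.congr_right ?_ hlim
  rw [tendstoLocallyUniformlyOn_iff_forall_tendsto]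
  rintro ⟨e₀, f₀, k₀⟩ ⟨h1, h2, h3, h4⟩
  refine Tendsto.mono_right ?_ (nhds_le_uniformity (limitKernel κ e₀ f₀ (onShell 0 k₀)))
  have hs : Tendsto (fun y : ℕ × ((Fin 4 → ℂ) × (Fin 4 → ℂ) × (Fin 3 → ℝ)) => y.1)
      (atTop ×ˢ 𝓝[S] (e₀, f₀, k₀)) atTop := tendsto_fst
  have hx : Tendsto (fun y : ℕ × ((Fin 4 → ℂ) × (Fin 4 → ℂ) × (Fin 3 → ℝ)) => y.2)
      (atTop ×ˢ 𝓝[S] (e₀, f₀, k₀)) (𝓝 (e₀, f₀, k₀)) := tendsto_snd.mono_right nhdsWithin_le_nhds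
  have he := (continuous_fst.tendsto _).comp hx
  have hf := ((continuous_fst.comp continuous_snd).tendsto _).comp hx
  have hk := ((continuous_snd.comp continuous_snd).tendsto _).comp hx
  exact (tendsto_limitKernel he hf hk h1 h2 h3 h4).prodMk_nhds
    (tendsto_twoPointKernel_rescaled hκ hB T hs hk he hf h1 h2 h3 h4)

/-! ### Bounds for test functions -/

theorem abs_mink_le (e p : Fin 4 → ℝ) : |mink e p| ≤ 4 * (‖e‖ * ‖p‖) := by
  have h : ∀ i, |e i * p i| ≤ ‖e‖ * ‖p‖ := fun i => by
    rw [abs_mul]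
    exact mul_le_mul (norm_le_pi_norm e i) (norm_le_pi_norm p i) (abs_nonneg _) (norm_nonneg _)
  have h0 := abs_le.1 (h 0)
  have h1 := abs_le.1 (h 1)
  have h2 := abs_le.1 (h 2)
  have h3 := abs_le.1 (h 3)
  rw [mink, abs_le]
  constructor <;> linarith [h0.1, h0.2, h1.1, h1.2, h2.1, h2.2, h3.1, h3.2]

/-- Quantitative support and decay properties of a test function. -/
structure TestBound (F : (Fin 4 → ℝ) → (Fin 4 → ℝ) → ℂ) (K : Set (Fin 4 → ℝ)) (δ c C : ℝ) :
    Prop where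
  compact : IsCompact K
  spacelike : ∀ e ∈ K, mink e e < 0
  delta_pos : 0 < δ
  c_pos : 0 < c
  const_nonneg : 0 ≤ C
  support : ∀ e p, F e p ≠ 0 → e ∈ K ∧ δ ≤ |mink e p| ∧ c ≤ ‖p‖
  bound : ∀ e p, ‖F e p‖ ≤ C / (1 + ‖p‖) ^ 4

theorem IsTestFunction.exists_bound {F : (Fin 4 → ℝ) → (Fin 4 → ℝ) → ℂ} (hF : IsTestFunction F) :
    ∃ K δ c C, TestBound F K δ c C := by
  obtain ⟨K, hK, hK1, hK2⟩ := hF.support_dir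
  obtain ⟨δ, hδ, hδ1⟩ := hF.support_away
  obtain ⟨C₀, hC₀⟩ := hF.decay 0
  obtain ⟨C₄, hC₄⟩ := hF.decay 4
  obtain ⟨R, hR, hR1⟩ := hK.isBounded.exists_pos_norm_le
  have hC₀' : 0 ≤ C₀ := le_trans (by positivity) (hC₀ 0 0)
  have hC₄' : 0 ≤ C₄ := le_trans (by positivity) (hC₄ 0 0)
  -- The momentum bound follows from δ ≤ |(ep)| ≤ 4‖e‖‖p‖ with ‖e‖ ≤ R on the support; the factor 8
  -- comes from (1 + x)⁴ ≤ 8(1 + x⁴).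
  refine ⟨K, δ, δ / (4 * R), 8 * (C₀ + C₄), hK, hK1, hδ, by positivity, by positivity, ?_, ?_⟩
  · intro e p hne
    have he : e ∈ K := by
      by_contra h
      exact hne (hK2 e h p)
    have hd : δ ≤ |mink e p| := by
      by_contra! h
      exact hne (hδ1 e p h)
    refine ⟨he, hd, ?_⟩
    rw [div_le_iff₀ (by positivity)]
    calc δ ≤ 4 * (‖e‖ * ‖p‖) := hd.trans (abs_mink_le e p)
      _ ≤ 4 * (R * ‖p‖) := by gcongr; exact hR1 e he
      _ = ‖p‖ * (4 * R) := by ring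
  · intro e p
    rw [le_div_iff₀ (by positivity)]
    have h0 := hC₀ e p
    have h4 := hC₄ e p
    rw [pow_zero, one_mul] at h0
    have hx : (1 + ‖p‖) ^ 4 ≤ 8 * (1 + ‖p‖ ^ 4) := by
      nlinarith [sq_nonneg (‖p‖ - 1), sq_nonneg (‖p‖ ^ 2 - 1), norm_nonneg p,
        sq_nonneg (‖p‖ ^ 2 - ‖p‖), sq_nonneg ((‖p‖ - 1) * (‖p‖ + 1))]
    calc ‖F e p‖ * (1 + ‖p‖) ^ 4 ≤ ‖F e p‖ * (8 * (1 + ‖p‖ ^ 4)) := by gcongr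
      _ = 8 * (‖F e p‖ + ‖p‖ ^ 4 * ‖F e p‖) := by ring
      _ ≤ 8 * (C₀ + C₄) := by gcongr

theorem TestBound.mono {F : (Fin 4 → ℝ) → (Fin 4 → ℝ) → ℂ} {K K' : Set (Fin 4 → ℝ)}
    {δ δ' c c' C C' : ℝ} (h : TestBound F K δ c C) (hK : IsCompact K')
    (hK' : ∀ e ∈ K', mink e e < 0) (hKK : K ⊆ K') (hδ : 0 < δ') (hδδ : δ' ≤ δ) (hc : 0 < c')
    (hcc : c' ≤ c) (hCC : C ≤ C') : TestBound F K' δ' c' C' where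
  compact := hK
  spacelike := hK'
  delta_pos := hδ
  c_pos := hc
  const_nonneg := h.const_nonneg.trans hCC
  support e p hne := by
    obtain ⟨h1, h2, h3⟩ := h.support e p hne
    exact ⟨hKK h1, hδδ.trans h2, hcc.trans h3⟩
  bound e p := (h.bound e p).trans (by gcongr)

theorem IsTestFunction.exists_common_bound {F G : (Fin 4 → ℝ) → (Fin 4 → ℝ) → ℂ}
    (hF : IsTestFunction F) (hG : IsTestFunction G) :
    ∃ K δ c C, TestBound F K δ c C ∧ TestBound G K δ c C := by
  obtain ⟨K, δ, c, C, h⟩ := hF.exists_bound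
  obtain ⟨K', δ', c', C', h'⟩ := hG.exists_bound
  have hK := h.compact.union h'.compact
  have hK' : ∀ e ∈ K ∪ K', mink e e < 0 := by
    rintro e (he | he)
    · exact h.spacelike e he
    · exact h'.spacelike e he
  have hδ := lt_min h.delta_pos h'.delta_pos
  have hc := lt_min h.c_pos h'.c_pos
  exact ⟨K ∪ K', min δ δ', min c c', max C C',
    h.mono hK hK' Set.subset_union_left hδ (min_le_left _ _) hc (min_le_left _ _)
      (le_max_left _ _),
    h'.mono hK hK' Set.subset_union_right hδ (min_le_right _ _) hc (min_le_right _ _)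
      (le_max_right _ _)⟩

theorem abs_le_onShell_zero (m : ℝ) (k : Fin 3 → ℝ) (i : Fin 3) : |k i| ≤ onShell m k 0 := by
  change |k i| ≤ Real.sqrt _
  refine Real.abs_le_sqrt ?_
  have := Finset.single_le_sum (f := fun i => k i ^ 2) (fun i _ => sq_nonneg _) (Finset.mem_univ i)
  nlinarith [sq_nonneg m]

theorem norm_onShell (m : ℝ) (k : Fin 3 → ℝ) : ‖onShell m k‖ = onShell m k 0 := by
  have h0 : 0 ≤ onShell m k 0 := Real.sqrt_nonneg _
  refine le_antisymm ((pi_norm_le_iff_of_nonneg h0).2 fun i => ?_) ?_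
  · fin_cases i
    · exact (abs_of_nonneg h0).le
    · exact abs_le_onShell_zero m k 0
    · exact abs_le_onShell_zero m k 1
    · exact abs_le_onShell_zero m k 2
  · exact (le_abs_self _).trans (norm_le_pi_norm (onShell m k) 0)

theorem norm_le_norm_onShell (m : ℝ) (k : Fin 3 → ℝ) : ‖k‖ ≤ ‖onShell m k‖ := by
  rw [norm_onShell]
  exact (pi_norm_le_iff_of_nonneg (Real.sqrt_nonneg _)).2 fun i => abs_le_onShell_zero m k i

theorem TestBound.norm_le_onShell {F : (Fin 4 → ℝ) → (Fin 4 → ℝ) → ℂ} {K : Set (Fin 4 → ℝ)}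
    {δ c C : ℝ} (h : TestBound F K δ c C) (e : Fin 4 → ℝ) (m : ℝ) (k : Fin 3 → ℝ) :
    ‖F e (onShell m k)‖ ≤ C / (1 + ‖k‖) ^ 4 := by
  refine (h.bound e _).trans ?_
  have := h.const_nonneg
  gcongr
  exact norm_le_norm_onShell m k

/-! ### The measure on the mass shell -/

/-- The density of the invariant measure on the mass shell. -/
def shellDensity (m : ℝ) (k : Fin 3 → ℝ) : ℝ := 1 / ((2 * Real.pi) ^ 3 * (2 * onShell m k 0))

theorem shellDensity_nonneg (m : ℝ) (k : Fin 3 → ℝ) : 0 ≤ shellDensity m k := by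
  have : 0 ≤ onShell m k 0 := Real.sqrt_nonneg _
  unfold shellDensity
  positivity

theorem measurable_onShell (m : ℝ) : Measurable (onShell m) :=
  (continuous_onShell.comp (continuous_const.prodMk continuous_id)).measurable

theorem measurable_shellDensity (m : ℝ) : Measurable (shellDensity m) := by
  unfold shellDensity
  exact measurable_const.div
    (((measurable_pi_apply 0).comp (measurable_onShell m)).const_mul 2 |>.const_mul _)

instance sigmaFinite_shellMeasure (m : ℝ) : SigmaFinite (shellMeasure m) :=
  SigmaFinite.withDensity_ofReal _

theorem integral_shellMeasure (m : ℝ) (g : (Fin 3 → ℝ) → ℂ) :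
    ∫ k, g k ∂shellMeasure m = ∫ k, (shellDensity m k : ℂ) * g k := by
  refine (integral_withDensity_eq_integral_toReal_smul
    (measurable_shellDensity m).ennreal_ofReal (by simp) g).trans ?_
  refine integral_congr_ae (Eventually.of_forall fun k => ?_)
  simp only
  rw [ENNReal.toReal_ofReal (shellDensity_nonneg m k), Complex.real_smul]

theorem integrable_shellMeasure_iff (m : ℝ) (g : (Fin 3 → ℝ) → ℝ) :
    Integrable g (shellMeasure m) ↔ Integrable fun k => shellDensity m k * g k := by
  refine (integrable_withDensity_iff_integrable_smul'
    (measurable_shellDensity m).ennreal_ofReal (by simp)).trans ?_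
  have : ∀ k, (ENNReal.ofReal (shellDensity m k)).toReal • g k = shellDensity m k * g k :=
      fun k => by
    rw [ENNReal.toReal_ofReal (shellDensity_nonneg m k), smul_eq_mul]
  simp_rw [this]

/-- The bound is independent of m. Test functions vanish near p = 0, so the growing density at the
apex does no harm as m tends to 0. -/
theorem shellDensity_le {m c : ℝ} (hc : 0 < c) {k : Fin 3 → ℝ} (hk : c ≤ ‖onShell m k‖) :
    shellDensity m k ≤ 1 / c := by
  rw [norm_onShell] at hk
  have hpi : (1 : ℝ) ≤ (2 * Real.pi) ^ 3 := one_le_pow₀ (by linarith [Real.pi_gt_three])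
  unfold shellDensity
  refine one_div_le_one_div_of_le hc ?_
  nlinarith

theorem integrable_inv_one_add_norm_pow_four :
    Integrable fun k : Fin 3 → ℝ => ((1 + ‖k‖) ^ 4)⁻¹ := by
  have h := integrable_one_add_norm (E := Fin 3 → ℝ) (μ := volume) (r := 4) (by simp; norm_num)
  refine h.congr (Eventually.of_forall fun k => ?_)
  have h0 : 0 ≤ 1 + ‖k‖ := by positivity
  simp only
  rw [Real.rpow_neg h0]
  norm_cast

/-- A function on the mass shell supported away from the apex that decays rapidly. -/
theorem integrable_shellMeasure_of_decay {m c A : ℝ} (hc : 0 < c) :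
    Integrable (fun k => if c ≤ ‖onShell m k‖ then A * ((1 + ‖k‖) ^ 4)⁻¹ else 0)
      (shellMeasure m) := by
  rw [integrable_shellMeasure_iff]
  have hms : MeasurableSet {k | c ≤ ‖onShell m k‖} :=
    measurableSet_le measurable_const (measurable_onShell m).norm
  refine (integrable_inv_one_add_norm_pow_four.const_mul (1 / c * |A|)).mono' ?_ ?_
  · refine ((measurable_shellDensity m).mul (Measurable.ite hms ?_ measurable_const)).aestronglyMeasurable
    exact (((measurable_norm.const_add 1).pow_const 4).inv).const_mul A
  · refine Eventually.of_forall fun k => ?_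
    split_ifs with h
    · rw [norm_mul, norm_mul, Real.norm_of_nonneg (shellDensity_nonneg m k), Real.norm_eq_abs,
        norm_inv, norm_pow, Real.norm_of_nonneg (by positivity : 0 ≤ 1 + ‖k‖), ← mul_assoc]
      gcongr
      exact shellDensity_le hc h
    · simp only [mul_zero, norm_zero]
      positivity

/-! ### One-particle vectors -/

theorem norm_integrand_le {α : Type*} {m : ℝ} {u : (Fin 4 → ℂ) → (Fin 4 → ℝ) → α → ℂ}
    {F : (Fin 4 → ℝ) → (Fin 4 → ℝ) → ℂ} {K : Set (Fin 4 → ℝ)} {δ c C M : ℝ} (hb : TestBound F K δ c C) (hM0 : 0 ≤ M)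
    (hM : ∀ e ∈ K, ∀ k a, δ ≤ |mink e (onShell m k)| → ‖u (toC e) (onShell m k) a‖ ≤ M)
    (e : Fin 4 → ℝ) (k : Fin 3 → ℝ) (a : α) :
    ‖F e (onShell m k) * u (toC e) (onShell m k) a‖ ≤
      K.indicator (fun _ => if c ≤ ‖onShell m k‖ then C * M / (1 + ‖k‖) ^ 4 else 0) e := by
  by_cases h : F e (onShell m k) = 0
  · rw [h, zero_mul, norm_zero]
    refine Set.indicator_nonneg (fun _ _ => ?_) _
    have := hb.const_nonneg
    split_ifs <;> positivity
  · obtain ⟨h1, h2, h3⟩ := hb.support _ _ h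
    rw [Set.indicator_of_mem h1, if_pos h3, norm_mul, mul_div_right_comm]
    have := hb.const_nonneg
    gcongr
    · exact hb.norm_le_onShell e m k
    · exact hM e h1 k a h2

theorem norm_oneParticle_le {α : Type*} {m : ℝ} {ν : Measure (Fin 4 → ℝ)}
    [IsLocallyFiniteMeasure ν] {u : (Fin 4 → ℂ) → (Fin 4 → ℝ) → α → ℂ}
    {F : (Fin 4 → ℝ) → (Fin 4 → ℝ) → ℂ} {K : Set (Fin 4 → ℝ)} {δ c C M : ℝ} (hb : TestBound F K δ c C) (hM0 : 0 ≤ M)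
    (hM : ∀ e ∈ K, ∀ k a, δ ≤ |mink e (onShell m k)| → ‖u (toC e) (onShell m k) a‖ ≤ M)
    (x : (Fin 3 → ℝ) × α) :
    ‖oneParticle m ν u F x‖ ≤
      if c ≤ ‖onShell m x.1‖ then ν.real K * (C * M) / (1 + ‖x.1‖) ^ 4 else 0 := by
  have h := norm_integral_le_of_norm_le (μ := ν) (g := K.indicator
    fun _ => if c ≤ ‖onShell m x.1‖ then C * M / (1 + ‖x.1‖) ^ 4 else 0)
    ((integrable_indicator_iff hb.compact.measurableSet).2
      (integrableOn_const (hs := hb.compact.measure_lt_top.ne)))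
    (Eventually.of_forall fun e => norm_integrand_le hb hM0 hM e x.1 x.2)
  refine h.trans (le_of_eq ?_)
  rw [integral_indicator hb.compact.measurableSet, setIntegral_const, smul_eq_mul]
  split_ifs <;> ring

section OneParticle

variable {α : Type*} [MeasurableSpace α]

/-- Intertwiners that are jointly measurable and locally bounded away from `(e p) = 0`. -/
structure IsRegularIntertwiner (m : ℝ) (u : (Fin 4 → ℂ) → (Fin 4 → ℝ) → α → ℂ) : Prop where
  measurable : Measurable fun x : ((Fin 3 → ℝ) × α) × (Fin 4 → ℝ) =>
    u (toC x.2) (onShell m x.1.1) x.1.2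
  bounded : ∀ K : Set (Fin 4 → ℝ), IsCompact K → (∀ e ∈ K, mink e e < 0) → ∀ δ > 0,
    ∃ M, 0 ≤ M ∧ ∀ e ∈ K, ∀ k a, δ ≤ |mink e (onShell m k)| →
      ‖u (toC e) (onShell m k) a‖ ≤ M

variable {m : ℝ} {τ : Measure α} [IsFiniteMeasure τ] {ν : Measure (Fin 4 → ℝ)}
  [IsLocallyFiniteMeasure ν] {u : (Fin 4 → ℂ) → (Fin 4 → ℝ) → α → ℂ}
  {F G : (Fin 4 → ℝ) → (Fin 4 → ℝ) → ℂ} {K : Set (Fin 4 → ℝ)} {δ c C M : ℝ}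

theorem measurable_testFunction_onShell (hF : IsTestFunction F) (m : ℝ) :
    Measurable fun x : (Fin 3 → ℝ) × (Fin 4 → ℝ) => F x.2 (onShell m x.1) := by
  have h := hF.continuous.measurable
  exact h.comp (measurable_snd.prodMk ((measurable_onShell m).comp measurable_fst))

theorem measurable_integrand (hu : IsRegularIntertwiner m u) (hF : IsTestFunction F) :
    Measurable fun x : ((Fin 3 → ℝ) × α) × (Fin 4 → ℝ) =>
      F x.2 (onShell m x.1.1) * u (toC x.2) (onShell m x.1.1) x.1.2 := by
  have h := (measurable_testFunction_onShell hF m).comp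
    ((measurable_fst.comp measurable_fst).prodMk measurable_snd :
      Measurable fun x : ((Fin 3 → ℝ) × α) × (Fin 4 → ℝ) => (x.1.1, x.2))
  exact h.mul hu.measurable

theorem stronglyMeasurable_oneParticle (hu : IsRegularIntertwiner m u) (hF : IsTestFunction F) :
    StronglyMeasurable (oneParticle m ν u F) :=
  (measurable_integrand hu hF).stronglyMeasurable.integral_prod_right'

theorem memLp_oneParticle (hu : IsRegularIntertwiner m u) (hF : IsTestFunction F) :
    MemLp (oneParticle m ν u F) 2 ((shellMeasure m).prod τ) := by
  have hmeas := (stronglyMeasurable_oneParticle (ν := ν) hu hF).aestronglyMeasurable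
    (μ := (shellMeasure m).prod τ)
  rw [memLp_two_iff_integrable_sq_norm hmeas]
  obtain ⟨K, δ, c, C, hb⟩ := hF.exists_bound
  obtain ⟨M, hM0, hM⟩ := hu.bounded K hb.compact hb.spacelike δ hb.delta_pos
  refine ((integrable_shellMeasure_of_decay (m := m) (A := (ν.real K * (C * M)) ^ 2)
    hb.c_pos).comp_fst τ).mono' (hmeas.norm.pow 2) (Eventually.of_forall fun x => ?_)
  have h := norm_oneParticle_le (ν := ν) hb hM0 hM x
  rw [Real.norm_of_nonneg (by positivity)]
  split_ifs at h ⊢ with hc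
  · have h1 : 1 ≤ (1 + ‖x.1‖) ^ 4 := one_le_pow₀ (by linarith [norm_nonneg x.1])
    calc ‖oneParticle m ν u F x‖ ^ 2 ≤ (ν.real K * (C * M) / (1 + ‖x.1‖) ^ 4) ^ 2 := by gcongr
      _ = (ν.real K * (C * M)) ^ 2 * ((1 + ‖x.1‖) ^ 4)⁻¹ * ((1 + ‖x.1‖) ^ 4)⁻¹ := by
          generalize (1 + ‖x.1‖) ^ 4 = w
          ring
      _ ≤ (ν.real K * (C * M)) ^ 2 * ((1 + ‖x.1‖) ^ 4)⁻¹ * 1 := by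
          gcongr
          exact inv_le_one_of_one_le₀ h1
      _ = _ := mul_one _
  · have : ‖oneParticle m ν u F x‖ = 0 := le_antisymm h (norm_nonneg _)
    rw [this]
    norm_num

theorem measurable_conj_mul_intertwiner (hu : IsRegularIntertwiner m u) :
    Measurable fun x : ((Fin 3 → ℝ) × ((Fin 4 → ℝ) × (Fin 4 → ℝ))) × α =>
      conj (u (toC x.1.2.1) (onShell m x.1.1) x.2) * u (toC x.1.2.2) (onShell m x.1.1) x.2 := by
  have h1 : Measurable fun x : ((Fin 3 → ℝ) × ((Fin 4 → ℝ) × (Fin 4 → ℝ))) × α =>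
      (((x.1.1, x.2), x.1.2.1) : ((Fin 3 → ℝ) × α) × (Fin 4 → ℝ)) := by fun_prop
  have h2 : Measurable fun x : ((Fin 3 → ℝ) × ((Fin 4 → ℝ) × (Fin 4 → ℝ))) × α =>
      (((x.1.1, x.2), x.1.2.2) : ((Fin 3 → ℝ) × α) × (Fin 4 → ℝ)) := by fun_prop
  exact (continuous_conj.measurable.comp (hu.measurable.comp h1)).mul (hu.measurable.comp h2)

theorem stronglyMeasurable_twoPointKernel (hu : IsRegularIntertwiner m u) :
    StronglyMeasurable fun y : (Fin 3 → ℝ) × ((Fin 4 → ℝ) × (Fin 4 → ℝ)) =>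
      twoPointKernel τ u (toC y.2.1) (toC y.2.2) (onShell m y.1) :=
  (measurable_conj_mul_intertwiner hu).stronglyMeasurable.integral_prod_right'

/-- The two-point function smeared in the string directions, as a function of the momentum. -/
def smearedKernel (m : ℝ) (τ : Measure α) (ν : Measure (Fin 4 → ℝ))
    (u : (Fin 4 → ℂ) → (Fin 4 → ℝ) → α → ℂ) (F G : (Fin 4 → ℝ) → (Fin 4 → ℝ) → ℂ)
    (k : Fin 3 → ℝ) : ℂ :=
  ∫ y, conj (F y.1 (onShell m k)) * G y.2 (onShell m k) *
    twoPointKernel τ u (toC y.1) (toC y.2) (onShell m k) ∂(ν.prod ν)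

theorem stronglyMeasurable_smearedKernel_integrand (hu : IsRegularIntertwiner m u)
    (hF : IsTestFunction F) (hG : IsTestFunction G) :
    StronglyMeasurable fun y : (Fin 3 → ℝ) × ((Fin 4 → ℝ) × (Fin 4 → ℝ)) =>
      conj (F y.2.1 (onShell m y.1)) * G y.2.2 (onShell m y.1) *
        twoPointKernel τ u (toC y.2.1) (toC y.2.2) (onShell m y.1) := by
  have h1 := (measurable_testFunction_onShell hF m).comp (by fun_prop :
    Measurable fun y : (Fin 3 → ℝ) × ((Fin 4 → ℝ) × (Fin 4 → ℝ)) => (y.1, y.2.1))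
  have h2 := (measurable_testFunction_onShell hG m).comp (by fun_prop :
    Measurable fun y : (Fin 3 → ℝ) × ((Fin 4 → ℝ) × (Fin 4 → ℝ)) => (y.1, y.2.2))
  exact ((continuous_conj.measurable.comp h1).mul h2).stronglyMeasurable.mul
    (stronglyMeasurable_twoPointKernel hu)

theorem stronglyMeasurable_smearedKernel (hu : IsRegularIntertwiner m u)
    (hF : IsTestFunction F) (hG : IsTestFunction G) :
    StronglyMeasurable (smearedKernel m τ ν u F G) :=
  (stronglyMeasurable_smearedKernel_integrand hu hF hG).integral_prod_right'

/-- Fubini: the spin integral is carried out inside the two smearings. Compact support in the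
directions and boundedness of the intertwiner on the support give integrability. -/
theorem integral_conj_oneParticle_mul_spin (hu : IsRegularIntertwiner m u)
    (hF : IsTestFunction F) (hG : IsTestFunction G) (k : Fin 3 → ℝ) :
    ∫ a, conj (oneParticle m ν u F (k, a)) * oneParticle m ν u G (k, a) ∂τ =
      smearedKernel m τ ν u F G k := by
  obtain ⟨K, δ, c, C, hbF, hbG⟩ := hF.exists_common_bound hG
  obtain ⟨M, hM0, hM⟩ := hu.bounded K hbF.compact hbF.spacelike δ hbF.delta_pos
  set f : α → (Fin 4 → ℝ) × (Fin 4 → ℝ) → ℂ := fun a y =>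
    conj (F y.1 (onShell m k) * u (toC y.1) (onShell m k) a) *
      (G y.2 (onShell m k) * u (toC y.2) (onShell m k) a) with hf
  have h1 : ∀ a, conj (oneParticle m ν u F (k, a)) * oneParticle m ν u G (k, a) =
      ∫ y, f a y ∂(ν.prod ν) := by
    intro a
    rw [oneParticle, oneParticle, ← integral_conj, ← integral_prod_mul]
  have hint : Integrable (Function.uncurry f) (τ.prod (ν.prod ν)) := by
    have hmF : Measurable fun z : α × ((Fin 4 → ℝ) × (Fin 4 → ℝ)) =>
        F z.2.1 (onShell m k) * u (toC z.2.1) (onShell m k) z.1 :=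
      (measurable_integrand hu hF).comp (by fun_prop :
        Measurable fun z : α × ((Fin 4 → ℝ) × (Fin 4 → ℝ)) => ((k, z.1), z.2.1))
    have hmG : Measurable fun z : α × ((Fin 4 → ℝ) × (Fin 4 → ℝ)) =>
        G z.2.2 (onShell m k) * u (toC z.2.2) (onShell m k) z.1 :=
      (measurable_integrand hu hG).comp (by fun_prop :
        Measurable fun z : α × ((Fin 4 → ℝ) × (Fin 4 → ℝ)) => ((k, z.1), z.2.2))
    set b : ℝ := if c ≤ ‖onShell m k‖ then C * M / (1 + ‖k‖) ^ 4 else 0 with hb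
    have hI : Integrable (fun z : α × ((Fin 4 → ℝ) × (Fin 4 → ℝ)) =>
        (1 : ℝ) * ((K.indicator (fun _ => b) z.2.1) * (K.indicator (fun _ => b) z.2.2)))
        (τ.prod (ν.prod ν)) := by
      have hK : Integrable (K.indicator fun _ => b) ν :=
        (integrable_indicator_iff hbF.compact.measurableSet).2
          (integrableOn_const (hs := hbF.compact.measure_lt_top.ne))
      exact (integrable_const (1 : ℝ)).mul_prod (hK.mul_prod hK)
    refine hI.mono' ((continuous_conj.measurable.comp hmF).mul hmG).aestronglyMeasurable
      (Eventually.of_forall fun z => ?_)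
    simp only [Function.uncurry, hf]
    rw [norm_mul, RCLike.norm_conj, one_mul]
    exact mul_le_mul (norm_integrand_le hbF hM0 hM _ _ _) (norm_integrand_le hbG hM0 hM _ _ _)
      (norm_nonneg _) ((norm_nonneg _).trans (norm_integrand_le hbF hM0 hM z.2.1 k z.1))
  simp_rw [h1]
  rw [integral_integral_swap hint, smearedKernel]
  refine integral_congr_ae (Eventually.of_forall fun y => ?_)
  simp only [hf, twoPointKernel]
  rw [← integral_const_mul]
  refine integral_congr_ae (Eventually.of_forall fun a => ?_)
  simp only [map_mul]
  ring

/-- The inner product of one-particle vectors in terms of the two-point kernel. -/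
theorem integral_conj_oneParticle_mul (hu : IsRegularIntertwiner m u)
    (hF : IsTestFunction F) (hG : IsTestFunction G) :
    ∫ x, conj (oneParticle m ν u F x) * oneParticle m ν u G x ∂((shellMeasure m).prod τ) =
      ∫ k, (shellDensity m k : ℂ) * smearedKernel m τ ν u F G k := by
  have hint : Integrable (fun x => conj (oneParticle m ν u F x) * oneParticle m ν u G x)
      ((shellMeasure m).prod τ) :=
    MemLp.integrable_mul (p := 2) (q := 2) (memLp_oneParticle hu hF).star (memLp_oneParticle hu hG)
  rw [integral_prod _ hint, integral_shellMeasure]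
  simp_rw [integral_conj_oneParticle_mul_spin hu hF hG]

end OneParticle

/-! ### Regularity of the intertwiners -/

theorem measurable_mink_toC {X : Type*} [MeasurableSpace X] {e q : X → Fin 4 → ℝ}
    (he : Measurable e) (hq : Measurable q) :
    Measurable fun x => mink (toC (e x)) (toC (q x)) := by
  have h : ∀ i, Measurable fun x => e x i := fun i => (measurable_pi_apply i).comp he
  have h' : ∀ i, Measurable fun x => q x i := fun i => (measurable_pi_apply i).comp hq
  have hc : ∀ i, Measurable fun x => ((e x i : ℝ) : ℂ) * ((q x i : ℝ) : ℂ) := fun i =>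
    (measurable_ofReal.comp (h i)).mul (measurable_ofReal.comp (h' i))
  exact (((hc 0).sub (hc 1)).sub (hc 2)).sub (hc 3)

theorem measurable_rootNegSq_toC {X : Type*} [MeasurableSpace X] {e : X → Fin 4 → ℝ}
    (he : Measurable e) : Measurable fun x => rootNegSq (toC (e x)) :=
  (measurable_mink_toC he he).neg.pow_const _

theorem norm_koehlerFactor_toC (κ : ℝ) {e : Fin 4 → ℝ} (he : mink e e ≤ 0) (p : Fin 4 → ℝ) :
    ‖koehlerFactor κ (toC e) p‖ = 1 := by
  rw [koehlerFactor, rootNegSq_toC he, mink_toC]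
  have : -(I * κ * (Real.sqrt (-(mink e e)) : ℝ) / ((mink e p : ℝ) : ℂ)) =
      ((-(κ * Real.sqrt (-(mink e e)) / mink e p) : ℝ) : ℂ) * I := by
    push_cast
    ring
  rw [this, norm_exp_ofReal_mul_I]

theorem norm_standardIntertwiner_toC (κ : ℝ) (B : (Fin 4 → ℝ) → Matrix (Fin 4) (Fin 4) ℝ)
    {e : Fin 4 → ℝ} (he : mink e e ≤ 0) (p : Fin 4 → ℝ) (θ : ℝ) :
    ‖standardIntertwiner κ B (toC e) p θ‖ = 1 := by
  rw [standardIntertwiner, norm_mul, norm_koehlerFactor_toC κ he, one_mul, mink_toC, mink_toC]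
  generalize mink e ((B p).mulVec ![0, κ * Real.cos θ, κ * Real.sin θ, 0]) = x
  have : -(I * (x : ℂ) / ((mink e p : ℝ) : ℂ)) = ((-(x / mink e p) : ℝ) : ℂ) * I := by
    push_cast
    ring
  rw [this, norm_exp_ofReal_mul_I]

theorem isRegularIntertwiner_standard (κ : ℝ) {B : (Fin 4 → ℝ) → Matrix (Fin 4) (Fin 4) ℝ}
    (hB : IsBoostFamily 0 ![1, 0, 0, 1] B) :
    IsRegularIntertwiner 0 (standardIntertwiner κ B) where
  measurable := by
    have he : Measurable fun x : ((Fin 3 → ℝ) × ℝ) × (Fin 4 → ℝ) => x.2 := measurable_snd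
    have hp : Measurable fun x : ((Fin 3 → ℝ) × ℝ) × (Fin 4 → ℝ) => onShell 0 x.1.1 :=
      (measurable_onShell 0).comp (measurable_fst.comp measurable_fst)
    have hBm : ∀ i j, Measurable fun x : ((Fin 3 → ℝ) × ℝ) × (Fin 4 → ℝ) =>
        B (onShell 0 x.1.1) i j := fun i j => (hB.measurable i j).comp hp
    have hq : Measurable fun x : ((Fin 3 → ℝ) × ℝ) × (Fin 4 → ℝ) =>
        (B (onShell 0 x.1.1)).mulVec ![0, κ * Real.cos x.1.2, κ * Real.sin x.1.2, 0] := by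
      refine measurable_pi_iff.2 fun i => ?_
      simp only [Matrix.mulVec, dotProduct, Fin.sum_univ_four, Matrix.cons_val_zero,
        Matrix.cons_val_one, Matrix.cons_val, mul_zero, zero_add, add_zero]
      refine ((hBm i 1).mul ?_).add ((hBm i 2).mul ?_) <;> fun_prop
    have h1 : Measurable fun x : ((Fin 3 → ℝ) × ℝ) × (Fin 4 → ℝ) =>
        koehlerFactor κ (toC x.2) (onShell 0 x.1.1) :=
      (((measurable_rootNegSq_toC he).const_mul (I * κ)).div (measurable_mink_toC he hp)).neg.cexp
    exact h1.mul (((measurable_mink_toC he hq).const_mul I).div (measurable_mink_toC he hp)).neg.cexp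
  bounded K _ hK' δ _ := ⟨1, zero_le_one, fun e he k a _ =>
    (norm_standardIntertwiner_toC κ B (hK' e he).le _ a).le⟩

/-- The exact norm (1 + x)^(2s) is at most exp(2sx), and s m² ≤ κ² makes the exponent uniform in s.
This bound justifies both interchanges of limit and integral. -/
theorem sum_norm_rescaledIntertwiner_sq_le {κ : ℝ} (hκ : 0 < κ)
    {B : ℕ → (Fin 4 → ℝ) → Matrix (Fin 4) (Fin 4) ℝ}
    (hB : ∀ s, 0 < s → IsBoostFamily (plMass κ s) ![plMass κ s, 0, 0, 0] (B s))
    (T : (s : ℕ) → OrthonormalBasis (Fin (2 * s + 1)) ℝ (stf s)) {K : Set (Fin 4 → ℝ)}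
    (hK : IsCompact K) (hK' : ∀ e ∈ K, mink e e < 0) {δ : ℝ} (hδ : 0 < δ) :
    ∃ M, 0 ≤ M ∧ ∀ s, 0 < s → ∀ e ∈ K, ∀ k, δ ≤ |mink e (onShell (plMass κ s) k)| →
      ∑ n, ‖rescaledIntertwiner (plMass κ s) s (B s) (T s) (toC e)
        (onShell (plMass κ s) k) n‖ ^ 2 ≤ M := by
  obtain ⟨R, hR⟩ := hK.exists_bound_of_continuousOn (f := fun e : Fin 4 → ℝ => mink e e)
    (Continuous.continuousOn (by unfold mink; fun_prop))
  refine ⟨Real.exp (2 * (κ ^ 2 * R / δ ^ 2)), (Real.exp_pos _).le, fun s hs e he k hd => ?_⟩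
  have hm := plMass_pos hκ hs
  set p := onShell (plMass κ s) k
  have hne : mink e p ≠ 0 := by
    intro h
    rw [h, abs_zero] at hd
    linarith
  have hRe : -(mink e e) ≤ R := (neg_le_abs _).trans (hR e he)
  have hR0 : 0 ≤ R := (abs_nonneg _).trans (hR e he)
  have hneg := hK' e he
  have hsq : δ ^ 2 ≤ mink e p ^ 2 := by
    rw [← sq_abs (mink e p)]
    gcongr
  rw [sum_norm_rescaledIntertwiner_sq hm.ne' (hB s hs) (T s) (onShell_mem_of_pos hm k) hneg hne]
  have hx0 : 0 ≤ plMass κ s ^ 2 * -(mink e e) / mink e p ^ 2 := by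
    have : 0 < -(mink e e) := by linarith
    positivity
  have hx : plMass κ s ^ 2 * -(mink e e) / mink e p ^ 2 ≤ plMass κ s ^ 2 * R / δ ^ 2 := by gcongr
  have hs' : (0 : ℝ) < s := by exact_mod_cast hs
  have hsm : s * plMass κ s ^ 2 ≤ κ ^ 2 := by
    rw [plMass_sq, mul_div_assoc', div_le_iff₀ (by positivity)]
    nlinarith [mul_pos (pow_pos hκ 2) hs', mul_pos (mul_pos (pow_pos hκ 2) hs') hs']
  calc (1 + plMass κ s ^ 2 * -(mink e e) / mink e p ^ 2) ^ (2 * s)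
      ≤ (Real.exp (plMass κ s ^ 2 * R / δ ^ 2)) ^ (2 * s) := by
        gcongr
        rw [add_comm]
        exact (Real.add_one_le_exp _).trans (Real.exp_le_exp.2 hx)
    _ = Real.exp (2 * ((s * plMass κ s ^ 2) * R / δ ^ 2)) := by
        rw [← Real.exp_nat_mul]
        congr 1
        push_cast
        ring
    _ ≤ Real.exp (2 * (κ ^ 2 * R / δ ^ 2)) := by gcongr

theorem isRegularIntertwiner_rescaled {κ : ℝ} (hκ : 0 < κ)
    {B : ℕ → (Fin 4 → ℝ) → Matrix (Fin 4) (Fin 4) ℝ}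
    (hB : ∀ s, 0 < s → IsBoostFamily (plMass κ s) ![plMass κ s, 0, 0, 0] (B s))
    (T : (s : ℕ) → OrthonormalBasis (Fin (2 * s + 1)) ℝ (stf s)) {s : ℕ} (hs : 0 < s) :
    IsRegularIntertwiner (plMass κ s) (rescaledIntertwiner (plMass κ s) s (B s) (T s)) where
  measurable := by
    have hm := plMass_pos hκ hs
    have hswap : Measurable fun x : ((Fin 3 → ℝ) × Fin (2 * s + 1)) × (Fin 4 → ℝ) =>
        (((x.1.1, x.2), x.1.2) : ((Fin 3 → ℝ) × (Fin 4 → ℝ)) × Fin (2 * s + 1)) :=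
      ((measurable_fst.comp measurable_fst).prodMk measurable_snd).prodMk
        (measurable_snd.comp measurable_fst)
    have hmain : Measurable fun x : ((Fin 3 → ℝ) × (Fin 4 → ℝ)) × Fin (2 * s + 1) =>
        rescaledIntertwiner (plMass κ s) s (B s) (T s) (toC x.1.2)
          (onShell (plMass κ s) x.1.1) x.2 := by
      refine measurable_from_prod_countable_left fun n => ?_
      have he : Measurable fun x : (Fin 3 → ℝ) × (Fin 4 → ℝ) => x.2 := measurable_snd
      have hp : Measurable fun x : (Fin 3 → ℝ) × (Fin 4 → ℝ) => onShell (plMass κ s) x.1 :=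
        (measurable_onShell _).comp measurable_fst
      have hcol : ∀ a : Fin 3, Measurable fun x : (Fin 3 → ℝ) × (Fin 4 → ℝ) =>
          fun μ => B s (onShell (plMass κ s) x.1) μ a.succ := fun a =>
        measurable_pi_iff.2 fun μ => ((hB s hs).measurable μ a.succ).comp hp
      have hpol : ∀ a : Fin 3, Measurable fun x : (Fin 3 → ℝ) × (Fin 4 → ℝ) =>
          polarization (plMass κ s) (B s) (toC x.2) (onShell (plMass κ s) x.1) a := fun a =>
        ((measurable_mink_toC he hp).const_div _).mul (measurable_mink_toC he (hcol a))
      have hharm : Measurable fun x : (Fin 3 → ℝ) × (Fin 4 → ℝ) => harmonic (T s n)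
          (polarization (plMass κ s) (B s) (toC x.2) (onShell (plMass κ s) x.1)) := by
        unfold harmonic tensorEval
        exact Finset.measurable_sum _ fun i _ =>
          (Finset.measurable_prod _ fun j _ => hpol (i j)).const_mul _
      have hop : Measurable fun x : (Fin 3 → ℝ) × (Fin 4 → ℝ) =>
          operatorFactor (plMass κ s) s (toC x.2) (onShell (plMass κ s) x.1) := by
        unfold operatorFactor stringInt
        exact ((((measurable_rootNegSq_toC he).const_mul _).mul
          ((measurable_mink_toC he hp).const_div I)).const_sub 1).pow_const s
      -- The harmonic form is valid at every point, including (ep) = 0, so measurability can be read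
      -- off from it.
      have heq : (fun x : (Fin 3 → ℝ) × (Fin 4 → ℝ) => rescaledIntertwiner (plMass κ s) s (B s)
          (T s) (toC x.2) (onShell (plMass κ s) x.1) n) = fun x => (normConst s : ℂ) *
          operatorFactor (plMass κ s) s (toC x.2) (onShell (plMass κ s) x.1) *
          harmonic (T s n)
            (polarization (plMass κ s) (B s) (toC x.2) (onShell (plMass κ s) x.1)) := by
        funext x
        rw [rescaledIntertwiner, escortIntertwiner_eq hm.ne' (hB s hs) (T s) _
          (onShell_mem_of_pos hm x.1)]
      simp only [heq]
      exact (hop.const_mul (normConst s : ℂ)).mul hharm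
    simpa only [Function.comp_def] using hmain.comp hswap
  bounded K hK hK' δ hδ := by
    obtain ⟨M, hM0, hM⟩ := sum_norm_rescaledIntertwiner_sq_le hκ hB T hK hK' hδ
    refine ⟨Real.sqrt M, Real.sqrt_nonneg _, fun e he k n hd => ?_⟩
    refine Real.le_sqrt_of_sq_le ((Finset.single_le_sum (f := fun n =>
      ‖rescaledIntertwiner (plMass κ s) s (B s) (T s) (toC e) (onShell (plMass κ s) k) n‖ ^ 2)
      (fun n _ => sq_nonneg _) (Finset.mem_univ n)).trans (hM s hs e he k hd))

theorem norm_twoPointKernel_count_le {n : ℕ} (u : (Fin 4 → ℂ) → (Fin 4 → ℝ) → Fin n → ℂ)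
    {e₁ e₂ : Fin 4 → ℂ} {p : Fin 4 → ℝ} {M : ℝ} (h₁ : ∑ a, ‖u e₁ p a‖ ^ 2 ≤ M)
    (h₂ : ∑ a, ‖u e₂ p a‖ ^ 2 ≤ M) : ‖twoPointKernel Measure.count u e₁ e₂ p‖ ≤ M := by
  rw [twoPointKernel_count]
  calc ‖∑ a, conj (u e₁ p a) * u e₂ p a‖ ≤ ∑ a, ‖conj (u e₁ p a) * u e₂ p a‖ := norm_sum_le _ _
    _ ≤ ∑ a, (‖u e₁ p a‖ ^ 2 + ‖u e₂ p a‖ ^ 2) / 2 := by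
        refine Finset.sum_le_sum fun a _ => ?_
        rw [norm_mul, RCLike.norm_conj]
        nlinarith [sq_nonneg (‖u e₁ p a‖ - ‖u e₂ p a‖)]
    _ = (∑ a, ‖u e₁ p a‖ ^ 2 + ∑ a, ‖u e₂ p a‖ ^ 2) / 2 := by
        rw [← Finset.sum_add_distrib, Finset.sum_div]
    _ ≤ M := by linarith

/-! ### Convergence of the inner products of one-particle vectors -/

section Gram

variable {κ : ℝ} {B₀ : (Fin 4 → ℝ) → Matrix (Fin 4) (Fin 4) ℝ}
  {B : ℕ → (Fin 4 → ℝ) → Matrix (Fin 4) (Fin 4) ℝ}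
  {T : (s : ℕ) → OrthonormalBasis (Fin (2 * s + 1)) ℝ (stf s)}
  {ν : Measure (Fin 4 → ℝ)} {F G : (Fin 4 → ℝ) → (Fin 4 → ℝ) → ℂ}

theorem tendsto_testFunction_mul_testFunction (hκ : 0 < κ) (hF : IsTestFunction F)
    (hG : IsTestFunction G) (e f : Fin 4 → ℝ) (k : Fin 3 → ℝ) :
    Tendsto (fun s => conj (F e (onShell (plMass κ s) k)) * G f (onShell (plMass κ s) k)) atTop
      (𝓝 (conj (F e (onShell 0 k)) * G f (onShell 0 k))) := by
  have hp := tendsto_onShell (tendsto_plMass hκ) (tendsto_const_nhds (x := k))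
  have hcF : Continuous (F e) := hF.continuous.comp (continuous_const.prodMk continuous_id)
  have hcG : Continuous (G f) := hG.continuous.comp (continuous_const.prodMk continuous_id)
  exact ((continuous_conj.tendsto _).comp ((hcF.tendsto _).comp hp)).mul ((hcG.tendsto _).comp hp)

/-- Where the kernels are not known to converge, the test function vanishes, also along the
approximating momenta, since its support keeps |(ep)| ≥ δ. -/
theorem eventually_testFunction_eq_zero (hκ : 0 < κ) (hF : IsTestFunction F) {e : Fin 4 → ℝ}
    {k : Fin 3 → ℝ} (h : ¬(mink e e < 0 ∧ mink e (onShell 0 k) ≠ 0)) :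
    F e (onShell 0 k) = 0 ∧ ∀ᶠ s in atTop, F e (onShell (plMass κ s) k) = 0 := by
  obtain ⟨K, δ, c, C, hb⟩ := hF.exists_bound
  have hcases : 0 ≤ mink e e ∨ mink e (onShell 0 k) = 0 := by
    by_contra! h'
    exact h h'
  rcases hcases with h | h
  · have : ∀ p, F e p = 0 := fun p => by
      by_contra hne
      exact absurd (hb.spacelike e (hb.support e p hne).1) (not_lt.2 h)
    exact ⟨this _, Eventually.of_forall fun s => this _⟩
  · have hz : ∀ p, |mink e p| < δ → F e p = 0 := fun p hp => by
      by_contra hne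
      exact absurd (hb.support e p hne).2.1 (not_le.2 hp)
    have hp := tendsto_onShell (tendsto_plMass hκ) (tendsto_const_nhds (x := k))
    have hc : Continuous fun p : Fin 4 → ℝ => |mink e p| := by
      unfold mink
      fun_prop
    have ht := (hc.tendsto _).comp hp
    rw [h, abs_zero] at ht
    refine ⟨hz _ (by rw [h, abs_zero]; exact hb.delta_pos), ?_⟩
    filter_upwards [ht.eventually_lt_const hb.delta_pos] with s hs
    exact hz _ hs

theorem tendsto_smearedKernel_integrand (hκ : 0 < κ)
    (hB₀ : IsBoostFamily 0 ![1, 0, 0, 1] B₀)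
    (hB : ∀ s, 0 < s → IsBoostFamily (plMass κ s) ![plMass κ s, 0, 0, 0] (B s))
    (hF : IsTestFunction F) (hG : IsTestFunction G) (y : (Fin 4 → ℝ) × (Fin 4 → ℝ))
    (k : Fin 3 → ℝ) :
    Tendsto (fun s => conj (F y.1 (onShell (plMass κ s) k)) * G y.2 (onShell (plMass κ s) k) *
      twoPointKernel Measure.count (rescaledIntertwiner (plMass κ s) s (B s) (T s))
        (toC y.1) (toC y.2) (onShell (plMass κ s) k)) atTop
      (𝓝 (conj (F y.1 (onShell 0 k)) * G y.2 (onShell 0 k) *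
      twoPointKernel circleMeasure (standardIntertwiner κ B₀) (toC y.1) (toC y.2)
        (onShell 0 k))) := by
  by_cases h1 : mink y.1 y.1 < 0 ∧ mink y.1 (onShell 0 k) ≠ 0
  · by_cases h2 : mink y.2 y.2 < 0 ∧ mink y.2 (onShell 0 k) ≠ 0
    · have hne1 : mink (toC y.1) (toC (onShell 0 k)) ≠ 0 := by
        rw [mink_toC]
        exact_mod_cast h1.2
      have hne2 : mink (toC y.2) (toC (onShell 0 k)) ≠ 0 := by
        rw [mink_toC]
        exact_mod_cast h2.2
      rw [twoPointKernel_standardIntertwiner hB₀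
        (onShell_mem_of_ne (ne_zero_of_mink_onShell_ne hne1)) hne1 hne2]
      exact (tendsto_testFunction_mul_testFunction hκ hF hG y.1 y.2 k).mul
        (tendsto_twoPointKernel_rescaled hκ hB T tendsto_id tendsto_const_nhds tendsto_const_nhds
          tendsto_const_nhds (Or.inl ⟨y.1, rfl, h1.1⟩) (Or.inl ⟨y.2, rfl, h2.1⟩) hne1 hne2)
    · obtain ⟨hz, hev⟩ := eventually_testFunction_eq_zero hκ hG h2
      rw [hz, mul_zero, zero_mul]
      refine tendsto_const_nhds.congr' ?_
      filter_upwards [hev] with s hs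
      rw [hs, mul_zero, zero_mul]
  · obtain ⟨hz, hev⟩ := eventually_testFunction_eq_zero hκ hF h1
    rw [hz, map_zero, zero_mul, zero_mul]
    refine tendsto_const_nhds.congr' ?_
    filter_upwards [hev] with s hs
    rw [hs, map_zero, zero_mul, zero_mul]

theorem exists_bound_smearedKernel_integrand (hκ : 0 < κ)
    (hB : ∀ s, 0 < s → IsBoostFamily (plMass κ s) ![plMass κ s, 0, 0, 0] (B s))
    (hF : IsTestFunction F) (hG : IsTestFunction G) :
    ∃ K : Set (Fin 4 → ℝ), IsCompact K ∧ ∃ c A : ℝ, 0 < c ∧ 0 ≤ A ∧ ∀ s, 0 < s → ∀ y k,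
      ‖conj (F y.1 (onShell (plMass κ s) k)) * G y.2 (onShell (plMass κ s) k) *
        twoPointKernel Measure.count (rescaledIntertwiner (plMass κ s) s (B s) (T s))
          (toC y.1) (toC y.2) (onShell (plMass κ s) k)‖ ≤
      (K ×ˢ K).indicator (fun _ => if c ≤ ‖onShell (plMass κ s) k‖ then
        A * ((1 + ‖k‖) ^ 4)⁻¹ else 0) y := by
  obtain ⟨K, δ, c, C, hbF, hbG⟩ := hF.exists_common_bound hG
  obtain ⟨M, hM0, hM⟩ := sum_norm_rescaledIntertwiner_sq_le hκ hB T hbF.compact hbF.spacelike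
    hbF.delta_pos
  have hC := hbF.const_nonneg
  refine ⟨K, hbF.compact, c, C * C * M, hbF.c_pos, by positivity, fun s hs y k => ?_⟩
  by_cases h1 : F y.1 (onShell (plMass κ s) k) = 0
  · rw [h1, map_zero, zero_mul, zero_mul, norm_zero]
    refine Set.indicator_nonneg (fun _ _ => ?_) _
    split_ifs <;> positivity
  by_cases h2 : G y.2 (onShell (plMass κ s) k) = 0
  · rw [h2, mul_zero, zero_mul, norm_zero]
    refine Set.indicator_nonneg (fun _ _ => ?_) _
    split_ifs <;> positivity
  obtain ⟨a1, a2, a3⟩ := hbF.support _ _ h1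
  obtain ⟨b1, b2, b3⟩ := hbG.support _ _ h2
  rw [Set.indicator_of_mem (Set.mk_mem_prod a1 b1), if_pos a3, norm_mul, norm_mul,
    RCLike.norm_conj]
  have hk := norm_twoPointKernel_count_le
    (rescaledIntertwiner (plMass κ s) s (B s) (T s)) (hM s hs _ a1 k a2) (hM s hs _ b1 k b2)
  have hF' := hbF.norm_le_onShell y.1 (plMass κ s) k
  have hG' := hbG.norm_le_onShell y.2 (plMass κ s) k
  have hG'' : C / (1 + ‖k‖) ^ 4 ≤ C :=
    div_le_self hC (one_le_pow₀ (by linarith [norm_nonneg k]))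
  calc ‖F y.1 (onShell (plMass κ s) k)‖ * ‖G y.2 (onShell (plMass κ s) k)‖ *
        ‖twoPointKernel Measure.count (rescaledIntertwiner (plMass κ s) s (B s) (T s))
          (toC y.1) (toC y.2) (onShell (plMass κ s) k)‖
      ≤ (C / (1 + ‖k‖) ^ 4) * C * M := by
        gcongr
        exact hG'.trans hG''
    _ = C * C * M * ((1 + ‖k‖) ^ 4)⁻¹ := by ring

variable [IsLocallyFiniteMeasure ν]

theorem integrable_indicator_prod {K : Set (Fin 4 → ℝ)} (hK : IsCompact K) (b : ℝ) :
    Integrable ((K ×ˢ K).indicator fun _ => b) (ν.prod ν) :=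
  (integrable_indicator_iff (hK.measurableSet.prod hK.measurableSet)).2
    (integrableOn_const (hs := (hK.prod hK).measure_lt_top.ne))

theorem tendsto_smearedKernel (hκ : 0 < κ) (hB₀ : IsBoostFamily 0 ![1, 0, 0, 1] B₀)
    (hB : ∀ s, 0 < s → IsBoostFamily (plMass κ s) ![plMass κ s, 0, 0, 0] (B s))
    (hF : IsTestFunction F) (hG : IsTestFunction G) (k : Fin 3 → ℝ) :
    Tendsto (fun s => smearedKernel (plMass κ s) Measure.count ν
      (rescaledIntertwiner (plMass κ s) s (B s) (T s)) F G k) atTop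
      (𝓝 (smearedKernel 0 circleMeasure ν (standardIntertwiner κ B₀) F G k)) := by
  obtain ⟨K, hK, c, A, hc, hA, hb⟩ := exists_bound_smearedKernel_integrand (T := T) hκ hB hF hG
  refine tendsto_integral_filter_of_dominated_convergence
    ((K ×ˢ K).indicator fun _ => A * ((1 + ‖k‖) ^ 4)⁻¹) ?_ ?_ (integrable_indicator_prod hK _)
    (Eventually.of_forall fun y => tendsto_smearedKernel_integrand hκ hB₀ hB hF hG y k)
  · filter_upwards [eventually_gt_atTop 0] with s hs
    exact ((stronglyMeasurable_smearedKernel_integrand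
      (isRegularIntertwiner_rescaled hκ hB T hs) hF hG).comp_measurable
      (measurable_const.prodMk measurable_id)).aestronglyMeasurable
  · filter_upwards [eventually_gt_atTop 0] with s hs
    refine Eventually.of_forall fun y => (hb s hs y k).trans ?_
    refine Set.indicator_le_indicator ?_
    split_ifs
    · exact le_rfl
    · positivity

/-- Convergence of the inner products of one-particle vectors. -/
theorem tendsto_integral_conj_oneParticle_mul (hκ : 0 < κ)
    (hB₀ : IsBoostFamily 0 ![1, 0, 0, 1] B₀)
    (hB : ∀ s, 0 < s → IsBoostFamily (plMass κ s) ![plMass κ s, 0, 0, 0] (B s))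
    (hF : IsTestFunction F) (hG : IsTestFunction G) :
    Tendsto (fun s => ∫ x, conj (oneParticle (plMass κ s) ν
        (rescaledIntertwiner (plMass κ s) s (B s) (T s)) F x) *
      oneParticle (plMass κ s) ν (rescaledIntertwiner (plMass κ s) s (B s) (T s)) G x
        ∂((shellMeasure (plMass κ s)).prod Measure.count)) atTop
      (𝓝 (∫ x, conj (oneParticle 0 ν (standardIntertwiner κ B₀) F x) *
        oneParticle 0 ν (standardIntertwiner κ B₀) G x
        ∂((shellMeasure 0).prod circleMeasure))) := by
  rw [integral_conj_oneParticle_mul (isRegularIntertwiner_standard κ hB₀) hF hG]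
  have hev : ∀ᶠ s in atTop, ∫ k, (shellDensity (plMass κ s) k : ℂ) *
      smearedKernel (plMass κ s) Measure.count ν
        (rescaledIntertwiner (plMass κ s) s (B s) (T s)) F G k =
      ∫ x, conj (oneParticle (plMass κ s) ν
        (rescaledIntertwiner (plMass κ s) s (B s) (T s)) F x) *
      oneParticle (plMass κ s) ν (rescaledIntertwiner (plMass κ s) s (B s) (T s)) G x
        ∂((shellMeasure (plMass κ s)).prod Measure.count) := by
    filter_upwards [eventually_gt_atTop 0] with s hs
    rw [integral_conj_oneParticle_mul (isRegularIntertwiner_rescaled hκ hB T hs) hF hG]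
  refine Tendsto.congr' hev ?_
  obtain ⟨K, hK, c, A, hc, hA, hb⟩ := exists_bound_smearedKernel_integrand (T := T) hκ hB hF hG
  refine tendsto_integral_filter_of_dominated_convergence
    (fun k => (1 / c * ((ν.prod ν).real (K ×ˢ K) * A)) * ((1 + ‖k‖) ^ 4)⁻¹) ?_ ?_
    (integrable_inv_one_add_norm_pow_four.const_mul _) ?_
  · filter_upwards [eventually_gt_atTop 0] with s hs
    exact ((measurable_ofReal.comp (measurable_shellDensity _)).stronglyMeasurable.mul
      (stronglyMeasurable_smearedKernel (isRegularIntertwiner_rescaled hκ hB T hs) hF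
        hG)).aestronglyMeasurable
  · filter_upwards [eventually_gt_atTop 0] with s hs
    refine Eventually.of_forall fun k => ?_
    have h := norm_integral_le_of_norm_le (integrable_indicator_prod (ν := ν) hK _)
      (Eventually.of_forall fun y => hb s hs y k)
    rw [integral_indicator (hK.measurableSet.prod hK.measurableSet), setIntegral_const,
      smul_eq_mul] at h
    rw [norm_mul, Complex.norm_real, Real.norm_of_nonneg (shellDensity_nonneg _ _)]
    split_ifs at h with hck
    · calc shellDensity (plMass κ s) k * ‖smearedKernel (plMass κ s) Measure.count ν
            (rescaledIntertwiner (plMass κ s) s (B s) (T s)) F G k‖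
          ≤ 1 / c * ((ν.prod ν).real (K ×ˢ K) * (A * ((1 + ‖k‖) ^ 4)⁻¹)) :=
            mul_le_mul (shellDensity_le hc hck) h (norm_nonneg _) (by positivity)
        _ = _ := by ring
    · have h0 : ‖smearedKernel (plMass κ s) Measure.count ν
            (rescaledIntertwiner (plMass κ s) s (B s) (T s)) F G k‖ = 0 :=
        le_antisymm (h.trans (by rw [mul_zero])) (norm_nonneg _)
      rw [h0, mul_zero]
      positivity
  · have hne : ∀ᵐ k : Fin 3 → ℝ, k ≠ 0 := by simp [ae_iff]
    filter_upwards [hne] with k hk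
    refine Tendsto.mul ?_ (tendsto_smearedKernel hκ hB₀ hB hF hG k)
    refine (continuous_ofReal.tendsto _).comp ?_
    have hp := tendsto_onShell (tendsto_plMass hκ) (tendsto_const_nhds (x := k))
    have h0 := (continuous_apply (0 : Fin 4)).tendsto (onShell 0 k) |>.comp hp
    have hpos : 0 < onShell 0 k 0 := (onShell_mem_of_ne hk).2
    unfold shellDensity
    exact tendsto_const_nhds.div ((h0.const_mul 2).const_mul _) (by positivity)

end Gram

/-! ### Wightman functions on Fock space -/

section Fock

variable {X : Type*}

theorem create_zero (ψ : X → ℂ) : create ψ 0 = 0 := by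
  funext n x
  cases n with
  | zero => rfl
  | succ n => simp [create]

theorem create_add (ψ : X → ℂ) (Φ Ψ : FockVector X) :
    create ψ (Φ + Ψ) = create ψ Φ + create ψ Ψ := by
  funext n x
  cases n with
  | zero => simp [create]
  | succ n => simp [create, mul_add, Finset.sum_add_distrib]

theorem create_smul (ψ : X → ℂ) (c : ℂ) (Φ : FockVector X) :
    create ψ (c • Φ) = c • create ψ Φ := by
  funext n x
  cases n with
  | zero => simp [create]
  | succ n =>
    simp only [create, Pi.smul_apply, smul_eq_mul, Finset.mul_sum]
    exact Finset.sum_congr rfl fun i _ => by ring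

/-- The state `a^*(ψ₁) ⋯ a^*(ψ_n) Ω`. -/
def creationState (ψs : List (X → ℂ)) : FockVector X := ψs.foldr create (vacuum X)

theorem removeNth_succ_cons {n : ℕ} (i : Fin (n + 1)) (y : X) (x : Fin (n + 1) → X) :
    i.succ.removeNth (Fin.cons y x : Fin (n + 2) → X) = Fin.cons y (i.removeNth x) := by
  funext j
  refine Fin.cases ?_ (fun j => ?_) j
  · simp [Fin.removeNth]
  · simp [Fin.removeNth]

/-- Separates the term in which ψ occupies the new slot; integrated against χ it becomes the
contraction in the commutation relation. -/
theorem create_cons (ψ : X → ℂ) (Φ : FockVector X) {n : ℕ} (y : X) (x : Fin n → X) :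
    create ψ Φ (n + 1) (Fin.cons y x) =
      ((Real.sqrt (n + 1))⁻¹ : ℂ) * (ψ y * Φ n x + ∑ i : Fin n, ψ (x i) *
        Φ n (i.succ.removeNth (Fin.cons y x : Fin (n + 1) → X))) := by
  simp only [create]
  rw [Fin.sum_univ_succ]
  simp

variable [MeasurableSpace X] {μ : Measure X}

/-- Fock vectors that are square integrable in the first argument, for every value of the others. -/
def SectionwiseMemLp (μ : Measure X) (Φ : FockVector X) : Prop :=
  ∀ n (x : Fin n → X), MemLp (fun y => Φ (n + 1) (Fin.cons y x)) 2 μ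

theorem sectionwiseMemLp_vacuum : SectionwiseMemLp μ (vacuum X) := fun _ _ => MemLp.zero

theorem SectionwiseMemLp.add {Φ Ψ : FockVector X} (hΦ : SectionwiseMemLp μ Φ)
    (hΨ : SectionwiseMemLp μ Ψ) : SectionwiseMemLp μ (Φ + Ψ) :=
  fun n x => (hΦ n x).add (hΨ n x)

theorem SectionwiseMemLp.smul {Φ : FockVector X} (hΦ : SectionwiseMemLp μ Φ) (c : ℂ) :
    SectionwiseMemLp μ (c • Φ) :=
  fun n x => (hΦ n x).const_mul c

theorem SectionwiseMemLp.create {ψ : X → ℂ} (hψ : MemLp ψ 2 μ) {Φ : FockVector X}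
    (hΦ : SectionwiseMemLp μ Φ) : SectionwiseMemLp μ (create ψ Φ) := by
  intro n x
  simp_rw [create_cons]
  have h1 : MemLp (fun y => ψ y * Φ n x) 2 μ := hψ.mul_const (Φ n x)
  have h2 : ∀ i ∈ Finset.univ, MemLp (fun y => ψ (x i) *
      Φ n (i.succ.removeNth (Fin.cons y x : Fin (n + 1) → X))) 2 μ := by
    intro i _
    cases n with
    | zero => exact i.elim0
    | succ n =>
      simp_rw [removeNth_succ_cons]
      exact (hΦ n _).const_mul _
  exact (h1.add (memLp_finsetSum Finset.univ h2)).const_mul _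

theorem sectionwiseMemLp_creationState {ψs : List (X → ℂ)} (h : ∀ ψ ∈ ψs, MemLp ψ 2 μ) :
    SectionwiseMemLp μ (creationState ψs) := by
  induction ψs with
  | nil => exact sectionwiseMemLp_vacuum
  | cons ψ ψs ih =>
    exact SectionwiseMemLp.create (h ψ (by simp)) (ih fun φ hφ => h φ (by simp [hφ]))

theorem integrable_conj_mul {χ ψ : X → ℂ} (hχ : MemLp χ 2 μ) (hψ : MemLp ψ 2 μ) :
    Integrable (fun y => conj (χ y) * ψ y) μ :=
  MemLp.integrable_mul (p := 2) (q := 2) hχ.star hψ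

theorem annihilate_add {χ : X → ℂ} (hχ : MemLp χ 2 μ) {Φ Ψ : FockVector X}
    (hΦ : SectionwiseMemLp μ Φ) (hΨ : SectionwiseMemLp μ Ψ) :
    annihilate μ χ (Φ + Ψ) = annihilate μ χ Φ + annihilate μ χ Ψ := by
  funext n x
  simp only [annihilate, Pi.add_apply, mul_add]
  rw [integral_add (integrable_conj_mul hχ (hΦ n x)) (integrable_conj_mul hχ (hΨ n x)), mul_add]

theorem annihilate_smul (χ : X → ℂ) (c : ℂ) (Φ : FockVector X) :
    annihilate μ χ (c • Φ) = c • annihilate μ χ Φ := by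
  funext n x
  simp only [annihilate, Pi.smul_apply, smul_eq_mul, mul_left_comm _ c]
  rw [integral_const_mul]
  ring

theorem annihilate_zero (χ : X → ℂ) : annihilate μ χ 0 = 0 := by
  funext n x
  simp [annihilate]

theorem annihilate_vacuum (χ : X → ℂ) : annihilate μ χ (vacuum X) = 0 := by
  funext n x
  simp [annihilate, vacuum]

/-- The canonical commutation relation. -/
theorem annihilate_create {χ ψ : X → ℂ} (hχ : MemLp χ 2 μ) (hψ : MemLp ψ 2 μ)
    {Φ : FockVector X} (hΦ : SectionwiseMemLp μ Φ) :
    annihilate μ χ (create ψ Φ) =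
      (∫ y, conj (χ y) * ψ y ∂μ) • Φ + create ψ (annihilate μ χ Φ) := by
  funext n x
  have hsq : ∀ n : ℕ, (Real.sqrt ((n : ℝ) + 1) : ℂ) * ((Real.sqrt ((n : ℝ) + 1) : ℝ) : ℂ)⁻¹ = 1 :=
    fun n => mul_inv_cancel₀ (by
      have : 0 < Real.sqrt ((n : ℝ) + 1) := Real.sqrt_pos.2 (by positivity)
      exact_mod_cast this.ne')
  simp only [annihilate, create_cons, Pi.add_apply, Pi.smul_apply, smul_eq_mul]
  have h1 : ∀ y, conj (χ y) * ((((Real.sqrt (n + 1) : ℝ) : ℂ))⁻¹ * (ψ y * Φ n x +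
      ∑ i : Fin n, ψ (x i) * Φ n (i.succ.removeNth (Fin.cons y x : Fin (n + 1) → X)))) =
      ((Real.sqrt (n + 1) : ℝ) : ℂ)⁻¹ * ((conj (χ y) * ψ y) * Φ n x + ∑ i : Fin n, ψ (x i) *
        (conj (χ y) * Φ n (i.succ.removeNth (Fin.cons y x : Fin (n + 1) → X)))) := by
    intro y
    rw [mul_left_comm, mul_add, Finset.mul_sum]
    congr 2
    · ring
    · exact Finset.sum_congr rfl fun i _ => by ring
  simp_rw [h1]
  have hint : ∀ i : Fin n, Integrable (fun y => ψ (x i) *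
      (conj (χ y) * Φ n (i.succ.removeNth (Fin.cons y x : Fin (n + 1) → X)))) μ := by
    intro i
    cases n with
    | zero => exact i.elim0
    | succ n =>
      simp_rw [removeNth_succ_cons]
      exact (integrable_conj_mul hχ (hΦ n _)).const_mul _
  -- The square roots of creation and annihilation cancel. The split-off term integrates to the
  -- inner product times Φ, and the remaining sum is creation applied after annihilation.
  rw [integral_const_mul, ← mul_assoc, hsq, one_mul,
    integral_add ((integrable_conj_mul hχ hψ).mul_const _) (integrable_finsetSum _ fun i _ => hint i),
    integral_mul_const, integral_finsetSum _ fun i _ => hint i]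
  congr 1
  cases n with
  | zero => simp [create]
  | succ n =>
    rw [create]
    simp_rw [annihilate, removeNth_succ_cons, integral_const_mul]
    rw [Finset.mul_sum]
    refine Finset.sum_congr rfl fun i _ => ?_
    linear_combination (-(ψ (x i)) *
      ∫ y, conj (χ y) * Φ (n + 1) (Fin.cons y (i.removeNth x)) ∂μ) * hsq n

theorem fockInner_vacuum [SigmaFinite μ] (Φ : FockVector X) :
    fockInner μ (vacuum X) Φ = Φ 0 Fin.elim0 := by
  rw [fockInner, tsum_eq_single 0]
  · rw [integral_unique]
    have : (Measure.pi fun _ : Fin 0 => μ).real Set.univ = 1 := by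
      simp [Measure.real]
    rw [this]
    simp only [vacuum, map_one, one_mul, one_smul]
    congr 1
  · intro n hn
    obtain ⟨n, rfl⟩ := Nat.exists_eq_succ_of_ne_zero hn
    simp [vacuum]

end Fock

section FockLimit

variable {ι : Type*} {X : ℕ → Type*} {X' : Type*} {ψ : ∀ s, ι → X s → ℂ} {ψ' : ι → X' → ℂ}

/-- Pairs of a sequence of Fock vectors and a Fock vector that have the same expansion into
creation states, with convergent coefficients. -/
inductive FockExpansion (ψ : ∀ s, ι → X s → ℂ) (ψ' : ι → X' → ℂ) :
    (∀ s, FockVector (X s)) → FockVector X' → Prop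
  | zero : FockExpansion ψ ψ' (fun _ => 0) 0
  | cons {c : ℕ → ℂ} {c' : ℂ} (hc : Tendsto c atTop (𝓝 c')) (Fs : List ι)
      {Φ : ∀ s, FockVector (X s)} {Φ' : FockVector X'} (h : FockExpansion ψ ψ' Φ Φ') :
      FockExpansion ψ ψ' (fun s => c s • creationState (Fs.map (ψ s)) + Φ s)
        (c' • creationState (Fs.map ψ') + Φ')

theorem FockExpansion.creationState (Fs : List ι) :
    FockExpansion ψ ψ' (fun s => creationState (Fs.map (ψ s))) (creationState (Fs.map ψ')) := by
  simpa using FockExpansion.cons (ψ := ψ) (ψ' := ψ') (tendsto_const_nhds (x := (1 : ℂ))) Fs .zero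

theorem FockExpansion.add {Φ Ψ : ∀ s, FockVector (X s)} {Φ' Ψ' : FockVector X'}
    (hΦ : FockExpansion ψ ψ' Φ Φ') (hΨ : FockExpansion ψ ψ' Ψ Ψ') :
    FockExpansion ψ ψ' (fun s => Φ s + Ψ s) (Φ' + Ψ') := by
  induction hΦ with
  | zero => simpa using hΨ
  | cons hc Fs h ih =>
    simp_rw [add_assoc]
    exact .cons hc Fs ih

theorem FockExpansion.smul {Φ : ∀ s, FockVector (X s)} {Φ' : FockVector X'}
    (hΦ : FockExpansion ψ ψ' Φ Φ') {b : ℕ → ℂ} {b' : ℂ} (hb : Tendsto b atTop (𝓝 b')) :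
    FockExpansion ψ ψ' (fun s => b s • Φ s) (b' • Φ') := by
  induction hΦ with
  | zero => simpa using FockExpansion.zero (ψ := ψ) (ψ' := ψ')
  | cons hc Fs h ih =>
    simp_rw [smul_add, smul_smul]
    exact .cons (hb.mul hc) Fs ih

theorem FockExpansion.create {Φ : ∀ s, FockVector (X s)} {Φ' : FockVector X'}
    (hΦ : FockExpansion ψ ψ' Φ Φ') (F : ι) :
    FockExpansion ψ ψ' (fun s => create (ψ s F) (Φ s)) (create (ψ' F) Φ') := by
  induction hΦ with
  | zero => simpa only [create_zero] using FockExpansion.zero (ψ := ψ) (ψ' := ψ')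
  | cons hc Fs h ih =>
    simp_rw [create_add, create_smul]
    exact .cons hc (F :: Fs) ih

variable [∀ s, MeasurableSpace (X s)] [MeasurableSpace X'] {μ : ∀ s, Measure (X s)}
  {μ' : Measure X'}

theorem FockExpansion.sectionwiseMemLp {Φ : ∀ s, FockVector (X s)} {Φ' : FockVector X'}
    (hΦ : FockExpansion ψ ψ' Φ Φ') (hψ : ∀ s F, MemLp (ψ s F) 2 (μ s))
    (hψ' : ∀ F, MemLp (ψ' F) 2 μ') :
    (∀ s, SectionwiseMemLp (μ s) (Φ s)) ∧ SectionwiseMemLp μ' Φ' := by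
  induction hΦ with
  | zero => exact ⟨fun s n x => MemLp.zero, fun n x => MemLp.zero⟩
  | cons hc Fs h ih =>
    refine ⟨fun s => ((sectionwiseMemLp_creationState ?_).smul _).add (ih.1 s),
      ((sectionwiseMemLp_creationState ?_).smul _).add ih.2⟩
    · intro φ hφ
      obtain ⟨F, -, rfl⟩ := List.mem_map.1 hφ
      exact hψ s F
    · intro φ hφ
      obtain ⟨F, -, rfl⟩ := List.mem_map.1 hφ
      exact hψ' F

/-- The annihilator is commuted to the right until it meets the vacuum. Each commutation produces an
inner product, whose limit is given by `hlim`, as a new coefficient. -/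
theorem FockExpansion.annihilate {Φ : ∀ s, FockVector (X s)} {Φ' : FockVector X'}
    (hΦ : FockExpansion ψ ψ' Φ Φ') (hψ : ∀ s F, MemLp (ψ s F) 2 (μ s))
    (hψ' : ∀ F, MemLp (ψ' F) 2 μ')
    (hlim : ∀ F G, Tendsto (fun s => ∫ y, conj (ψ s F y) * ψ s G y ∂μ s) atTop
      (𝓝 (∫ y, conj (ψ' F y) * ψ' G y ∂μ'))) (F : ι) :
    FockExpansion ψ ψ' (fun s => annihilate (μ s) (ψ s F) (Φ s)) (annihilate μ' (ψ' F) Φ') := by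
  have hstate : ∀ Fs : List ι, FockExpansion ψ ψ'
      (fun s => PauliLubanski.annihilate (μ s) (ψ s F)
        (PauliLubanski.creationState (Fs.map (ψ s))))
      (PauliLubanski.annihilate μ' (ψ' F) (PauliLubanski.creationState (Fs.map ψ'))) := by
    intro Fs
    induction Fs with
    | nil =>
      simp only [List.map_nil, PauliLubanski.creationState, List.foldr_nil, annihilate_vacuum]
      exact .zero
    | cons G Fs ih =>
      have hs := (FockExpansion.creationState (ψ := ψ) (ψ' := ψ') Fs).sectionwiseMemLp hψ hψ'
      have h1 : ∀ s, PauliLubanski.annihilate (μ s) (ψ s F)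
          (PauliLubanski.creationState ((G :: Fs).map (ψ s))) =
          (∫ y, conj (ψ s F y) * ψ s G y ∂μ s) •
            PauliLubanski.creationState (Fs.map (ψ s)) +
          PauliLubanski.create (ψ s G) (PauliLubanski.annihilate (μ s) (ψ s F)
            (PauliLubanski.creationState (Fs.map (ψ s)))) := fun s =>
        annihilate_create (hψ s F) (hψ s G) (hs.1 s)
      have h2 : PauliLubanski.annihilate μ' (ψ' F)
          (PauliLubanski.creationState ((G :: Fs).map ψ')) =
          (∫ y, conj (ψ' F y) * ψ' G y ∂μ') • PauliLubanski.creationState (Fs.map ψ') +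
          PauliLubanski.create (ψ' G) (PauliLubanski.annihilate μ' (ψ' F)
            (PauliLubanski.creationState (Fs.map ψ'))) :=
        annihilate_create (hψ' F) (hψ' G) hs.2
      simp_rw [h1, h2]
      exact .cons (hlim F G) Fs (ih.create G)
  induction hΦ with
  | zero =>
    simp only [annihilate_zero]
    exact .zero
  | @cons c c' hc Fs Φ Φ' h ih =>
    have hs := (FockExpansion.creationState (ψ := ψ) (ψ' := ψ') Fs).sectionwiseMemLp hψ hψ'
    have hs' := h.sectionwiseMemLp hψ hψ'
    have h1 : ∀ s, PauliLubanski.annihilate (μ s) (ψ s F)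
        (c s • PauliLubanski.creationState (Fs.map (ψ s)) + Φ s) =
        c s • PauliLubanski.annihilate (μ s) (ψ s F) (PauliLubanski.creationState (Fs.map (ψ s))) +
          PauliLubanski.annihilate (μ s) (ψ s F) (Φ s) := fun s => by
      rw [annihilate_add (hψ s F) ((hs.1 s).smul _) (hs'.1 s), annihilate_smul]
    have h2 : PauliLubanski.annihilate μ' (ψ' F)
        (c' • PauliLubanski.creationState (Fs.map ψ') + Φ') =
        c' • PauliLubanski.annihilate μ' (ψ' F) (PauliLubanski.creationState (Fs.map ψ')) +
          PauliLubanski.annihilate μ' (ψ' F) Φ' := by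
      rw [annihilate_add (hψ' F) (hs.2.smul _) hs'.2, annihilate_smul]
    simp_rw [h1, h2]
    exact ((hstate Fs).smul hc).add ih

/-- The vacuum sees only the coefficients of the empty product of creators. -/
theorem FockExpansion.tendsto_fockInner_vacuum [∀ s, SigmaFinite (μ s)] [SigmaFinite μ']
    {Φ : ∀ s, FockVector (X s)} {Φ' : FockVector X'} (hΦ : FockExpansion ψ ψ' Φ Φ') :
    Tendsto (fun s => fockInner (μ s) (vacuum (X s)) (Φ s)) atTop
      (𝓝 (fockInner μ' (vacuum X') Φ')) := by
  simp_rw [fockInner_vacuum]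
  induction hΦ with
  | zero => exact tendsto_const_nhds
  | cons hc Fs h ih =>
    refine Tendsto.add ?_ ih
    simp only [Pi.smul_apply, smul_eq_mul]
    cases Fs with
    | nil => simpa [PauliLubanski.creationState, vacuum] using hc
    | cons F Fs => simp [PauliLubanski.creationState, PauliLubanski.create]

end FockLimit

/-! ### Convergence of the vacuum expectation values -/

theorem IsTestFunction.conjTest {F : (Fin 4 → ℝ) → (Fin 4 → ℝ) → ℂ} (hF : IsTestFunction F) :
    IsTestFunction (conjTest F) where
  continuous := continuous_conj.comp
    (hF.continuous.comp (continuous_fst.prodMk continuous_snd.neg))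
  support_dir := by
    obtain ⟨K, hK, hK1, hK2⟩ := hF.support_dir
    refine ⟨K, hK, hK1, fun e he p => ?_⟩
    rw [PauliLubanski.conjTest, hK2 e he, map_zero]
  support_away := by
    obtain ⟨δ, hδ, h⟩ := hF.support_away
    refine ⟨δ, hδ, fun e p hp => ?_⟩
    have hneg : mink e (-p) = -mink e p := by
      simp only [mink, Pi.neg_apply]
      ring
    rw [PauliLubanski.conjTest, h e (-p) (by rwa [hneg, abs_neg]), map_zero]
  decay N := by
    obtain ⟨C, hC⟩ := hF.decay N
    refine ⟨C, fun e p => ?_⟩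
    have := hC e (-p)
    rw [norm_neg] at this
    rwa [PauliLubanski.conjTest, RCLike.norm_conj]

theorem tendsto_wightman {κ : ℝ} (hκ : 0 < κ)
    {B₀ : (Fin 4 → ℝ) → Matrix (Fin 4) (Fin 4) ℝ}
    (hB₀ : IsBoostFamily 0 ![1, 0, 0, 1] B₀)
    {B : ℕ → (Fin 4 → ℝ) → Matrix (Fin 4) (Fin 4) ℝ}
    (hB : ∀ s, 0 < s → IsBoostFamily (plMass κ s) ![plMass κ s, 0, 0, 0] (B s))
    (T : (s : ℕ) → OrthonormalBasis (Fin (2 * s + 1)) ℝ (stf s))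
    (ν : Measure (Fin 4 → ℝ)) [IsLocallyFiniteMeasure ν]
    (Fs : List ((Fin 4 → ℝ) → (Fin 4 → ℝ) → ℂ)) (hFs : ∀ F ∈ Fs, IsTestFunction F) :
    Tendsto (fun s : ℕ => wightman (plMass κ s) Measure.count ν
        (rescaledIntertwiner (plMass κ s) s (B s) (T s)) Fs)
      atTop (𝓝 (wightman 0 circleMeasure ν (standardIntertwiner κ B₀) Fs)) := by
  -- Spin zero is skipped: boosts, and hence square integrability, are available only for positive
  -- spin.
  rw [← tendsto_add_atTop_iff_nat 1]
  let ψ : ∀ s : ℕ, {F // IsTestFunction F} → (Fin 3 → ℝ) × Fin (2 * (s + 1) + 1) → ℂ := fun s F =>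
    oneParticle (plMass κ (s + 1)) ν
      (rescaledIntertwiner (plMass κ (s + 1)) (s + 1) (B (s + 1)) (T (s + 1))) F
  let ψ' : {F // IsTestFunction F} → (Fin 3 → ℝ) × ℝ → ℂ := fun F =>
    oneParticle 0 ν (standardIntertwiner κ B₀) F
  have hψ : ∀ s F, MemLp (ψ s F) 2
      ((shellMeasure (plMass κ (s + 1))).prod Measure.count) := fun s F =>
    memLp_oneParticle (isRegularIntertwiner_rescaled hκ hB T s.succ_pos) F.2
  have hψ' : ∀ F, MemLp (ψ' F) 2 ((shellMeasure 0).prod circleMeasure) := fun F =>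
    memLp_oneParticle (isRegularIntertwiner_standard κ hB₀) F.2
  have hlim : ∀ F G, Tendsto (fun s => ∫ y, conj (ψ s F y) * ψ s G y
      ∂((shellMeasure (plMass κ (s + 1))).prod Measure.count)) atTop
      (𝓝 (∫ y, conj (ψ' F y) * ψ' G y ∂((shellMeasure 0).prod circleMeasure))) := fun F G =>
    (tendsto_add_atTop_iff_nat 1).2
      (tendsto_integral_conj_oneParticle_mul (ν := ν) (T := T) hκ hB₀ hB F.2 G.2)
  have hexp : FockExpansion ψ ψ'
      (fun s => Fs.foldr (fun F Φ => fieldOp (plMass κ (s + 1)) Measure.count ν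
        (rescaledIntertwiner (plMass κ (s + 1)) (s + 1) (B (s + 1)) (T (s + 1))) F Φ) (vacuum _))
      (Fs.foldr (fun F Φ => fieldOp 0 circleMeasure ν (standardIntertwiner κ B₀) F Φ)
        (vacuum _)) := by
    induction Fs with
    | nil => exact FockExpansion.creationState []
    | cons F Fs ih =>
      have hF := hFs F (by simp)
      have h := ih fun G hG => hFs G (by simp [hG])
      exact (h.create ⟨F, hF⟩).add (h.annihilate hψ hψ' hlim ⟨conjTest F, hF.conjTest⟩)
  exact hexp.tendsto_fockInner_vacuum

/-! ### Unitary equivalences from convergent Gram matrices -/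

/-- Almost orthonormal finite families are close to orthonormal ones. -/
theorem exists_orthonormal_of_tendsto_inner {H : ℕ → Type*} [∀ s, NormedAddCommGroup (H s)]
    [∀ s, InnerProductSpace ℂ (H s)] {d : ℕ} {b : ∀ s, Fin d → H s}
    (hb : ∀ i j, Tendsto (fun s => inner ℂ (b s i) (b s j)) atTop
      (𝓝 (if i = j then (1 : ℂ) else 0))) :
    ∃ o : ∀ s, Fin d → H s, (∀ᶠ s in atTop, Orthonormal ℂ (o s)) ∧
      ∀ i, Tendsto (fun s => ‖o s i - b s i‖) atTop (𝓝 0) := by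
  classical
  let g : ∀ s, Fin d → H s := fun s => InnerProductSpace.gramSchmidt ℂ (b s)
  have hb1 : ∀ i, Tendsto (fun s => ‖b s i‖) atTop (𝓝 1) := fun i => by
    have h : Tendsto (fun s => √‖inner ℂ (b s i) (b s i)‖) atTop (𝓝 (√‖(1 : ℂ)‖)) := by
      have := (hb i i).norm.sqrt
      rwa [if_pos rfl] at this
    simpa [inner_self_eq_norm_sq_to_K] using h
  -- Induction along Gram–Schmidt: the overlaps with the earlier vectors tend to 0, so all the
  -- corrections vanish in the limit.
  have key : ∀ n, Tendsto (fun s => ‖g s n - b s n‖) atTop (𝓝 0) ∧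
      Tendsto (fun s => ‖g s n‖) atTop (𝓝 1) := by
    intro n
    induction n using WellFoundedLT.induction with
    | _ n ih =>
    have hdiff : Tendsto (fun s => ‖g s n - b s n‖) atTop (𝓝 0) := by
      have hterm : ∀ i ∈ Finset.Iio n, Tendsto (fun s =>
          ‖inner ℂ (g s i) (b s n)‖ / ‖g s i‖ ^ 2 * ‖g s i‖) atTop (𝓝 0) := by
        intro i hi
        obtain ⟨h1, h2⟩ := ih i (Finset.mem_Iio.1 hi)
        have hin : Tendsto (fun s => ‖inner ℂ (g s i) (b s n)‖) atTop (𝓝 0) := by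
          have hbin := (hb i n).norm
          rw [if_neg (Finset.mem_Iio.1 hi).ne, norm_zero] at hbin
          refine squeeze_zero (fun _ => norm_nonneg _) (fun s => ?_)
            (g := fun s => ‖g s i - b s i‖ * ‖b s n‖ + ‖inner ℂ (b s i) (b s n)‖) ?_
          · calc ‖inner ℂ (g s i) (b s n)‖
                = ‖inner ℂ (g s i - b s i) (b s n) + inner ℂ (b s i) (b s n)‖ := by
                  rw [← inner_add_left, sub_add_cancel]
              _ ≤ _ := (norm_add_le _ _).trans (by gcongr; exact norm_inner_le_norm _ _)
          · simpa using (h1.mul (hb1 n)).add hbin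
        simpa using (hin.div (h2.pow 2) (by norm_num)).mul h2
      refine squeeze_zero (fun _ => norm_nonneg _) (fun s => ?_)
        (by simpa using tendsto_finsetSum _ hterm)
      have hdef := InnerProductSpace.gramSchmidt_def'' ℂ (b s) n
      have : b s n - g s n = ∑ i ∈ Finset.Iio n,
          (inner ℂ (g s i) (b s n) / ((‖g s i‖ : ℝ) : ℂ) ^ 2) • g s i :=
        sub_eq_iff_eq_add'.2 hdef
      rw [norm_sub_rev, this]
      refine (norm_sum_le _ _).trans (Finset.sum_le_sum fun i _ => ?_)
      simp [norm_smul]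
    refine ⟨hdiff, ?_⟩
    have : Tendsto (fun s => ‖g s n‖ - ‖b s n‖) atTop (𝓝 0) :=
      squeeze_zero_norm (fun s => abs_norm_sub_norm_le _ _) hdiff
    simpa using this.add (hb1 n)
  refine ⟨fun s i => ((‖g s i‖ : ℝ) : ℂ)⁻¹ • g s i, ?_, fun i => ?_⟩
  · have hne : ∀ i, ∀ᶠ s in atTop, g s i ≠ 0 := fun i =>
      ((key i).2.eventually_ne one_ne_zero).mono fun s hs h => hs (by rw [h, norm_zero])
    filter_upwards [eventually_all.2 hne] with s hs
    refine ⟨fun i => ?_, fun i j hij => ?_⟩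
    · rw [norm_smul, norm_inv, Complex.norm_real, norm_norm,
        inv_mul_cancel₀ (norm_ne_zero_iff.2 (hs i))]
    · dsimp only
      rw [inner_smul_left, inner_smul_right, InnerProductSpace.gramSchmidt_orthogonal ℂ (b s) hij]
      simp
  · have h1 : Tendsto (fun s => |‖g s i‖⁻¹ - 1| * ‖g s i‖ + ‖g s i - b s i‖) atTop (𝓝 0) := by
      have := ((((key i).2.inv₀ one_ne_zero).sub_const 1).abs.mul (key i).2).add (key i).1
      simpa using this
    refine squeeze_zero (fun _ => norm_nonneg _) (fun s => ?_) h1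
    calc ‖((‖g s i‖ : ℝ) : ℂ)⁻¹ • g s i - b s i‖
        = ‖((‖g s i‖⁻¹ - 1 : ℝ) : ℂ) • g s i + (g s i - b s i)‖ := by
          congr 1; push_cast; rw [sub_smul, one_smul]; abel
      _ ≤ _ := (norm_add_le _ _).trans (by rw [norm_smul, Complex.norm_real, Real.norm_eq_abs])

/-- Orthonormal vectors are √2 apart, so balls of radius 1/2 around them are disjoint. -/
theorem countable_of_orthonormal {H : Type*} [NormedAddCommGroup H] [InnerProductSpace ℂ H]
    [TopologicalSpace.SeparableSpace H] {ι : Type*} {v : ι → H} (hv : Orthonormal ℂ v) :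
    Countable ι := by
  have hd : (Set.univ : Set ι).PairwiseDisjoint fun i => Metric.ball (v i) (1 / 2) := by
    intro i _ j _ hij
    refine Metric.ball_disjoint_ball ?_
    have h : ‖v i - v j‖ ^ 2 = 2 := by
      rw [@norm_sub_sq ℂ, hv.2 hij, hv.1 i, hv.1 j]; norm_num
    rw [dist_eq_norm]
    nlinarith [norm_nonneg (v i - v j)]
  exact Set.countable_univ_iff.1 (hd.countable_of_isOpen (fun _ _ => Metric.isOpen_ball)
    fun i _ => ⟨v i, Metric.mem_ball_self (by norm_num)⟩)

/-- A finite orthonormal family in a separable infinite-dimensional Hilbert space is the beginning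
of a Hilbert basis. -/
theorem exists_hilbertBasis_nat {H : Type*} [NormedAddCommGroup H] [InnerProductSpace ℂ H]
    [CompleteSpace H] [TopologicalSpace.SeparableSpace H] (hH : ¬FiniteDimensional ℂ H) {d : ℕ}
    {v : Fin d → H} (hv : Orthonormal ℂ v) : ∃ b : HilbertBasis ℕ ℂ H, ∀ i : Fin d, b i = v i := by
  obtain ⟨w, b, hvw, hb⟩ := hv.toSubtypeRange.exists_hilbertBasis_extension
  have := countable_of_orthonormal b.orthonormal
  have : Infinite w := by
    refine not_finite_iff_infinite.1 fun hfin => hH ?_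
    have := Fintype.ofFinite w
    exact b.toOrthonormalBasis.toBasis.finiteDimensional_of_finite
  have := Encodable.ofCountable w
  have := Denumerable.ofEncodableOfInfinite w
  -- The given vectors are to occupy the first d places; since both index sets are countably
  -- infinite, this partial enumeration extends to a bijection.
  let f : {n : ℕ | n < d} ↪ w := ⟨fun n => ⟨v ⟨n, n.2⟩, hvw ⟨_, rfl⟩⟩, fun m n h => by
    have := hv.linearIndependent.injective (Subtype.ext_iff.1 h)
    exact Subtype.ext (Fin.mk.inj_iff.1 this)⟩
  obtain ⟨g, hg⟩ := Cardinal.extend_function_of_lt f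
    ((Cardinal.lt_aleph0_of_finite _).trans_eq Cardinal.mk_nat.symm)
    ⟨(Denumerable.eqv w).symm⟩
  refine ⟨HilbertBasis.mk (b.orthonormal.comp g g.injective) ?_, fun i => ?_⟩
  · rw [g.surjective.range_comp, b.dense_span]
  · rw [HilbertBasis.coe_mk, Function.comp_apply, hg ⟨i, i.2⟩, hb]
    rfl

/-- Finite orthonormal families of the same size in two separable infinite-dimensional Hilbert
spaces are related by a unitary operator. -/
theorem exists_linearIsometryEquiv_apply_eq {H H' : Type*} [NormedAddCommGroup H]
    [InnerProductSpace ℂ H] [CompleteSpace H] [TopologicalSpace.SeparableSpace H]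
    [NormedAddCommGroup H'] [InnerProductSpace ℂ H'] [CompleteSpace H']
    [TopologicalSpace.SeparableSpace H'] (hH : ¬FiniteDimensional ℂ H)
    (hH' : ¬FiniteDimensional ℂ H') {d : ℕ} {o : Fin d → H} {o' : Fin d → H'}
    (ho : Orthonormal ℂ o) (ho' : Orthonormal ℂ o') :
    ∃ V : H ≃ₗᵢ[ℂ] H', ∀ i, V (o i) = o' i := by
  obtain ⟨b, hb⟩ := exists_hilbertBasis_nat hH ho
  obtain ⟨b', hb'⟩ := exists_hilbertBasis_nat hH' ho'
  refine ⟨b.repr.trans b'.repr.symm, fun i => ?_⟩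
  rw [← hb, ← hb', LinearIsometryEquiv.trans_apply, b.repr_self, b'.repr_symm_single]

section UnitaryLimit

variable {H : ℕ → Type*} [∀ s, NormedAddCommGroup (H s)] [∀ s, InnerProductSpace ℂ (H s)]
  [∀ s, CompleteSpace (H s)] [∀ s, TopologicalSpace.SeparableSpace (H s)]
  {H' : Type*} [NormedAddCommGroup H'] [InnerProductSpace ℂ H'] [CompleteSpace H']
  [TopologicalSpace.SeparableSpace H']

/-- Finite families whose Gram matrices converge also converge in norm, up to unitary
equivalence. -/
theorem eventually_exists_linearIsometryEquiv (hH : ∀ s, ¬FiniteDimensional ℂ (H s))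
    (hH' : ¬FiniteDimensional ℂ H') {N : ℕ} {ψ : ∀ s, Fin N → H s} {ψ' : Fin N → H'}
    (hψ : ∀ i j, Tendsto (fun s => inner ℂ (ψ s i) (ψ s j)) atTop (𝓝 (inner ℂ (ψ' i) (ψ' j))))
    {ε : ℝ} (hε : 0 < ε) :
    ∀ᶠ s in atTop, ∃ V : H s ≃ₗᵢ[ℂ] H', ∀ j, ‖V (ψ s j) - ψ' j‖ ≤ ε := by
  classical
  let L : ∀ s, (Fin N → ℂ) →ₗ[ℂ] H s := fun s => Fintype.linearCombination ℂ (ψ s)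
  let L' : (Fin N → ℂ) →ₗ[ℂ] H' := Fintype.linearCombination ℂ ψ'
  have hL : ∀ x y, Tendsto (fun s => inner ℂ (L s x) (L s y)) atTop
      (𝓝 (inner ℂ (L' x) (L' y))) := by
    intro x y
    simp only [L, L', Fintype.linearCombination_apply, sum_inner, inner_sum, inner_smul_left,
      inner_smul_right]
    exact tendsto_finsetSum _ fun i _ => (tendsto_finsetSum _ fun j _ =>
      (hψ j i).const_mul _).const_mul _
  let U : Submodule ℂ H' := LinearMap.range L'
  let b := stdOrthonormalBasis ℂ U
  -- Coefficient vectors y whose combinations of the limit vectors form an orthonormal basis of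
  -- their span. The same combinations at level s are almost orthonormal.
  choose y hy using fun a => (b a).2
  have hyo : Orthonormal ℂ fun a => L' (y a) := by
    have := b.orthonormal.comp_linearIsometry U.subtypeₗᵢ
    convert this using 2 with a
    exact hy a
  obtain ⟨o, ho, hoL⟩ := exists_orthonormal_of_tendsto_inner (b := fun s a => L s (y a))
    fun i j => by
      have := hL (y i) (y j)
      rwa [orthonormal_iff_ite.1 hyo i j] at this
  let e : Fin N → Fin (Module.finrank ℂ U) → ℂ := fun j a =>
    b.repr ⟨ψ' j, Pi.single j 1, by simp [L']⟩ a
  -- The limit vectors may be linearly dependent. Each z_j is a linear relation among them, so the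
  -- same combination at level s tends to 0 in norm.
  let z : Fin N → Fin N → ℂ := fun j => Pi.single j 1 - ∑ a, e j a • y a
  have he : ∀ j, ψ' j = ∑ a, e j a • L' (y a) := by
    intro j
    have := congrArg (fun v : U => (v : H'))
      (b.sum_repr ⟨ψ' j, Pi.single j 1, by simp [L']⟩)
    simp only [AddSubmonoidClass.coe_finsetSum, Submodule.coe_smul] at this
    rw [← this]
    exact Finset.sum_congr rfl fun a _ => by rw [hy a]
  have hz' : ∀ j, L' (z j) = 0 := by
    intro j
    simp only [z, map_sub, map_sum, map_smul, ← he j]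
    simp [L']
  have hz : ∀ j, Tendsto (fun s => ‖L s (z j)‖) atTop (𝓝 0) := by
    intro j
    have := (hL (z j) (z j)).norm.sqrt
    rw [hz' j] at this
    simpa [inner_self_eq_norm_sq_to_K] using this
  have hsmall : ∀ j, ∀ᶠ s in atTop,
      ‖L s (z j)‖ + ∑ a, ‖e j a‖ * ‖o s a - L s (y a)‖ < ε := by
    intro j
    have := (hz j).add (tendsto_finsetSum Finset.univ fun a _ => (hoL a).const_mul ‖e j a‖)
    simp only [mul_zero, Finset.sum_const_zero, add_zero] at this
    exact this.eventually_lt_const hε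
  filter_upwards [ho, eventually_all.2 hsmall] with s hos hs
  obtain ⟨V, hV⟩ := exists_linearIsometryEquiv_apply_eq (hH s) hH' hos hyo
  refine ⟨V, fun j => le_trans ?_ (hs j).le⟩
  have hdec : ψ s j = L s (z j) + ∑ a, e j a • L s (y a) := by
    simp only [z, map_sub, map_sum, map_smul]
    simp [L]
  have hid : V (ψ s j) - ψ' j
      = V (L s (z j)) + ∑ a, e j a • V (L s (y a) - o s a) := by
    rw [hdec, he j]
    simp only [map_add, map_sum, map_smul, map_sub, hV, smul_sub, Finset.sum_sub_distrib]
    abel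
  rw [hid]
  refine (norm_add_le _ _).trans (add_le_add (V.norm_map _).le
    ((norm_sum_le _ _).trans (Finset.sum_le_sum fun a _ => ?_)))
  rw [norm_smul, V.norm_map, norm_sub_rev]

/-- Families whose Gram matrices converge also converge in norm, up to unitary equivalence. -/
theorem exists_linearIsometryEquiv_tendsto (hH : ∀ s, ¬FiniteDimensional ℂ (H s))
    (hH' : ¬FiniteDimensional ℂ H') {ι : Type*} {ψ : ∀ s, ι → H s} {ψ' : ι → H'}
    (hψ : ∀ i j, Tendsto (fun s => inner ℂ (ψ s i) (ψ s j)) atTop (𝓝 (inner ℂ (ψ' i) (ψ' j)))) :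
    ∃ V : ∀ s, H s ≃ₗᵢ[ℂ] H', ∀ i, Tendsto (fun s => V s (ψ s i)) atTop (𝓝 (ψ' i)) := by
  classical
  have hV₀ : ∀ s, Nonempty (H s ≃ₗᵢ[ℂ] H') := fun s =>
    let ⟨V, _⟩ := exists_linearIsometryEquiv_apply_eq (hH s) hH' (d := 0) (o := Fin.elim0)
      (o' := Fin.elim0) ⟨fun i => i.elim0, fun i => i.elim0⟩ ⟨fun i => i.elim0, fun i => i.elim0⟩
    ⟨V⟩
  rcases isEmpty_or_nonempty ι with hι | hι
  · exact ⟨fun s => (hV₀ s).some, fun i => isEmptyElim i⟩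
  have : TopologicalSpace.SeparableSpace (Set.range ψ') :=
    have := UniformSpace.secondCountable_of_separable H'
    inferInstance
  choose F hF using fun n => (TopologicalSpace.denseSeq (Set.range ψ') n).2
  have hdense : ∀ i, ∀ ε > 0, ∃ n, ‖ψ' i - ψ' (F n)‖ < ε := by
    intro i ε hε
    obtain ⟨n, hn⟩ := (TopologicalSpace.denseRange_denseSeq (Set.range ψ')).exists_dist_lt
      ⟨ψ' i, i, rfl⟩ hε
    refine ⟨n, ?_⟩
    rwa [Subtype.dist_eq, dist_eq_norm, ← hF n] at hn
  let P : ℕ → ℕ → Prop := fun s N => ∃ V : H s ≃ₗᵢ[ℂ] H', ∀ j < N,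
    ‖V (ψ s (F j)) - ψ' (F j)‖ ≤ 1 / ((N : ℝ) + 1)
  have hP₀ : ∀ s, P s 0 := fun s => ⟨(hV₀ s).some, fun j hj => (Nat.not_lt_zero j hj).elim⟩
  have hP : ∀ N, ∀ᶠ s in atTop, P s N := by
    intro N
    filter_upwards [eventually_exists_linearIsometryEquiv hH hH' (N := N)
      (ψ := fun s j => ψ s (F j)) (ψ' := fun j => ψ' (F j)) (fun i j => hψ _ _)
      (Nat.one_div_pos_of_nat (α := ℝ) (n := N))] with s hs
    obtain ⟨V, hV⟩ := hs
    exact ⟨V, fun j hj => hV ⟨j, hj⟩⟩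
  -- Diagonal choice: at level s the unitary handles as many vectors of the dense sequence, to as
  -- high an accuracy, as possible with N ≤ s.
  let n : ℕ → ℕ := fun s => Nat.findGreatest (P s) s
  have hn : Tendsto n atTop atTop := by
    refine tendsto_atTop.2 fun N => ?_
    filter_upwards [hP N, eventually_ge_atTop N] with s hs hNs
    exact Nat.le_findGreatest hNs hs
  choose V hV using fun s => Nat.findGreatest_spec (P := P s) (Nat.zero_le s) (hP₀ s)
  refine ⟨V, fun i => ?_⟩
  rw [Metric.tendsto_nhds]
  intro ε hε
  obtain ⟨k, hk⟩ := hdense i (ε / 4) (by positivity)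
  -- Distances are determined by Gram matrices, so approximation by the dense sequence in the limit
  -- space carries over to large s.
  have hclose : ∀ᶠ s in atTop, ‖ψ s i - ψ s (F k)‖ < ε / 4 := by
    have h : Tendsto (fun s => √‖inner ℂ (ψ s i - ψ s (F k)) (ψ s i - ψ s (F k))‖) atTop
        (𝓝 (√‖inner ℂ (ψ' i - ψ' (F k)) (ψ' i - ψ' (F k))‖)) := by
      simp only [inner_sub_left, inner_sub_right]
      exact (((hψ _ _).sub (hψ _ _)).sub ((hψ _ _).sub (hψ _ _))).norm.sqrt
    simp only [inner_self_eq_norm_sq_to_K, norm_pow, Complex.coe_algebraMap, Complex.norm_real,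
      norm_norm, Real.sqrt_sq (norm_nonneg _)] at h
    exact h.eventually_lt_const hk
  have hsmall : ∀ᶠ s in atTop, 1 / ((n s : ℝ) + 1) < ε / 4 :=
    (tendsto_one_div_add_atTop_nhds_zero_nat.comp hn).eventually_lt_const (by positivity)
  filter_upwards [hclose, hsmall, hn.eventually_gt_atTop k] with s h1 h2 h3
  have h4 := hV s k h3
  rw [dist_eq_norm]
  calc ‖V s (ψ s i) - ψ' i‖
      = ‖V s (ψ s i - ψ s (F k)) + (V s (ψ s (F k)) - ψ' (F k)) - (ψ' i - ψ' (F k))‖ := by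
        rw [map_sub]; congr 1; abel
    _ ≤ ‖ψ s i - ψ s (F k)‖ + ‖V s (ψ s (F k)) - ψ' (F k)‖ + ‖ψ' i - ψ' (F k)‖ := by
        refine (norm_sub_le _ _).trans ?_
        gcongr
        refine (norm_add_le _ _).trans ?_
        rw [(V s).norm_map]
    _ < ε := by
        have : ‖V s (ψ s (F k)) - ψ' (F k)‖ ≤ 1 / ((n s : ℝ) + 1) := h4
        linarith

end UnitaryLimit

/-! ### Inner products and infinite dimension of the one-particle spaces -/

section LebesgueSpace

variable {X : Type*} [MeasurableSpace X] {μ : Measure X}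

theorem inner_toL2 {f g : X → ℂ} (hf : MemLp f 2 μ) (hg : MemLp g 2 μ) :
    inner ℂ (toL2 μ f) (toL2 μ g) = ∫ x, conj (f x) * g x ∂μ := by
  rw [toL2, dif_pos hf, toL2, dif_pos hg, L2.inner_def]
  refine integral_congr_ae ?_
  filter_upwards [hf.coeFn_toLp, hg.coeFn_toLp] with x h1 h2
  rw [h1, h2, RCLike.inner_apply, mul_comm]

/-- Indicators of the disjoint sets, cut down to finite positive measure, are orthogonal and
nonzero. -/
theorem not_finiteDimensional_Lp [SigmaFinite μ] {A : ℕ → Set X}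
    (hA : ∀ j, MeasurableSet (A j)) (hd : Pairwise fun i j => Disjoint (A i) (A j))
    (hpos : ∀ j, μ (A j) ≠ 0) : ¬FiniteDimensional ℂ (Lp ℂ 2 μ) := by
  choose S hS hSA hS0 hStop using fun j =>
    Measure.exists_subset_measure_lt_top (hA j) (pos_iff_ne_zero.2 (hpos j))
  have hin : ∀ i j, inner ℂ (indicatorConstLp 2 (hS i) (hStop i).ne (1 : ℂ))
      (indicatorConstLp 2 (hS j) (hStop j).ne (1 : ℂ)) = ((μ.real (S i ∩ S j) : ℝ) : ℂ) := fun i j =>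
    L2.inner_indicatorConstLp_one_indicatorConstLp_one _ _ _ _
  have hli : LinearIndependent ℂ fun j => indicatorConstLp 2 (hS j) (hStop j).ne (1 : ℂ) := by
    refine linearIndependent_of_ne_zero_of_inner_eq_zero (fun j h => ?_) fun i j hij => ?_
    · have := hin j j
      rw [h, inner_zero_left, Set.inter_self, eq_comm, Complex.ofReal_eq_zero] at this
      exact ((measureReal_eq_zero_iff (hStop j).ne).1 this ▸ hS0 j).ne rfl
    · refine (hin i j).trans ?_
      rw [((hd hij).mono (hSA i) (hSA j)).inter_eq, measureReal_empty, Complex.ofReal_zero]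
  exact fun h => not_finite_iff_infinite.2 inferInstance hli.finite

theorem not_finiteDimensional_Lp_shellMeasure_prod (m : ℝ) {α : Type*} [MeasurableSpace α]
    {τ : Measure α} [SigmaFinite τ] [NeZero τ] :
    ¬FiniteDimensional ℂ (Lp ℂ 2 ((shellMeasure m).prod τ)) := by
  -- Open unit cubes with positive coordinates: they avoid the apex, so the density is positive on
  -- them for m = 0 as well.
  let A : ℕ → Set (Fin 3 → ℝ) := fun j =>
    Set.univ.pi fun _ => Set.Ioo ((j : ℝ)) ((j : ℝ) + 1)
  have hA : ∀ j, MeasurableSet (A j) := fun j =>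
    MeasurableSet.univ_pi fun _ => measurableSet_Ioo
  refine not_finiteDimensional_Lp (A := fun j => A j ×ˢ Set.univ)
    (fun j => (hA j).prod MeasurableSet.univ) (fun i j hij => ?_) fun j => ?_
  · refine Set.disjoint_left.2 fun x hi hj => hij ?_
    have h1 := hi.1 0 trivial
    have h2 := hj.1 0 trivial
    have h3 : (i : ℝ) < j + 1 := h1.1.trans h2.2
    have h4 : (j : ℝ) < i + 1 := h2.1.trans h1.2
    norm_cast at h3 h4
    omega
  · rw [Measure.prod_prod]
    refine mul_ne_zero (fun h => ?_) (by simpa using NeZero.ne τ)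
    change (volume.withDensity fun k => ENNReal.ofReal (shellDensity m k)) (A j) = 0 at h
    rw [withDensity_apply_eq_zero (measurable_shellDensity m).ennreal_ofReal,
      Set.inter_eq_right.2, Real.volume_pi_Ioo] at h
    · simp at h
    · intro k hk
      have hk0 : 0 < k 0 := (Nat.cast_nonneg j).trans_lt (hk 0 trivial).1
      have : 0 < onShell m k 0 := by
        have : 0 < m ^ 2 + ∑ i, k i ^ 2 := by
          rw [Fin.sum_univ_three]
          positivity
        simpa [onShell] using this
      refine (ENNReal.ofReal_pos.2 ?_).ne'
      rw [shellDensity]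
      positivity

end LebesgueSpace

/-- The one-particle vectors converge in norm, up to unitary equivalence. -/
theorem exists_linearIsometryEquiv_tendsto_oneParticle {κ : ℝ} (hκ : 0 < κ)
    {B₀ : (Fin 4 → ℝ) → Matrix (Fin 4) (Fin 4) ℝ}
    (hB₀ : IsBoostFamily 0 ![1, 0, 0, 1] B₀)
    {B : ℕ → (Fin 4 → ℝ) → Matrix (Fin 4) (Fin 4) ℝ}
    (hB : ∀ s, 0 < s → IsBoostFamily (plMass κ s) ![plMass κ s, 0, 0, 0] (B s))
    (T : (s : ℕ) → OrthonormalBasis (Fin (2 * s + 1)) ℝ (stf s))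
    (ν : Measure (Fin 4 → ℝ)) [IsLocallyFiniteMeasure ν] :
    ∃ V : (s : ℕ) →
        Lp ℂ 2 ((shellMeasure (plMass κ s)).prod
          (Measure.count : Measure (Fin (2 * s + 1)))) ≃ₗᵢ[ℂ]
        Lp ℂ 2 ((shellMeasure 0).prod circleMeasure),
      ∀ F, IsTestFunction F →
        Tendsto
          (fun s : ℕ => V s (toL2 _ (oneParticle (plMass κ s) ν
            (rescaledIntertwiner (plMass κ s) s (B s) (T s)) F)))
          atTop (𝓝 (toL2 _ (oneParticle 0 ν (standardIntertwiner κ B₀) F))) := by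
  have : Fact ((2 : ENNReal) ≠ ⊤) := ⟨ENNReal.ofNat_ne_top⟩
  obtain ⟨V, hV⟩ := exists_linearIsometryEquiv_tendsto
    (H := fun s => Lp ℂ 2 ((shellMeasure (plMass κ s)).prod
      (Measure.count : Measure (Fin (2 * s + 1)))))
    (H' := Lp ℂ 2 ((shellMeasure 0).prod circleMeasure))
    (ι := {F // IsTestFunction F})
    (ψ := fun s F => toL2 _ (oneParticle (plMass κ s) ν
      (rescaledIntertwiner (plMass κ s) s (B s) (T s)) F))
    (ψ' := fun F => toL2 _ (oneParticle 0 ν (standardIntertwiner κ B₀) F))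
    (fun s => not_finiteDimensional_Lp_shellMeasure_prod _)
    (not_finiteDimensional_Lp_shellMeasure_prod _) fun F G => by
      rw [inner_toL2 (memLp_oneParticle (isRegularIntertwiner_standard κ hB₀) F.2)
        (memLp_oneParticle (isRegularIntertwiner_standard κ hB₀) G.2)]
      refine (tendsto_integral_conj_oneParticle_mul (ν := ν) (T := T) hκ hB₀ hB F.2 G.2).congr' ?_
      filter_upwards [eventually_gt_atTop 0] with s hs
      rw [inner_toL2 (memLp_oneParticle (isRegularIntertwiner_rescaled hκ hB T hs) F.2)
        (memLp_oneParticle (isRegularIntertwiner_rescaled hκ hB T hs) G.2)]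
  exact ⟨V, fun F hF => hV ⟨F, hF⟩⟩

end PauliLubanski

end

open PauliLubanski in
theorem corollaryc (κ : ℝ) (hκ : 0 < κ)
    (B₀ : (Fin 4 → ℝ) → Matrix (Fin 4) (Fin 4) ℝ)
    (hB₀ : IsBoostFamily 0 ![1, 0, 0, 1] B₀)
    (B : ℕ → (Fin 4 → ℝ) → Matrix (Fin 4) (Fin 4) ℝ)
    (hB : ∀ s, 0 < s → IsBoostFamily (plMass κ s) ![plMass κ s, 0, 0, 0] (B s))
    (T : (s : ℕ) → OrthonormalBasis (Fin (2 * s + 1)) ℝ (stf s))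
    (ν : Measure (Fin 4 → ℝ)) [IsLocallyFiniteMeasure ν] :
    -- the operator factors produce the Köhler factor
    TendstoLocallyUniformlyOn
      (fun (s : ℕ) (x : (Fin 4 → ℂ) × (Fin 3 → ℝ)) =>
        operatorFactor (plMass κ s) s x.1 (onShell (plMass κ s) x.2))
      (fun x => koehlerFactor κ x.1 (onShell 0 x.2)) atTop
      {x | x.1 ∈ stringDirections ∧ mink x.1 (toC (onShell 0 x.2)) ≠ 0} ∧
    -- the two-point kernels converge
    TendstoLocallyUniformlyOn
      (fun (s : ℕ) (x : (Fin 4 → ℂ) × (Fin 4 → ℂ) × (Fin 3 → ℝ)) =>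
        twoPointKernel Measure.count (rescaledIntertwiner (plMass κ s) s (B s) (T s))
          x.1 x.2.1 (onShell (plMass κ s) x.2.2))
      (fun x => twoPointKernel circleMeasure (standardIntertwiner κ B₀)
          x.1 x.2.1 (onShell 0 x.2.2)) atTop
      {x | x.1 ∈ stringDirections ∧ x.2.1 ∈ stringDirections ∧
        mink x.1 (toC (onShell 0 x.2.2)) ≠ 0 ∧ mink x.2.1 (toC (onShell 0 x.2.2)) ≠ 0} ∧
    -- the smeared fields create normalizable one-particle vectors
    (∀ F, IsTestFunction F →
      (∀ s, 0 < s → MemLp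
        (oneParticle (plMass κ s) ν (rescaledIntertwiner (plMass κ s) s (B s) (T s)) F) 2
        ((shellMeasure (plMass κ s)).prod Measure.count)) ∧
      MemLp (oneParticle 0 ν (standardIntertwiner κ B₀) F) 2
        ((shellMeasure 0).prod circleMeasure)) ∧
    -- all vacuum expectation values of the fields on Fock space converge
    (∀ Fs : List ((Fin 4 → ℝ) → (Fin 4 → ℝ) → ℂ), (∀ F ∈ Fs, IsTestFunction F) →
      Tendsto
        (fun s : ℕ => wightman (plMass κ s) Measure.count ν
          (rescaledIntertwiner (plMass κ s) s (B s) (T s)) Fs)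
        atTop (𝓝 (wightman 0 circleMeasure ν (standardIntertwiner κ B₀) Fs))) ∧
    -- the one-particle vectors converge in norm, up to unitary equivalence
    ∃ V : (s : ℕ) →
        Lp ℂ 2 ((shellMeasure (plMass κ s)).prod
          (Measure.count : Measure (Fin (2 * s + 1)))) ≃ₗᵢ[ℂ]
        Lp ℂ 2 ((shellMeasure 0).prod circleMeasure),
      ∀ F, IsTestFunction F →
        Tendsto
          (fun s : ℕ => V s (toL2 _ (oneParticle (plMass κ s) ν
            (rescaledIntertwiner (plMass κ s) s (B s) (T s)) F)))
          atTop (𝓝 (toL2 _ (oneParticle 0 ν (standardIntertwiner κ B₀) F))) := by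
  refine ⟨tendstoLocallyUniformlyOn_operatorFactor hκ,
    tendstoLocallyUniformlyOn_twoPointKernel hκ hB₀ hB T,
    fun F hF => ⟨fun s hs => memLp_oneParticle (isRegularIntertwiner_rescaled hκ hB T hs) hF,
      memLp_oneParticle (isRegularIntertwiner_standard κ hB₀) hF⟩,
    fun Fs hFs => tendsto_wightman hκ hB₀ hB T ν Fs hFs,
    exists_linearIsometryEquiv_tendsto_oneParticle hκ hB₀ hB T ν⟩
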